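/- Let $L_1,L_2>0$ and let $\mathbb T^2=(\mathbb R/L_1\mathbb Z)\times(\mathbb R/L_2\mathbb Z)$. There is a constant $C>0$ depending only on $L_1,L_2$ with the following property. For $B,\mu>0$ set $$T_0(B)=\int_{B^2}^{4B^2}\frac{dy}{Cy+Cy^3},\qquad T_1(B)=\frac{1}{4C(2\mu+4C+64CB^4)B+4C(2\mu+4C+64CB^4)^{1/2}}.$$ Let $\mathbf v\in L^\infty([0,\infty);W^{1,\infty}(\mathbb T^2))$ be a vector field on $\mathbb T^2$ (i.e. bounded and Lipschitz in space uniformly in time) with $\operatorname{div}\mathbf v=0$. Let $\mathcal S_{s,t}$, $0\le s\le t$, be the solution operator of $\partial_t f+\mathbf v\cdot\nabla f+\Delta^2 f=0$, and let $$\tau^*=\inf\{t\ge 0:\ \|\mathcal S_{s,s+t}\|_{\mathring L^2\to\mathring L^2}\le \tfrac12\ \text{ for all } s\ge 0\}$$ be the dissipation time of $\mathbf v$, where $\mathring L^2$ is the space of mean-free functions in $L^2(\mathbb T^2)$. Let $\mathbb P$ be the projection $\phi\mapsto\phi-\bar\phi$ of $L^2(\mathbb T^2)$ onto $\mathring L^2$,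 where $\bar\phi$ is the average of $\phi$. A mild solution on $[0,T]$, $0<T<\infty$, of the advective Kuramoto–Sivashinsky equation $\partial_t\phi+\mathbf v\cdot\nabla\phi+\frac12|\nabla\phi|^2=-\Delta^2\phi-\Delta\phi$ with data $\phi_0\in L^2(\mathbb T^2)$ is a function $\phi\in C([0,T];L^2(\mathbb T^2))$ such that $\nabla\phi$ is integrable on $(0,T)$ with values in $L^2$, $\sup_{0<t\le T}t^{1/4}\|\nabla\phi(t)\|_{L^2}<\infty$ and, with $\mathcal L=\Delta^2+\Delta$, $$\phi(t)=e^{-t\mathcal L}\phi_0-\frac12\int_0^te^{-(t-\tau)\mathcal L}|\nabla\phi(\tau)|^2\,d\tau-\int_0^te^{-(t-\tau)\mathcal L}(\mathbf v(\tau)\cdot\nabla\phi(\tau))\,d\tau\qquad(0\le t\le T)$$ (the two integrals being taken together as one Bochner integral in $L^2$). Let $\phi_0\in L^2(\mathbb T^2)$ and $B,\mu>0$ be arbitrary, and suppose that $$\tau^*\le\min\Big(T_0(B),\,T_1(B),\,\frac1{4\mu}\Big)$$ and that $\|\mathbb P\phi_0\|_{L^2}\le B$ or, more generally, that $\|\mathbb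 P\phi(t_0)\|_{L^2}\le B$ for some mild solution $\phi$ on some $[0,T]$ with data $\phi_0$ and some $t_0\in[0,T]$. Then the mild solution with data $\phi_0$ exists on $[0,\infty)$: there is a bounded function $\Phi:[0,\infty)\to L^2(\mathbb T^2)$ which is a mild solution on $[0,T]$ with data $\phi_0$ for every $T>0$, and every mild solution with data $\phi_0$ on any $[0,T]$ coincides with $\Phi$ on $[0,T]$. No restriction is made on $L_1,L_2$, so that growing modes of the linearized operator are allowed. -/

import Mathlib

open MeasureTheory Set
open scoped ENNReal NNReal

noncomputable section

namespace AdvectiveKSE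

/-- The flat two-dimensional torus with periods `L₁` and `L₂`. -/
abbrev Torus (L₁ L₂ : ℝ) : Type := AddCircle L₁ × AddCircle L₂

variable (L₁ L₂ : ℝ) [Fact (0 < L₁)] [Fact (0 < L₂)]

/-- Real-valued square integrable functions on the torus, for Lebesgue measure of total mass
`L₁ * L₂`. -/
abbrev L2 : Type := Lp ℝ 2 (volume : Measure (Torus L₁ L₂))

/-- The frequency vector `2π (k₁ / L₁, k₂ / L₂)`. -/
def freq (L₁ L₂ : ℝ) (k : ℤ × ℤ) : Fin 2 → ℝ :=
  ![2 * Real.pi * (k.1 / L₁), 2 * Real.pi * (k.2 / L₂)]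

/-- The squared Euclidean length of the frequency vector. -/
def freqSq (L₁ L₂ : ℝ) (k : ℤ × ℤ) : ℝ := ∑ j, freq L₁ L₂ k j ^ 2

/-- The Fourier symbol of `Δ² + Δ`. -/
def kseSymbol (L₁ L₂ : ℝ) (k : ℤ × ℤ) : ℝ := freqSq L₁ L₂ k ^ 2 - freqSq L₁ L₂ k

/-- The Fourier symbol of `Δ²`. -/
def bilaplaceSymbol (L₁ L₂ : ℝ) (k : ℤ × ℤ) : ℝ := freqSq L₁ L₂ k ^ 2

/-- The character `x ↦ exp (i (freq k) · x)` of the torus. -/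
def character (L₁ L₂ : ℝ) (k : ℤ × ℤ) (x : Torus L₁ L₂) : ℂ := fourier k.1 x.1 * fourier k.2 x.2

variable {L₁ L₂}

/-- The Fourier coefficients of an integrable function, normalized so that the Fourier series
of `g` is `∑ fourierCoeff2 g k * character k`. -/
def fourierCoeff2 (g : Torus L₁ L₂ → ℝ) (k : ℤ × ℤ) : ℂ :=
  (1 / (L₁ * L₂) : ℝ) * ∫ x, (starRingEnd ℂ) (character L₁ L₂ k x) * (g x : ℂ)

/-- The real part of the `k`-th term of the Fourier series of `g`. As `g` is real, the sum of
these over all `k` is the Fourier series of `g`. -/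
def fourierMode (g : Torus L₁ L₂ → ℝ) (k : ℤ × ℤ) : L2 L₁ L₂ :=
  ContinuousMap.toLp 2 volume ℝ
    ⟨fun x : Torus L₁ L₂ => (fourierCoeff2 g k * character L₁ L₂ k x).re, by
      unfold character; fun_prop⟩

/-- The function with Fourier coefficients `exp (-t σ(k)) * ĝ(k)`: the semigroup with generator
`-σ` applied to `g`. For `σ = kseSymbol` or `σ = bilaplaceSymbol` the series converges in `L²`
when `t > 0` and `g` is integrable, and when `t = 0` and `g` is square integrable. -/
def semigroup (σ : ℤ × ℤ → ℝ) (t : ℝ) (g : Torus L₁ L₂ → ℝ) : L2 L₁ L₂ :=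
  ∑' k, Real.exp (-t * σ k) • fourierMode g k

/-- `g` is the (distributional) gradient of `u`, and it is square integrable. -/
def HasGradient (u : L2 L₁ L₂) (g : Fin 2 → L2 L₁ L₂) : Prop :=
  ∀ j k, fourierCoeff2 (g j) k = Complex.I * (freq L₁ L₂ k j : ℂ) * fourierCoeff2 u k

/-- `u` is a mild solution on the time interval `[s, T]`, with data `u₀` at time `s`, of
`∂ₜ u + σ(D) u = F(t, ∇u)`, where `σ(D)` is the Fourier multiplier with symbol `σ`: it is
continuous with values in `L²`, `∇u` is integrable,
`sup_{s < t ≤ T} (t - s)^{1/4} ‖∇u(t)‖ < ∞`, and Duhamel's formula holds at each time with a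
Bochner integral in `L²`. -/
def IsMildSolution (σ : ℤ × ℤ → ℝ) (F : ℝ → (Fin 2 → L2 L₁ L₂) → Torus L₁ L₂ → ℝ)
    (s T : ℝ) (u₀ : L2 L₁ L₂) (u : ℝ → L2 L₁ L₂) : Prop :=
  ContinuousOn u (Icc s T) ∧
  ∃ G : ℝ → Fin 2 → L2 L₁ L₂,
    (∀ t ∈ Ioc s T, HasGradient (u t) (G t)) ∧
    IntegrableOn G (Ioc s T) ∧
    (∃ M : ℝ, ∀ t ∈ Ioc s T, ∀ j, (t - s) ^ (1 / 4 : ℝ) * ‖G t j‖ ≤ M) ∧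
    ∀ t ∈ Icc s T,
      IntervalIntegrable (fun τ => semigroup σ (t - τ) (F τ (G τ))) volume s t ∧
      u t = semigroup σ (t - s) u₀ + ∫ τ in s..t, semigroup σ (t - τ) (F τ (G τ))

/-- `u` is a mild solution, on `[0, T]` and with data `φ₀`, of the advective
Kuramoto-Sivashinsky equation `∂ₜ φ + v · ∇φ + |∇φ|² / 2 = -Δ² φ - Δ φ`. -/
def IsKSEMildSolution (v : ℝ → Torus L₁ L₂ → EuclideanSpace ℝ (Fin 2)) (T : ℝ)
    (φ₀ : L2 L₁ L₂) (φ : ℝ → L2 L₁ L₂) : Prop :=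
  IsMildSolution (kseSymbol L₁ L₂)
    (fun τ g x => -(1 / 2 * ∑ j, g j x ^ 2) - ∑ j, v τ x j * g j x) 0 T φ₀ φ

/-- `f` is a mild solution, on `[s, T]` and with data `f₀` at time `s`, of the
advection-hyperdiffusion equation `∂ₜ f + v · ∇f + Δ² f = 0`. -/
def IsAdvHyperSolution (v : ℝ → Torus L₁ L₂ → EuclideanSpace ℝ (Fin 2)) (s T : ℝ)
    (f₀ : L2 L₁ L₂) (f : ℝ → L2 L₁ L₂) : Prop :=
  IsMildSolution (bilaplaceSymbol L₁ L₂) (fun τ g x => -∑ j, v τ x j * g j x) s T f₀ f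

/-- `‖S_{s,t}‖ ≤ q` on mean-free `L²` functions, where `S_{s,t}` takes the value at time `s` of
a solution of the advection-hyperdiffusion equation to its value at time `t`. -/
def SolutionOperatorNormLE (v : ℝ → Torus L₁ L₂ → EuclideanSpace ℝ (Fin 2)) (s t q : ℝ) : Prop :=
  ∀ (f₀ : L2 L₁ L₂) (f : ℝ → L2 L₁ L₂), ∫ x, f₀ x = 0 → IsAdvHyperSolution v s t f₀ f →
    ‖f t‖ ≤ q * ‖f₀‖

/-- The dissipation time of `v`: the infimum (`∞` if there is none) of the times `t ≥ 0` with
`‖S_{s,s+t}‖ ≤ 1/2` on mean-free functions, for all `s ≥ 0`. -/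
def dissipationTime (v : ℝ → Torus L₁ L₂ → EuclideanSpace ℝ (Fin 2)) : ℝ≥0∞ :=
  sInf (ENNReal.ofReal '' {t : ℝ | 0 ≤ t ∧ ∀ s, 0 ≤ s → SolutionOperatorNormLE v s (s + t) (1 / 2)})

/-- `v ∈ L^∞([0,∞); W^{1,∞})`: for almost all times, `v` is bounded and Lipschitz continuous in
space, with constants independent of time. -/
def IsLipschitzField (v : ℝ → Torus L₁ L₂ → EuclideanSpace ℝ (Fin 2)) : Prop :=
  AEStronglyMeasurable (fun p : ℝ × Torus L₁ L₂ => v p.1 p.2)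
    ((volume.restrict (Ici (0 : ℝ))).prod volume) ∧
  ∃ K : ℝ≥0, ∀ᵐ t ∂(volume.restrict (Ici (0 : ℝ))), (∀ x, ‖v t x‖ ≤ K) ∧ LipschitzWith K (v t)

/-- `div v = 0` in the sense of distributions, at almost all times. -/
def IsDivergenceFree (v : ℝ → Torus L₁ L₂ → EuclideanSpace ℝ (Fin 2)) : Prop :=
  ∀ᵐ t ∂(volume.restrict (Ici (0 : ℝ))), ∀ k,
    ∑ j, Complex.I * (freq L₁ L₂ k j : ℂ) * fourierCoeff2 (fun x => v t x j) k = 0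

/-- The projection `u ↦ u - (average of u)` onto mean-free functions. -/
def meanFree (u : L2 L₁ L₂) : L2 L₁ L₂ := u - Lp.const 2 volume (⨍ x, u x)

/-- The time `T₀(B)`, for a constant `C`. -/
def timeT0 (C B : ℝ) : ℝ := ∫ y in (B ^ 2)..(4 * B ^ 2), 1 / (C * y + C * y ^ 3)

/-- The time `T₁(B)`, for constants `C` and `μ`. -/
def timeT1 (C μ B : ℝ) : ℝ :=
  1 / (4 * C * (2 * μ + 4 * C + 64 * C * B ^ 4) * B
    + 4 * C * Real.sqrt (2 * μ + 4 * C + 64 * C * B ^ 4))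

end AdvectiveKSE

end

open MeasureTheory Set
open scoped ENNReal NNReal
set_option linter.unusedSectionVars false

noncomputable section

namespace AdvectiveKSE

variable {L₁ L₂ : ℝ} [Fact (0 < L₁)] [Fact (0 < L₂)]

/-! ### Characters and Fourier series on the torus -/

/-! The argument runs on Fourier coefficients. Let N be `sqSum (fluct u)`, that is ‖ℙφ‖²/(L₁L₂), and
let D be `lapSum` of the same coefficients, the corresponding quantity for Δφ. A parameter a ∈ [0,1]
treats two equations at once: a = 1 is Kuramoto–Sivashinsky, a = 0 is advection-hyperdiffusion.

Energy. The transport term is orthogonal to the solution because the field is divergence-free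
(`IsSolenoidal.hasSum_transport`). Interpolation and Agmon's inequality (`exists_agmon`) absorb the
remaining terms and give N' + D ≤ c(N + N³) (`exists_energyIneq`). Starting from N ≤ β², this keeps
N ≤ 4β² for a time of order 1/(1 + β⁴), but it does not prevent growth later.

Decay. Let τ be a time over which the linear flow halves mean-free functions. On [t₀, t₀ + τ] there
is an alternative (`exists_stepBound`). If the integral of D is at least τKβ², with K = 2μ + 4C +
64CB⁴, the dissipation beats the growth and N drops by the factor 1 - 2μτ. If it is smaller, the
difference between φ and the linear flow issued from ℙφ(t₀) is driven by terms that D controls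
(`exists_differenceIneq`). That difference is then at most β/4, the linear flow is at most β/2, and
N drops by the factor (3/4)². The form of T₁ is what makes both cases work for a large constant C
(`exists_isSmall`).

Iteration. N decays geometrically along the times t₀ + nτ. The mean moves at the rate of half the
average of |∇φ|², which is integrable over each step with a bound proportional to β², so its total
displacement is a convergent geometric series (`sol_bound`). The solution therefore stays bounded in
L².

Well-posedness. The gradient G is a fixed point in the norm sup (t - s)^{1/4}‖G(t)‖. The
coefficients of |G|² are bounded by its L¹ norm, hence by a multiple of (t - s)^{-1/2}, and the
semigroup supplies the missing decay in frequency (`contraction`). The local existence time depends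
only on ‖ℙφ‖ (`exists_local_sol`), so the bound above yields a global solution
(`exists_sol_of_bound`); uniqueness is `Sol.unique`. The energy identity is proved away from the
initial time, where the solution is in H² with a summable majorant, by integrating the squared
coefficients term by term; the initial time is reached by continuity of N. -/

lemma area_pos (L₁ L₂ : ℝ) [h₁ : Fact (0 < L₁)] [h₂ : Fact (0 < L₂)] : 0 < L₁ * L₂ :=
  mul_pos h₁.out h₂.out

variable (L₁ L₂) in
/-- Complex-valued square integrable functions on the torus. -/
abbrev LC : Type := Lp ℂ 2 (volume : Measure (Torus L₁ L₂))

variable (L₁ L₂) in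
/-- The character with index `k`, as a continuous map. -/
def charMap (k : ℤ × ℤ) : C(Torus L₁ L₂, ℂ) :=
  ⟨character L₁ L₂ k, by unfold character; fun_prop⟩

lemma character_add (k l : ℤ × ℤ) (x : Torus L₁ L₂) :
    character L₁ L₂ (k + l) x = character L₁ L₂ k x * character L₁ L₂ l x := by
  simp only [character, Prod.fst_add, Prod.snd_add, fourier_add]
  ring

lemma character_neg (k : ℤ × ℤ) (x : Torus L₁ L₂) :
    character L₁ L₂ (-k) x = (starRingEnd ℂ) (character L₁ L₂ k x) := by
  simp only [character, Prod.fst_neg, Prod.snd_neg, fourier_neg, map_mul]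

lemma character_zero (x : Torus L₁ L₂) : character L₁ L₂ 0 x = 1 := by
  simp [character]

lemma norm_character (k : ℤ × ℤ) (x : Torus L₁ L₂) : ‖character L₁ L₂ k x‖ = 1 := by
  rw [character, norm_mul, fourier_apply, fourier_apply, Circle.norm_coe, Circle.norm_coe, mul_one]

lemma continuous_character (k : ℤ × ℤ) : Continuous (character L₁ L₂ k) :=
  (charMap L₁ L₂ k).continuous

/-- For n ≠ 0 a translation by half a wavelength changes the sign of the integrand. -/
lemma integral_fourier_circle (T : ℝ) [hT : Fact (0 < T)] (n : ℤ) :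
    ∫ x : AddCircle T, fourier n x = if n = 0 then (T : ℂ) else 0 := by
  have h : ∫ x : AddCircle T, fourier n x = T • ∫ x : AddCircle T, fourier n x
      ∂AddCircle.haarAddCircle := by
    rw [AddCircle.integral_haarAddCircle, smul_inv_smul₀ hT.out.ne']
  rw [h]
  split_ifs with hn
  · simp [hn]
  · rw [integral_eq_zero_of_add_right_eq_neg (μ := AddCircle.haarAddCircle)
      (fourier_add_half_inv_index hn hT.out), smul_zero]

lemma integral_character (k : ℤ × ℤ) :
    ∫ x, character L₁ L₂ k x = if k = 0 then ((L₁ * L₂ : ℝ) : ℂ) else 0 := by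
  have h : ∫ x, character L₁ L₂ k x =
      (∫ x : AddCircle L₁, fourier k.1 x) * ∫ x : AddCircle L₂, fourier k.2 x :=
    integral_prod_mul (μ := volume) (ν := volume) (fun x : AddCircle L₁ => (fourier k.1 x : ℂ))
      (fun x : AddCircle L₂ => (fourier k.2 x : ℂ))
  rw [h, integral_fourier_circle, integral_fourier_circle]
  obtain ⟨a, b⟩ := k
  by_cases ha : a = 0 <;> by_cases hb : b = 0 <;> simp [ha, hb]

variable (L₁ L₂) in
/-- The star subalgebra of continuous functions generated by the characters. -/
def charSubalgebra : StarSubalgebra ℂ C(Torus L₁ L₂, ℂ) where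
  toSubalgebra := Algebra.adjoin ℂ (range (charMap L₁ L₂))
  star_mem' := by
    change Algebra.adjoin ℂ (range (charMap L₁ L₂)) ≤
      star (Algebra.adjoin ℂ (range (charMap L₁ L₂)))
    refine Algebra.adjoin_le ?_
    rintro _ ⟨n, rfl⟩
    refine Algebra.subset_adjoin ⟨-n, ?_⟩
    ext1 x
    simp only [charMap, ContinuousMap.coe_mk, character_neg, starRingEnd_apply,
      ContinuousMap.star_apply]

lemma charSubalgebra_coe :
    Subalgebra.toSubmodule (charSubalgebra L₁ L₂).toSubalgebra =
      Submodule.span ℂ (range (charMap L₁ L₂)) := by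
  apply Algebra.adjoin_eq_span_of_subset
  refine .trans (fun x ↦ Submonoid.closure_induction (fun _ ↦ id) ⟨0, ?_⟩ ?_) Submodule.subset_span
  · ext z
    simp [charMap, character_zero]
  · rintro _ _ _ _ ⟨m, rfl⟩ ⟨n, rfl⟩
    refine ⟨m + n, ?_⟩
    ext z
    simp [charMap, character_add]

lemma charSubalgebra_separatesPoints : (charSubalgebra L₁ L₂).SeparatesPoints := by
  intro x y hxy
  by_cases h : x.1 = y.1
  · have h2 : x.2 ≠ y.2 := fun h2 => hxy (Prod.ext h h2)
    refine ⟨_, ⟨charMap L₁ L₂ (0, 1), Algebra.subset_adjoin ⟨_, rfl⟩, rfl⟩, ?_⟩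
    simp only [charMap, ContinuousMap.coe_mk, character, fourier_zero, one_mul, fourier_one]
    intro hc
    exact h2 (AddCircle.injective_toCircle (Fact.out : 0 < L₂).ne' (Subtype.coe_injective hc))
  · refine ⟨_, ⟨charMap L₁ L₂ (1, 0), Algebra.subset_adjoin ⟨_, rfl⟩, rfl⟩, ?_⟩
    simp only [charMap, ContinuousMap.coe_mk, character, fourier_zero, mul_one, fourier_one]
    intro hc
    exact h (AddCircle.injective_toCircle (Fact.out : 0 < L₁).ne' (Subtype.coe_injective hc))

/-- Stone–Weierstrass: the span of the characters is a star subalgebra, and the characters (1,0) and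
(0,1) separate points. -/
lemma span_charMap_closure_eq_top :
    (Submodule.span ℂ (range (charMap L₁ L₂))).topologicalClosure = ⊤ := by
  rw [← charSubalgebra_coe]
  exact congr_arg (Subalgebra.toSubmodule <| StarSubalgebra.toSubalgebra ·)
    (ContinuousMap.starSubalgebra_topologicalClosure_eq_top_of_separatesPoints _
      charSubalgebra_separatesPoints)

variable (L₁ L₂) in
/-- The characters, normalized in `L²`. -/
def charLp (k : ℤ × ℤ) : LC L₁ L₂ :=
  ((Real.sqrt (L₁ * L₂))⁻¹ : ℂ) • ContinuousMap.toLp (E := ℂ) 2 volume ℂ (charMap L₁ L₂ k)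

lemma sqrt_area_mul_self : ((Real.sqrt (L₁ * L₂) : ℝ) : ℂ) * (Real.sqrt (L₁ * L₂) : ℝ) =
    ((L₁ * L₂ : ℝ) : ℂ) := by
  rw [← Complex.ofReal_mul, Real.mul_self_sqrt (area_pos L₁ L₂).le]

lemma sqrt_area_ne_zero : ((Real.sqrt (L₁ * L₂) : ℝ) : ℂ) ≠ 0 := by
  exact_mod_cast (Real.sqrt_pos.2 (area_pos L₁ L₂)).ne'

lemma orthonormal_charLp : Orthonormal ℂ (charLp L₁ L₂) := by
  rw [orthonormal_iff_ite]
  intro i j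
  have h : ∀ x, charMap L₁ L₂ j x * (starRingEnd ℂ) (charMap L₁ L₂ i x) =
      character L₁ L₂ (j - i) x := fun x => by
    rw [sub_eq_add_neg, character_add, character_neg]; rfl
  rw [charLp, charLp, inner_smul_left, inner_smul_right, ContinuousMap.inner_toLp]
  simp_rw [h]
  rw [integral_character, ← sqrt_area_mul_self]
  have := sqrt_area_ne_zero (L₁ := L₁) (L₂ := L₂)
  by_cases hij : i = j
  · simp only [hij, sub_self, if_true, map_inv₀, Complex.conj_ofReal]
    field_simp
  · have : j - i ≠ 0 := sub_ne_zero.2 (Ne.symm hij)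
    simp [hij, this]

lemma span_charLp_closure_eq_top :
    (Submodule.span ℂ (range (charLp L₁ L₂))).topologicalClosure = ⊤ := by
  have h1 : (Submodule.span ℂ (range (fun k =>
      ContinuousMap.toLp (E := ℂ) 2 (volume : Measure (Torus L₁ L₂)) ℂ
        (charMap L₁ L₂ k)))).topologicalClosure = ⊤ := by
    simpa only [Submodule.map_span, ContinuousLinearMap.coe_coe, ← range_comp, Function.comp_def]
      using (ContinuousMap.toLp_denseRange ℂ (volume : Measure (Torus L₁ L₂)) ℂ
        (p := 2) (by simp)).topologicalClosure_map_submodule span_charMap_closure_eq_top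
  rw [← top_le_iff, ← h1]
  apply Submodule.topologicalClosure_mono
  rw [Submodule.span_le]
  rintro _ ⟨k, rfl⟩
  have : ContinuousMap.toLp (E := ℂ) 2 (volume : Measure (Torus L₁ L₂)) ℂ (charMap L₁ L₂ k) =
      ((Real.sqrt (L₁ * L₂) : ℝ) : ℂ) • charLp L₁ L₂ k := by
    rw [charLp, smul_inv_smul₀ sqrt_area_ne_zero]
  simp only [SetLike.mem_coe, this]
  exact Submodule.smul_mem _ _ (Submodule.subset_span ⟨k, rfl⟩)

variable (L₁ L₂) in
/-- The Hilbert basis of normalized characters. -/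
def charBasis : HilbertBasis (ℤ × ℤ) ℂ (LC L₁ L₂) :=
  HilbertBasis.mk orthonormal_charLp span_charLp_closure_eq_top.ge

lemma coe_charBasis : ⇑(charBasis L₁ L₂) = charLp L₁ L₂ := HilbertBasis.coe_mk _ _

lemma coeFn_charLp (k : ℤ × ℤ) :
    charLp L₁ L₂ k =ᵐ[volume] fun x => ((Real.sqrt (L₁ * L₂))⁻¹ : ℂ) * character L₁ L₂ k x := by
  filter_upwards [Lp.coeFn_smul ((Real.sqrt (L₁ * L₂))⁻¹ : ℂ)
      (ContinuousMap.toLp (E := ℂ) 2 volume ℂ (charMap L₁ L₂ k)),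
    ContinuousMap.coeFn_toLp (𝕜 := ℂ) (p := 2) volume (charMap L₁ L₂ k)] with x h1 h2
  rw [charLp, h1, Pi.smul_apply, h2]
  rfl

variable (L₁ L₂) in
/-- A real function as a complex one. -/
def toComplex : L2 L₁ L₂ →L[ℝ] LC L₁ L₂ := Complex.ofRealCLM.compLpL 2 volume

variable (L₁ L₂) in
/-- The real part of a complex function. -/
def toReal : LC L₁ L₂ →L[ℝ] L2 L₁ L₂ := Complex.reCLM.compLpL 2 volume

lemma coeFn_toComplex (u : L2 L₁ L₂) : toComplex L₁ L₂ u =ᵐ[volume] fun x => (u x : ℂ) :=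
  ContinuousLinearMap.coeFn_compLpL _ _

lemma coeFn_toReal (u : LC L₁ L₂) : toReal L₁ L₂ u =ᵐ[volume] fun x => (u x).re :=
  ContinuousLinearMap.coeFn_compLpL _ _

lemma inner_charLp (k : ℤ × ℤ) (u : LC L₁ L₂) :
    inner ℂ (charLp L₁ L₂ k) u =
      (Real.sqrt (L₁ * L₂))⁻¹ * ∫ x, (starRingEnd ℂ) (character L₁ L₂ k x) * u x := by
  rw [L2.inner_def, ← integral_const_mul]
  apply integral_congr_ae
  filter_upwards [coeFn_charLp (L₁ := L₁) (L₂ := L₂) k] with x hx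
  rw [hx, RCLike.inner_apply]
  simp only [map_mul, map_inv₀, Complex.conj_ofReal, Complex.ofReal_inv]
  ring

lemma fourierCoeff2_eq_inner (u : L2 L₁ L₂) (k : ℤ × ℤ) :
    fourierCoeff2 u k = (Real.sqrt (L₁ * L₂))⁻¹ *
      inner ℂ (charLp L₁ L₂ k) (toComplex L₁ L₂ u) := by
  rw [inner_charLp, fourierCoeff2, ← mul_assoc, Complex.ofReal_inv, ← mul_inv, sqrt_area_mul_self]
  congr 1
  · simp
  · apply integral_congr_ae
    filter_upwards [coeFn_toComplex u] with x hx
    rw [hx]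

variable (L₁ L₂) in
/-- The Fourier coefficient as a continuous linear functional. -/
def coef (k : ℤ × ℤ) : L2 L₁ L₂ →L[ℝ] ℂ :=
  (Real.sqrt (L₁ * L₂))⁻¹ • ((innerSL ℂ (charLp L₁ L₂ k)).restrictScalars ℝ).comp (toComplex L₁ L₂)

lemma coef_apply (k : ℤ × ℤ) (u : L2 L₁ L₂) : coef L₁ L₂ k u = fourierCoeff2 u k := by
  rw [fourierCoeff2_eq_inner]
  simp [coef]

lemma fourierCoeff2_congr {f g : Torus L₁ L₂ → ℝ} (h : f =ᵐ[volume] g) (k : ℤ × ℤ) :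
    fourierCoeff2 f k = fourierCoeff2 g k := by
  rw [fourierCoeff2, fourierCoeff2]
  congr 1
  apply integral_congr_ae
  filter_upwards [h] with x hx
  rw [hx]

lemma inner_toComplex (u w : L2 L₁ L₂) :
    inner ℂ (toComplex L₁ L₂ u) (toComplex L₁ L₂ w) = ((inner ℝ u w : ℝ) : ℂ) := by
  rw [L2.inner_def, L2.inner_def, ← integral_complex_ofReal]
  apply integral_congr_ae
  filter_upwards [coeFn_toComplex u, coeFn_toComplex w] with x hx hy
  rw [hx, hy]
  simp [RCLike.inner_apply]

/-- Parseval's identity. -/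
lemma hasSum_coef_mul (u w : L2 L₁ L₂) :
    HasSum (fun k => (starRingEnd ℂ) (coef L₁ L₂ k u) * coef L₁ L₂ k w)
      (((inner ℝ u w / (L₁ * L₂) : ℝ) : ℂ)) := by
  have h := ((charBasis L₁ L₂).hasSum_inner_mul_inner (toComplex L₁ L₂ u)
    (toComplex L₁ L₂ w)).mul_left (((L₁ * L₂ : ℝ) : ℂ)⁻¹)
  rw [inner_toComplex] at h
  have e : ((inner ℝ u w / (L₁ * L₂) : ℝ) : ℂ) =
      (((L₁ * L₂ : ℝ) : ℂ)⁻¹ * ((inner ℝ u w : ℝ) : ℂ)) := by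
    rw [div_eq_inv_mul, Complex.ofReal_mul, Complex.ofReal_inv]
  rw [e]
  refine h.congr_fun fun k => ?_
  rw [coef_apply, coef_apply, fourierCoeff2_eq_inner, fourierCoeff2_eq_inner, coe_charBasis,
    map_mul, inner_conj_symm, ← sqrt_area_mul_self, Complex.conj_ofReal, Complex.ofReal_inv,
    mul_inv]
  ring

lemma hasSum_norm_coef_sq (u : L2 L₁ L₂) :
    HasSum (fun k => ‖coef L₁ L₂ k u‖ ^ 2) (‖u‖ ^ 2 / (L₁ * L₂)) := by
  have h := Complex.hasSum_re (hasSum_coef_mul u u)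
  convert h using 1
  · funext k
    rw [mul_comm, Complex.mul_conj, Complex.ofReal_re, Complex.normSq_eq_norm_sq]
  · rw [Complex.ofReal_re, real_inner_self_eq_norm_sq]

lemma norm_sq_eq_tsum (u : L2 L₁ L₂) :
    ‖u‖ ^ 2 = (L₁ * L₂) * ∑' k, ‖coef L₁ L₂ k u‖ ^ 2 := by
  rw [(hasSum_norm_coef_sq u).tsum_eq]
  rw [mul_div_cancel₀ _ (area_pos L₁ L₂).ne']

lemma summable_norm_coef_sq (u : L2 L₁ L₂) : Summable (fun k => ‖coef L₁ L₂ k u‖ ^ 2) :=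
  (hasSum_norm_coef_sq u).summable

lemma ext_coef {u w : L2 L₁ L₂} (h : ∀ k, coef L₁ L₂ k u = coef L₁ L₂ k w) : u = w := by
  rw [← sub_eq_zero, ← norm_eq_zero, ← sq_eq_zero_iff, norm_sq_eq_tsum]
  simp [map_sub, h]

lemma fourierCoeff2_neg (f : Torus L₁ L₂ → ℝ) (k : ℤ × ℤ) :
    fourierCoeff2 f (-k) = (starRingEnd ℂ) (fourierCoeff2 f k) := by
  rw [fourierCoeff2, fourierCoeff2, map_mul, ← integral_conj, Complex.conj_ofReal]
  simp [character_neg]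

lemma coef_neg (u : L2 L₁ L₂) (k : ℤ × ℤ) :
    coef L₁ L₂ (-k) u = (starRingEnd ℂ) (coef L₁ L₂ k u) := by
  rw [coef_apply, coef_apply, fourierCoeff2_neg]

/-! ### Functions with given Fourier coefficients -/

/-- The real part of `c` times a character. -/
def mode (L₁ L₂ : ℝ) [Fact (0 < L₁)] [Fact (0 < L₂)] (c : ℂ) (k : ℤ × ℤ) : L2 L₁ L₂ :=
  ContinuousMap.toLp 2 volume ℝ
    ⟨fun x : Torus L₁ L₂ => (c * character L₁ L₂ k x).re, by
      unfold character; fun_prop⟩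

lemma coeFn_mode (c : ℂ) (k : ℤ × ℤ) :
    mode L₁ L₂ c k =ᵐ[volume] fun x => (c * character L₁ L₂ k x).re :=
  ContinuousMap.coeFn_toLp (𝕜 := ℝ) (p := 2) volume _

lemma fourierMode_eq_mode (g : Torus L₁ L₂ → ℝ) (k : ℤ × ℤ) :
    fourierMode g k = mode L₁ L₂ (fourierCoeff2 g k) k := rfl

lemma mode_eq_toReal (c : ℂ) (k : ℤ × ℤ) :
    mode L₁ L₂ c k = toReal L₁ L₂ ((c * Real.sqrt (L₁ * L₂)) • charLp L₁ L₂ k) := by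
  apply Lp.ext
  filter_upwards [coeFn_mode (L₁ := L₁) (L₂ := L₂) c k, coeFn_toReal (L₁ := L₁) (L₂ := L₂)
    ((c * Real.sqrt (L₁ * L₂)) • charLp L₁ L₂ k), coeFn_charLp (L₁ := L₁) (L₂ := L₂) k,
    Lp.coeFn_smul (c * Real.sqrt (L₁ * L₂)) (charLp L₁ L₂ k)] with x h1 h2 h3 h4
  rw [h1, h2, h4, Pi.smul_apply, h3, smul_eq_mul]
  have := sqrt_area_ne_zero (L₁ := L₁) (L₂ := L₂)
  congr 1
  field_simp

lemma smul_mode (r : ℝ) (c : ℂ) (k : ℤ × ℤ) : r • mode L₁ L₂ c k = mode L₁ L₂ (r * c) k := by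
  rw [mode_eq_toReal, mode_eq_toReal, ← map_smul, mul_assoc, mul_smul (r : ℂ)]
  rfl

/-- Re z = (z + z̄)/2, and conjugation sends the character k to -k. For k = 0 the two terms fall on
the same index. -/
lemma toComplex_mode (c : ℂ) (k : ℤ × ℤ) :
    toComplex L₁ L₂ (mode L₁ L₂ c k) = (c / 2 * Real.sqrt (L₁ * L₂)) • charLp L₁ L₂ k +
      ((starRingEnd ℂ) c / 2 * Real.sqrt (L₁ * L₂)) • charLp L₁ L₂ (-k) := by
  apply Lp.ext
  filter_upwards [coeFn_mode (L₁ := L₁) (L₂ := L₂) c k, coeFn_toComplex (mode L₁ L₂ c k),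
    coeFn_charLp (L₁ := L₁) (L₂ := L₂) k, coeFn_charLp (L₁ := L₁) (L₂ := L₂) (-k),
    Lp.coeFn_smul (c / 2 * Real.sqrt (L₁ * L₂)) (charLp L₁ L₂ k),
    Lp.coeFn_smul ((starRingEnd ℂ) c / 2 * Real.sqrt (L₁ * L₂)) (charLp L₁ L₂ (-k)),
    Lp.coeFn_add ((c / 2 * Real.sqrt (L₁ * L₂)) • charLp L₁ L₂ k)
      (((starRingEnd ℂ) c / 2 * Real.sqrt (L₁ * L₂)) • charLp L₁ L₂ (-k))]
    with x h1 h2 h3 h4 h5 h6 h7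
  rw [h2, h1, h7, Pi.add_apply, h5, h6, Pi.smul_apply, Pi.smul_apply, h3, h4, smul_eq_mul,
    smul_eq_mul, character_neg, Complex.re_eq_add_conj, map_mul]
  have := sqrt_area_ne_zero (L₁ := L₁) (L₂ := L₂)
  field_simp

lemma coef_mode (c : ℂ) (k l : ℤ × ℤ) :
    coef L₁ L₂ l (mode L₁ L₂ c k) =
      (if l = k then c / 2 else 0) + (if l = -k then (starRingEnd ℂ) c / 2 else 0) := by
  rw [coef_apply, fourierCoeff2_eq_inner, toComplex_mode, inner_add_right, inner_smul_right,
    inner_smul_right, orthonormal_iff_ite.1 orthonormal_charLp,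
    orthonormal_iff_ite.1 orthonormal_charLp]
  have := sqrt_area_ne_zero (L₁ := L₁) (L₂ := L₂)
  split_ifs <;> rw [Complex.ofReal_inv] <;> field_simp <;> simp

/-- Each mode is the real part of a multiple of an orthonormal vector, so the complex orthogonal
series converges first and its image under the continuous map `toReal` follows. -/
lemma summable_mode {c : ℤ × ℤ → ℂ} (hc : Summable fun k => ‖c k‖ ^ 2) :
    Summable fun k => mode L₁ L₂ (c k) k := by
  have h1 : Summable fun k => ‖c k * Real.sqrt (L₁ * L₂)‖ ^ 2 := by
    simp_rw [norm_mul, mul_pow]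
    exact hc.mul_right _
  have hv : OrthogonalFamily ℂ (fun _ : ℤ × ℤ => ℂ)
      (fun k => LinearIsometry.toSpanSingleton ℂ (LC L₁ L₂) (orthonormal_charLp.1 k)) :=
    orthonormal_charLp.orthogonalFamily
  have h2 := (hv.summable_iff_norm_sq_summable (fun k => c k * Real.sqrt (L₁ * L₂))).2 h1
  have h3 := h2.map (toReal L₁ L₂) (toReal L₁ L₂).continuous
  refine h3.congr fun k => ?_
  simp only [Function.comp_apply]
  rw [mode_eq_toReal]
  rfl

variable (L₁ L₂) in
/-- The real function whose Fourier coefficients are `c`, provided that `c` is square summable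
and `c (-k)` is the conjugate of `c k`. -/
def ofCoeff (c : ℤ × ℤ → ℂ) : L2 L₁ L₂ := ∑' k, mode L₁ L₂ (c k) k

lemma semigroup_eq_ofCoeff (σ : ℤ × ℤ → ℝ) (t : ℝ) (g : Torus L₁ L₂ → ℝ) :
    semigroup σ t g = ofCoeff L₁ L₂ (fun k => Real.exp (-t * σ k) * fourierCoeff2 g k) := by
  simp only [semigroup, ofCoeff, fourierMode_eq_mode, smul_mode]

/-- Taking real parts splits each term between k and -k. The Hermitian symmetry makes the two halves
at a given index equal, so they add up to the prescribed coefficient. -/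
lemma coef_ofCoeff {c : ℤ × ℤ → ℂ} (hc : Summable fun k => ‖c k‖ ^ 2)
    (hs : ∀ k, c (-k) = (starRingEnd ℂ) (c k)) (l : ℤ × ℤ) :
    coef L₁ L₂ l (ofCoeff L₁ L₂ c) = c l := by
  have h1 := (summable_mode (L₁ := L₁) (L₂ := L₂) hc).hasSum.mapL (coef L₁ L₂ l)
  simp only [coef_mode] at h1
  have e1 : HasSum (fun k => if l = k then c k / 2 else 0) (c l / 2) := by
    have := hasSum_ite_eq l (c l / 2)
    refine this.congr_fun fun k => ?_
    by_cases h : l = k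
    · subst h; simp
    · simp [h, Ne.symm h]
  have e2 : HasSum (fun k => if l = -k then (starRingEnd ℂ) (c k) / 2 else 0) (c l / 2) := by
    have := hasSum_ite_eq (-l) (c l / 2)
    refine this.congr_fun fun k => ?_
    by_cases h : l = -k
    · subst h
      simp [hs]
    · have : k ≠ -l := fun h' => h (by rw [h', neg_neg])
      simp [h, this]
  rw [ofCoeff]
  have := (e1.add e2).unique h1
  rw [← this]
  ring

lemma norm_ofCoeff_sq {c : ℤ × ℤ → ℂ} (hc : Summable fun k => ‖c k‖ ^ 2)
    (hs : ∀ k, c (-k) = (starRingEnd ℂ) (c k)) :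
    ‖ofCoeff L₁ L₂ c‖ ^ 2 = (L₁ * L₂) * ∑' k, ‖c k‖ ^ 2 := by
  rw [norm_sq_eq_tsum]
  simp only [coef_ofCoeff hc hs]

lemma hasSum_mode_coef (u : L2 L₁ L₂) :
    HasSum (fun k => mode L₁ L₂ (coef L₁ L₂ k u) k) u := by
  have h := (summable_mode (L₁ := L₁) (L₂ := L₂) (summable_norm_coef_sq u)).hasSum
  have e : ∑' k, mode L₁ L₂ (coef L₁ L₂ k u) k = u :=
    ext_coef (coef_ofCoeff (summable_norm_coef_sq u) (coef_neg u))
  rwa [e] at h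

/-- A family of `L²` functions with measurable Fourier coefficients is measurable. -/
lemma aestronglyMeasurable_of_coef {α : Type*} [MeasurableSpace α] {ν : Measure α}
    {u : α → L2 L₁ L₂} (h : ∀ k, AEStronglyMeasurable (fun t => coef L₁ L₂ k (u t)) ν) :
    AEStronglyMeasurable u ν := by
  have hm : ∀ k, AEStronglyMeasurable (fun t => mode L₁ L₂ (coef L₁ L₂ k (u t)) k) ν := by
    intro k
    simp_rw [mode_eq_toReal]
    refine (toReal L₁ L₂).continuous.comp_aestronglyMeasurable ?_
    exact ((h k).mul_const _).smul_const _
  refine aestronglyMeasurable_of_tendsto_ae (Filter.atTop : Filter (Finset (ℤ × ℤ)))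
    (f := fun S t => ∑ k ∈ S, mode L₁ L₂ (coef L₁ L₂ k (u t)) k) (fun S => ?_) ?_
  · exact Finset.aestronglyMeasurable_fun_sum S fun k _ => hm k
  · exact Filter.Eventually.of_forall fun t => hasSum_mode_coef (u t)

/-- Continuity in `L²` from continuity of the Fourier coefficients and domination. -/
lemma continuousOn_of_coef {u : ℝ → L2 L₁ L₂} {S : Set ℝ} {M : ℤ × ℤ → ℝ}
    (hM : Summable fun k => M k ^ 2)
    (hb : ∀ t ∈ S, ∀ k, ‖coef L₁ L₂ k (u t)‖ ≤ M k)
    (hc : ∀ k, ContinuousOn (fun t => coef L₁ L₂ k (u t)) S) : ContinuousOn u S := by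
  intro t ht
  rw [ContinuousWithinAt, tendsto_iff_norm_sub_tendsto_zero]
  have h0 : Filter.Tendsto (fun r => ∑' k, ‖coef L₁ L₂ k (u r - u t)‖ ^ 2) (nhdsWithin t S)
      (nhds (∑' k : ℤ × ℤ, (0 : ℝ))) := by
    refine tendsto_tsum_of_dominated_convergence (bound := fun k => (2 * M k) ^ 2) ?_ ?_ ?_
    · simp_rw [mul_pow]; exact hM.mul_left _
    · intro k
      have h1 := (hc k t ht).sub (continuousWithinAt_const (b := coef L₁ L₂ k (u t)))
      have h2 := ((continuous_norm.pow 2).tendsto _).comp h1.tendsto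
      simpa [map_sub, Function.comp_def] using h2
    · filter_upwards [self_mem_nhdsWithin] with r hr k
      rw [Real.norm_of_nonneg (by positivity), map_sub]
      gcongr
      linarith [norm_sub_le (coef L₁ L₂ k (u r)) (coef L₁ L₂ k (u t)), hb r hr k, hb t ht k]
  have h1 : Filter.Tendsto (fun r => Real.sqrt ((L₁ * L₂) *
      ∑' k, ‖coef L₁ L₂ k (u r - u t)‖ ^ 2)) (nhdsWithin t S) (nhds 0) := by
    have := (h0.const_mul (L₁ * L₂)).sqrt
    simpa using this
  refine h1.congr fun r => ?_
  rw [← norm_sq_eq_tsum, Real.sqrt_sq (norm_nonneg _)]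

/-! ### Frequencies -/

lemma freq_neg (k : ℤ × ℤ) (j : Fin 2) : freq L₁ L₂ (-k) j = -freq L₁ L₂ k j := by
  fin_cases j <;> simp [freq] <;> ring

lemma freq_add (k l : ℤ × ℤ) (j : Fin 2) :
    freq L₁ L₂ (k + l) j = freq L₁ L₂ k j + freq L₁ L₂ l j := by
  fin_cases j <;> simp [freq] <;> ring

lemma freqSq_neg (k : ℤ × ℤ) : freqSq L₁ L₂ (-k) = freqSq L₁ L₂ k := by
  simp [freqSq, freq_neg]

lemma freqSq_zero : freqSq L₁ L₂ 0 = 0 := by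
  simp [freqSq, freq]

lemma freqSq_nonneg (k : ℤ × ℤ) : 0 ≤ freqSq L₁ L₂ k :=
  Finset.sum_nonneg fun _ _ => sq_nonneg _

lemma freq_sq_le (k : ℤ × ℤ) (j : Fin 2) : freq L₁ L₂ k j ^ 2 ≤ freqSq L₁ L₂ k :=
  Finset.single_le_sum (f := fun j => freq L₁ L₂ k j ^ 2) (fun _ _ => sq_nonneg _)
    (Finset.mem_univ j)

variable (L₁ L₂) in
lemma exists_le_freqSq : ∃ c : ℝ, 0 < c ∧
    ∀ k : ℤ × ℤ, c * ((k.1 : ℝ) ^ 2 + (k.2 : ℝ) ^ 2) ≤ freqSq L₁ L₂ k := by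
  have h1 : 0 < L₁ := Fact.out
  have h2 : 0 < L₂ := Fact.out
  refine ⟨min ((2 * Real.pi / L₁) ^ 2) ((2 * Real.pi / L₂) ^ 2), by positivity, fun k => ?_⟩
  have e : freqSq L₁ L₂ k = (2 * Real.pi / L₁) ^ 2 * (k.1 : ℝ) ^ 2 +
      (2 * Real.pi / L₂) ^ 2 * (k.2 : ℝ) ^ 2 := by
    simp only [freqSq, freq, Fin.sum_univ_two, Matrix.cons_val_zero, Matrix.cons_val_one]
    ring
  rw [e, mul_add]
  gcongr
  · exact min_le_left _ _
  · exact min_le_right _ _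

lemma one_le_sq_add_sq {k : ℤ × ℤ} (hk : k ≠ 0) : (1 : ℝ) ≤ (k.1 : ℝ) ^ 2 + (k.2 : ℝ) ^ 2 := by
  have : (1 : ℤ) ≤ k.1 ^ 2 + k.2 ^ 2 := by
    have h0 : 0 ≤ k.1 ^ 2 := sq_nonneg _
    have h0' : 0 ≤ k.2 ^ 2 := sq_nonneg _
    by_contra! h
    have h1 : k.1 ^ 2 = 0 := by linarith
    have h2 : k.2 ^ 2 = 0 := by linarith
    exact hk (Prod.ext (pow_eq_zero_iff two_ne_zero |>.1 h1) (pow_eq_zero_iff two_ne_zero |>.1 h2))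
  exact_mod_cast this

lemma freqSq_pos {k : ℤ × ℤ} (hk : k ≠ 0) : 0 < freqSq L₁ L₂ k := by
  obtain ⟨c, hc, h⟩ := exists_le_freqSq L₁ L₂
  have := one_le_sq_add_sq hk
  exact lt_of_lt_of_le (by positivity) (h k)

variable (L₁ L₂) in
/-- The weight `1 + |ξ|⁴`. -/
def weight (k : ℤ × ℤ) : ℝ := 1 + freqSq L₁ L₂ k ^ 2

lemma one_le_weight (k : ℤ × ℤ) : 1 ≤ weight L₁ L₂ k := by
  unfold weight; nlinarith [sq_nonneg (freqSq L₁ L₂ k)]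

lemma weight_pos (k : ℤ × ℤ) : 0 < weight L₁ L₂ k := lt_of_lt_of_le one_pos (one_le_weight k)

lemma freqSq_sq_le_weight (k : ℤ × ℤ) : freqSq L₁ L₂ k ^ 2 ≤ weight L₁ L₂ k := by
  unfold weight; linarith

lemma freqSq_le_weight (k : ℤ × ℤ) : freqSq L₁ L₂ k ≤ weight L₁ L₂ k := by
  unfold weight; nlinarith [sq_nonneg (freqSq L₁ L₂ k - 1)]

lemma freqSq_le_weight_rpow (k : ℤ × ℤ) : freqSq L₁ L₂ k ≤ weight L₁ L₂ k ^ (1 / 2 : ℝ) := by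
  rw [← Real.sqrt_eq_rpow]
  exact Real.le_sqrt_of_sq_le (freqSq_sq_le_weight k)

lemma summable_int_weight {c : ℝ} (hc : 0 < c) :
    Summable fun m : ℤ => (1 + c * (m : ℝ) ^ 2) ^ (-(3 / 4) : ℝ) := by
  have h1 : Summable fun m : ℤ => c ^ (-(3 / 4) : ℝ) * |(m : ℝ)| ^ (-(3 / 2) : ℝ) :=
    (Real.summable_abs_int_rpow (by norm_num)).mul_left _
  have h2 : Summable fun m : ℤ => if m = 0 then (1 : ℝ) else 0 :=
    (hasSum_ite_eq (0 : ℤ) (1 : ℝ)).summable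
  refine Summable.of_nonneg_of_le (fun m => by positivity) (fun m => ?_) (h2.add h1)
  by_cases hm : m = 0
  · subst hm
    simp
  · have hm' : 0 < |(m : ℝ)| := abs_pos.2 (by exact_mod_cast hm)
    simp only [hm, if_false, zero_add]
    have e : c ^ (-(3 / 4) : ℝ) * |(m : ℝ)| ^ (-(3 / 2) : ℝ) =
        (c * (m : ℝ) ^ 2) ^ (-(3 / 4) : ℝ) := by
      rw [Real.mul_rpow hc.le (sq_nonneg _), ← sq_abs (m : ℝ), ← Real.rpow_natCast,
        ← Real.rpow_mul hm'.le]
      norm_num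
    rw [e]
    apply Real.rpow_le_rpow_of_nonpos
    · rw [← sq_abs]; positivity
    · linarith
    · norm_num

variable (L₁ L₂) in
-- The weight dominates half of (1 + c k₁²)(1 + c k₂²), so the double sum is controlled by a product
-- of two convergent sums of order |m|^{-3/2}. This is where dimension two fixes the exponents used
-- later.
lemma summable_weight_rpow : Summable fun k => weight L₁ L₂ k ^ (-(3 / 4) : ℝ) := by
  obtain ⟨c, hc, h⟩ := exists_le_freqSq L₁ L₂
  have h1 := ((summable_int_weight hc).mul_of_nonneg (summable_int_weight hc)
    (fun m => by positivity) (fun m => by positivity)).mul_left ((1 / 2 : ℝ) ^ (-(3 / 4) : ℝ))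
  refine Summable.of_nonneg_of_le (fun k => (Real.rpow_pos_of_pos (weight_pos k) _).le)
    (fun k => ?_) h1
  rw [← Real.mul_rpow (by positivity) (by positivity),
    ← Real.mul_rpow (by positivity) (by positivity)]
  apply Real.rpow_le_rpow_of_nonpos (by positivity) _ (by norm_num)
  have hk := h k
  have hp : 0 ≤ c * (k.1 : ℝ) ^ 2 := by positivity
  have hq : 0 ≤ c * (k.2 : ℝ) ^ 2 := by positivity
  unfold weight
  nlinarith [sq_nonneg (freqSq L₁ L₂ k - 1), freqSq_nonneg (L₁ := L₁) (L₂ := L₂) k,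
    sq_nonneg (c * (k.1 : ℝ) ^ 2), sq_nonneg (c * (k.2 : ℝ) ^ 2), mul_nonneg hp hq]

variable (L₁ L₂) in
lemma summable_weight_inv : Summable fun k => (weight L₁ L₂ k)⁻¹ := by
  refine Summable.of_nonneg_of_le (fun k => (inv_pos.2 (weight_pos k)).le) (fun k => ?_)
    (summable_weight_rpow L₁ L₂)
  rw [← Real.rpow_neg_one]
  exact Real.rpow_le_rpow_of_exponent_le (one_le_weight k) (by norm_num)

/-! ### Agmon's inequality -/

/-- Telescoping; u ≥ 1 ensures u + n + 1 ≤ 2(u + n), whence the factor 2. -/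
lemma sum_range_inv_sq_le {u : ℝ} (hu : 1 ≤ u) (N : ℕ) :
    ∑ n ∈ Finset.range N, ((u + n) ^ 2)⁻¹ ≤ 2 * (u⁻¹ - (u + N)⁻¹) := by
  induction N with
  | zero => simp
  | succ N ih =>
    rw [Finset.sum_range_succ]
    have hN : (0 : ℝ) ≤ N := Nat.cast_nonneg N
    have h : ((u + N) ^ 2)⁻¹ ≤ 2 * ((u + N)⁻¹ - (u + (N + 1 : ℕ))⁻¹) := by
      have h1 : 0 < u + N := by linarith
      have h2 : 0 < u + (N + 1 : ℕ) := by push_cast; linarith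
      rw [inv_sub_inv h1.ne' h2.ne', ← mul_div_assoc, inv_eq_one_div,
        div_le_div_iff₀ (by positivity) (by positivity)]
      push_cast
      nlinarith
    linarith

lemma summable_nat_inv_sq {u : ℝ} (hu : 1 ≤ u) : Summable fun n : ℕ => ((u + n) ^ 2)⁻¹ := by
  refine summable_of_sum_range_le (c := 2 * u⁻¹) (fun n => by positivity) fun N => ?_
  have := sum_range_inv_sq_le hu N
  have : 0 ≤ (u + N)⁻¹ := by positivity
  linarith

lemma tsum_nat_inv_sq_le {u : ℝ} (hu : 1 ≤ u) : ∑' n : ℕ, ((u + n) ^ 2)⁻¹ ≤ 2 * u⁻¹ := by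
  refine (summable_nat_inv_sq hu).tsum_le_of_sum_range_le fun N => ?_
  have := sum_range_inv_sq_le hu N
  have : 0 ≤ (u + N)⁻¹ := by positivity
  linarith

lemma sum_int_inv_sq_le {u : ℝ} (hu : 1 ≤ u) (S : Finset ℤ) :
    ∑ m ∈ S, ((u + |(m : ℝ)|) ^ 2)⁻¹ ≤ 4 * u⁻¹ := by
  have h1 : HasSum (fun n : ℕ => ((u + |(((n : ℕ) : ℤ) : ℝ)|) ^ 2)⁻¹)
      (∑' n : ℕ, ((u + n) ^ 2)⁻¹) := by
    refine (summable_nat_inv_sq hu).hasSum.congr_fun fun n => ?_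
    simp
  have h2s : Summable (fun n : ℕ => ((u + ((n + 1 : ℕ) : ℝ)) ^ 2)⁻¹) :=
    (summable_nat_add_iff 1).2 (summable_nat_inv_sq hu)
  have h2 : HasSum (fun n : ℕ => ((u + |((-(n + 1 : ℤ) : ℤ) : ℝ)|) ^ 2)⁻¹)
      (∑' n : ℕ, ((u + ((n + 1 : ℕ) : ℝ)) ^ 2)⁻¹) := by
    refine h2s.hasSum.congr_fun fun n => ?_
    have : |((-(n + 1 : ℤ) : ℤ) : ℝ)| = ((n + 1 : ℕ) : ℝ) := by
      push_cast
      rw [abs_neg, abs_of_nonneg (by positivity)]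
    rw [this]
  have h3 := HasSum.of_nat_of_neg_add_one (f := fun m : ℤ => ((u + |(m : ℝ)|) ^ 2)⁻¹) h1 h2
  have h4 : ∑' n : ℕ, ((u + ((n + 1 : ℕ) : ℝ)) ^ 2)⁻¹ ≤ ∑' n : ℕ, ((u + n) ^ 2)⁻¹ := by
    refine h2s.tsum_le_tsum (fun n => ?_) (summable_nat_inv_sq hu)
    have : (0 : ℝ) ≤ n := Nat.cast_nonneg n
    gcongr
    simp
  have h5 := sum_le_hasSum S (fun m _ => by positivity) h3
  have := tsum_nat_inv_sq_le hu
  linarith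

variable (L₁ L₂) in
/-- A lattice sum: `∑_{k ≠ 0} 1 / (a + |ξ|⁴) ≤ κ a^{-1/2}`. -/
lemma exists_lattice_sum_le : ∃ κ : ℝ, 0 < κ ∧ ∀ a : ℝ, 0 < a → ∀ S : Finset (ℤ × ℤ), 0 ∉ S →
    ∑ k ∈ S, (a + freqSq L₁ L₂ k ^ 2)⁻¹ ≤ κ / Real.sqrt a := by
  obtain ⟨c, hc, h⟩ := exists_le_freqSq L₁ L₂
  refine ⟨256 / c, by positivity, fun a ha S hS => ?_⟩
  set r := Real.sqrt a with hr
  have hr0 : 0 < r := Real.sqrt_pos.2 ha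
  have hra : r ^ 2 = a := Real.sq_sqrt ha.le
  -- Since |k|² ≥ 1, half of the lower bound c|k|² can be given up to gain the additive constant e.
  set e := c / 2 with he
  have he0 : 0 < e := by positivity
  -- With e u² = r + e the bound separates: r + |ξ|² dominates e(u² + k₁² + k₂²), hence up to
  -- constants the product of u + |k₁| and u + |k₂|. The extra e guarantees u ≥ 1.
  set u := Real.sqrt ((r + e) / e) with hu
  have hu2 : e * u ^ 2 = r + e := by
    rw [hu, Real.sq_sqrt (by positivity)]; field_simp
  have hu1 : 1 ≤ u := by
    rw [hu, Real.one_le_sqrt, one_le_div he0]; linarith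
  have key : ∀ k ∈ S, (a + freqSq L₁ L₂ k ^ 2)⁻¹ ≤
      (8 / e ^ 2) * (((u + |(k.1 : ℝ)|) ^ 2)⁻¹ * ((u + |(k.2 : ℝ)|) ^ 2)⁻¹) := by
    intro k hk
    have hk0 : k ≠ 0 := fun h0 => hS (h0 ▸ hk)
    have h1 := one_le_sq_add_sq hk0
    have h2 := h k
    have hl : e * u ^ 2 - r + e * ((k.1 : ℝ) ^ 2 + (k.2 : ℝ) ^ 2) ≤ freqSq L₁ L₂ k := by
      rw [hu2]
      have : c = 2 * e := by rw [he]; ring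
      rw [this] at h2
      nlinarith
    have hp : (u + |(k.1 : ℝ)|) ^ 2 ≤ 2 * (u ^ 2 + (k.1 : ℝ) ^ 2) := by
      rw [← sq_abs (k.1 : ℝ)]; nlinarith [sq_nonneg (u - |(k.1 : ℝ)|)]
    have hq : (u + |(k.2 : ℝ)|) ^ 2 ≤ 2 * (u ^ 2 + (k.2 : ℝ) ^ 2) := by
      rw [← sq_abs (k.2 : ℝ)]; nlinarith [sq_nonneg (u - |(k.2 : ℝ)|)]
    have hpq : (u + |(k.1 : ℝ)|) ^ 2 * (u + |(k.2 : ℝ)|) ^ 2 ≤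
        (2 * (u ^ 2 + (k.1 : ℝ) ^ 2)) * (2 * (u ^ 2 + (k.2 : ℝ) ^ 2)) := by gcongr
    have hsum : (e * (u ^ 2 + (k.1 : ℝ) ^ 2 + (k.2 : ℝ) ^ 2)) ^ 2 ≤ (r + freqSq L₁ L₂ k) ^ 2 := by
      gcongr
      nlinarith
    have hfin : (e ^ 2 / 8) * ((u + |(k.1 : ℝ)|) ^ 2 * (u + |(k.2 : ℝ)|) ^ 2) ≤
        a + freqSq L₁ L₂ k ^ 2 := by
      have h3 : (u ^ 2 + (k.1 : ℝ) ^ 2) * (u ^ 2 + (k.2 : ℝ) ^ 2) ≤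
          (u ^ 2 + (k.1 : ℝ) ^ 2 + (k.2 : ℝ) ^ 2) ^ 2 := by
        nlinarith [sq_nonneg u, sq_nonneg (k.1 : ℝ), sq_nonneg (k.2 : ℝ),
          mul_nonneg (sq_nonneg u) (sq_nonneg (k.1 : ℝ)),
          mul_nonneg (sq_nonneg u) (sq_nonneg (k.2 : ℝ)),
          mul_nonneg (sq_nonneg (k.1 : ℝ)) (sq_nonneg (k.2 : ℝ))]
      have h4 : e ^ 2 * ((u + |(k.1 : ℝ)|) ^ 2 * (u + |(k.2 : ℝ)|) ^ 2) ≤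
          4 * (r + freqSq L₁ L₂ k) ^ 2 := by
        calc e ^ 2 * ((u + |(k.1 : ℝ)|) ^ 2 * (u + |(k.2 : ℝ)|) ^ 2)
            ≤ e ^ 2 * ((2 * (u ^ 2 + (k.1 : ℝ) ^ 2)) * (2 * (u ^ 2 + (k.2 : ℝ) ^ 2))) := by
              gcongr
          _ = 4 * (e ^ 2 * ((u ^ 2 + (k.1 : ℝ) ^ 2) * (u ^ 2 + (k.2 : ℝ) ^ 2))) := by ring
          _ ≤ 4 * (e ^ 2 * (u ^ 2 + (k.1 : ℝ) ^ 2 + (k.2 : ℝ) ^ 2) ^ 2) := by gcongr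
          _ ≤ 4 * (r + freqSq L₁ L₂ k) ^ 2 := by rw [← mul_pow]; gcongr
      rw [← hra]
      nlinarith [sq_nonneg (r - freqSq L₁ L₂ k)]
    have hpos : 0 < (e ^ 2 / 8) * ((u + |(k.1 : ℝ)|) ^ 2 * (u + |(k.2 : ℝ)|) ^ 2) := by positivity
    refine (inv_anti₀ hpos hfin).trans (le_of_eq ?_)
    rw [mul_inv, mul_inv, inv_div]
  have hsub : S ⊆ S.image Prod.fst ×ˢ S.image Prod.snd := fun k hk =>
    Finset.mem_product.2 ⟨Finset.mem_image_of_mem _ hk, Finset.mem_image_of_mem _ hk⟩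
  calc ∑ k ∈ S, (a + freqSq L₁ L₂ k ^ 2)⁻¹
      ≤ ∑ k ∈ S, (8 / e ^ 2) * (((u + |(k.1 : ℝ)|) ^ 2)⁻¹ * ((u + |(k.2 : ℝ)|) ^ 2)⁻¹) :=
        Finset.sum_le_sum key
    _ ≤ ∑ k ∈ S.image Prod.fst ×ˢ S.image Prod.snd,
          (8 / e ^ 2) * (((u + |(k.1 : ℝ)|) ^ 2)⁻¹ * ((u + |(k.2 : ℝ)|) ^ 2)⁻¹) :=
        Finset.sum_le_sum_of_subset_of_nonneg hsub fun k _ _ => by positivity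
    _ = (8 / e ^ 2) * ((∑ m ∈ S.image Prod.fst, ((u + |(m : ℝ)|) ^ 2)⁻¹) *
          ∑ m ∈ S.image Prod.snd, ((u + |(m : ℝ)|) ^ 2)⁻¹) := by
        rw [← Finset.mul_sum, Finset.sum_product, Finset.sum_mul_sum]
    _ ≤ (8 / e ^ 2) * ((4 * u⁻¹) * (4 * u⁻¹)) := by
        gcongr
        · exact sum_int_inv_sq_le hu1 _
        · exact sum_int_inv_sq_le hu1 _
    _ = 128 / (e * (e * u ^ 2)) := by field_simp; norm_num
    _ ≤ 128 / (e * r) := by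
        rw [hu2]
        gcongr
        linarith
    _ = 256 / c / r := by rw [he]; field_simp; norm_num

/-! ### Sobolev sums, interpolation and Agmon's inequality. -/

/-- The sum of the squares of the coefficients. -/
def sqSum (x : ℤ × ℤ → ℂ) : ℝ := ∑' k, ‖x k‖ ^ 2

variable (L₁ L₂) in
/-- The sum of the squares of the coefficients of the gradient. -/
def gradSum (x : ℤ × ℤ → ℂ) : ℝ := ∑' k, freqSq L₁ L₂ k * ‖x k‖ ^ 2

variable (L₁ L₂) in
/-- The sum of the squares of the coefficients of the Laplacian. -/
def lapSum (x : ℤ × ℤ → ℂ) : ℝ := ∑' k, freqSq L₁ L₂ k ^ 2 * ‖x k‖ ^ 2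

variable (L₁ L₂) in
/-- The coefficients of a function in the Sobolev space `H²`. -/
def IsH2 (x : ℤ × ℤ → ℂ) : Prop := Summable fun k => weight L₁ L₂ k * ‖x k‖ ^ 2

lemma IsH2.sq {x : ℤ × ℤ → ℂ} (h : IsH2 L₁ L₂ x) : Summable fun k => ‖x k‖ ^ 2 :=
  Summable.of_nonneg_of_le (fun _ => by positivity)
    (fun k => le_mul_of_one_le_left (by positivity) (one_le_weight k)) h

lemma IsH2.grad {x : ℤ × ℤ → ℂ} (h : IsH2 L₁ L₂ x) :
    Summable fun k => freqSq L₁ L₂ k * ‖x k‖ ^ 2 :=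
  Summable.of_nonneg_of_le (fun k => mul_nonneg (freqSq_nonneg k) (by positivity))
    (fun k => mul_le_mul_of_nonneg_right (freqSq_le_weight k) (by positivity)) h

lemma IsH2.lap {x : ℤ × ℤ → ℂ} (h : IsH2 L₁ L₂ x) :
    Summable fun k => freqSq L₁ L₂ k ^ 2 * ‖x k‖ ^ 2 :=
  Summable.of_nonneg_of_le (fun k => by positivity)
    (fun k => mul_le_mul_of_nonneg_right (freqSq_sq_le_weight k) (by positivity)) h

lemma sqSum_nonneg (x : ℤ × ℤ → ℂ) : 0 ≤ sqSum x := tsum_nonneg fun _ => by positivity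

lemma gradSum_nonneg (x : ℤ × ℤ → ℂ) : 0 ≤ gradSum L₁ L₂ x :=
  tsum_nonneg fun k => mul_nonneg (freqSq_nonneg k) (by positivity)

lemma lapSum_nonneg (x : ℤ × ℤ → ℂ) : 0 ≤ lapSum L₁ L₂ x := tsum_nonneg fun _ => by positivity

lemma gradSum_sq_le {x : ℤ × ℤ → ℂ} (h : IsH2 L₁ L₂ x) :
    gradSum L₁ L₂ x ^ 2 ≤ sqSum x * lapSum L₁ L₂ x := by
  have h1 : Filter.Tendsto (fun S : Finset (ℤ × ℤ) => (∑ k ∈ S, freqSq L₁ L₂ k * ‖x k‖ ^ 2) ^ 2)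
      Filter.atTop (nhds (gradSum L₁ L₂ x ^ 2)) := (h.grad.hasSum : Filter.Tendsto _ _ _).pow 2
  refine le_of_tendsto h1 (Filter.Eventually.of_forall fun S => ?_)
  calc (∑ k ∈ S, freqSq L₁ L₂ k * ‖x k‖ ^ 2) ^ 2
      = (∑ k ∈ S, ‖x k‖ * (freqSq L₁ L₂ k * ‖x k‖)) ^ 2 := by
        congr 1; exact Finset.sum_congr rfl fun k _ => by ring
    _ ≤ (∑ k ∈ S, ‖x k‖ ^ 2) * ∑ k ∈ S, (freqSq L₁ L₂ k * ‖x k‖) ^ 2 :=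
        Finset.sum_mul_sq_le_sq_mul_sq S _ _
    _ ≤ sqSum x * lapSum L₁ L₂ x := by
        gcongr
        · exact sqSum_nonneg x
        · exact h.sq.sum_le_tsum S fun _ _ => by positivity
        · simp_rw [mul_pow]
          exact h.lap.sum_le_tsum S fun _ _ => by positivity

/-- Weighted arithmetic-geometric mean: 2|x| ≤ w|x|² + 1/w, and 1/w is summable over a planar
lattice. -/
lemma IsH2.summable_norm {x : ℤ × ℤ → ℂ} (h : IsH2 L₁ L₂ x) : Summable fun k => ‖x k‖ := by
  refine Summable.of_nonneg_of_le (fun _ => norm_nonneg _) (fun k => ?_)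
    ((summable_weight_inv L₁ L₂).add h)
  have hw := weight_pos (L₁ := L₁) (L₂ := L₂) k
  have h1 : (weight L₁ L₂ k)⁻¹ * weight L₁ L₂ k = 1 := inv_mul_cancel₀ hw.ne'
  have hi : 0 < (weight L₁ L₂ k)⁻¹ := inv_pos.2 hw
  have h2 : 0 ≤ weight L₁ L₂ k * (‖x k‖ - (weight L₁ L₂ k)⁻¹) ^ 2 := by positivity
  have h3 : weight L₁ L₂ k * (‖x k‖ - (weight L₁ L₂ k)⁻¹) ^ 2 =
    weight L₁ L₂ k * ‖x k‖ ^ 2 - 2 * ((weight L₁ L₂ k)⁻¹ * weight L₁ L₂ k) * ‖x k‖ +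
      ((weight L₁ L₂ k)⁻¹ * weight L₁ L₂ k) * (weight L₁ L₂ k)⁻¹ := by ring
  rw [h3, h1] at h2
  linarith [norm_nonneg (x k)]

variable (L₁ L₂) in
/-- Agmon's inequality: `‖u‖_∞ ≤ C ‖u‖^{1/2} ‖Δ u‖^{1/2}` for mean-free `u`. -/
lemma exists_agmon : ∃ κ : ℝ, 0 < κ ∧ ∀ x : ℤ × ℤ → ℂ, IsH2 L₁ L₂ x → x 0 = 0 →
    (∑' k, ‖x k‖) ^ 4 ≤ κ * (sqSum x * lapSum L₁ L₂ x) := by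
  obtain ⟨κ, hκ, h⟩ := exists_lattice_sum_le L₁ L₂
  refine ⟨4 * κ ^ 2, by positivity, fun x hx hx0 => ?_⟩
  have hN := sqSum_nonneg x
  have hD := lapSum_nonneg (L₁ := L₁) (L₂ := L₂) x
  -- The vanishing cases are set aside because the proof divides D by N. If D = 0, only the zero
  -- mode could survive, and it vanishes by assumption.
  rcases hD.eq_or_lt with hD0 | hD0
  · have h1 : ∀ k, x k = 0 := fun k => by
      by_cases hk : k = 0
      · rw [hk, hx0]
      · have h2 := (hx.lap.hasSum_iff.2 hD0.symm)
        have h3 := (hasSum_zero_iff_of_nonneg (fun k => by positivity)).1 h2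
        have h4 := congrFun h3 k
        have h5 := (freqSq_pos (L₁ := L₁) (L₂ := L₂) hk).ne'
        simpa [h5] using h4
    simp [h1, ← hD0]
  rcases hN.eq_or_lt with hN0 | hN0
  · have h2 := (hx.sq.hasSum_iff.2 hN0.symm)
    have h3 := (hasSum_zero_iff_of_nonneg (fun k => by positivity)).1 h2
    have h1 : ∀ k, x k = 0 := fun k => by simpa using congrFun h3 k
    simp [h1, ← hN0]
  set N := sqSum x
  set D := lapSum L₁ L₂ x
  -- Cauchy–Schwarz with weights D/N + |ξ|⁴: this choice makes both parts of the weighted sum at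
  -- most D.
  have ha : 0 < D / N := by positivity
  have hb : (∑' k, ‖x k‖) ^ 2 ≤ κ / Real.sqrt (D / N) * (2 * D) := by
    have h1 : Filter.Tendsto (fun S : Finset (ℤ × ℤ) => (∑ k ∈ S, ‖x k‖) ^ 2)
      Filter.atTop (nhds ((∑' k, ‖x k‖) ^ 2)) :=
        (hx.summable_norm.hasSum : Filter.Tendsto _ _ _).pow 2
    refine le_of_tendsto h1 (Filter.Eventually.of_forall fun S => ?_)
    have e1 : ∑ k ∈ S, ‖x k‖ = ∑ k ∈ S.erase 0, ‖x k‖ := by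
      rw [Finset.sum_erase]; simp [hx0]
    rw [e1]
    calc (∑ k ∈ S.erase 0, ‖x k‖) ^ 2
        ≤ (∑ k ∈ S.erase 0, (D / N + freqSq L₁ L₂ k ^ 2)⁻¹) *
          ∑ k ∈ S.erase 0, (D / N + freqSq L₁ L₂ k ^ 2) * ‖x k‖ ^ 2 := by
          refine Finset.sum_sq_le_sum_mul_sum_of_sq_le_mul _ (fun k _ => by positivity)
            (fun k _ => by positivity) fun k _ => le_of_eq ?_
          have : 0 < D / N + freqSq L₁ L₂ k ^ 2 := by positivity
          field_simp
      _ ≤ κ / Real.sqrt (D / N) * (2 * D) := by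
          gcongr
          · exact h _ ha _ (Finset.notMem_erase _ _)
          · simp_rw [add_mul]
            rw [Finset.sum_add_distrib, ← Finset.mul_sum, two_mul]
            gcongr
            · calc D / N * ∑ k ∈ S.erase 0, ‖x k‖ ^ 2 ≤ D / N * N := by
                    gcongr
                    exact hx.sq.sum_le_tsum _ fun _ _ => by positivity
                _ = D := by field_simp
            · exact hx.lap.sum_le_tsum _ fun _ _ => by positivity
  have hs : Real.sqrt (D / N) ^ 2 = D / N := Real.sq_sqrt ha.le
  have hs0 : 0 < Real.sqrt (D / N) := Real.sqrt_pos.2 ha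
  calc (∑' k, ‖x k‖) ^ 4 = ((∑' k, ‖x k‖) ^ 2) ^ 2 := by ring
    _ ≤ (κ / Real.sqrt (D / N) * (2 * D)) ^ 2 := by gcongr
    _ = 4 * κ ^ 2 * (D ^ 2 / Real.sqrt (D / N) ^ 2) := by field_simp; ring
    _ = 4 * κ ^ 2 * (N * D) := by rw [hs]; field_simp

/-! ### Products -/

lemma integrable_mul_L2 (f g : L2 L₁ L₂) : Integrable (fun x => f x * g x) := by
  have h := L2.integrable_inner (𝕜 := ℝ) g f
  simpa [RCLike.inner_apply] using h

lemma integral_mul_eq_inner (f g : L2 L₁ L₂) : ∫ x, f x * g x = inner ℝ f g := by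
  rw [L2.inner_def]
  simp [RCLike.inner_apply, mul_comm]

lemma integral_abs_mul_le (f g : L2 L₁ L₂) : ∫ x, |f x * g x| ≤ ‖f‖ * ‖g‖ := by
  have e : ∫ x, |f x * g x| = inner ℝ |f| |g| := by
    rw [← integral_mul_eq_inner]
    apply integral_congr_ae
    filter_upwards [Lp.coeFn_abs f, Lp.coeFn_abs g] with x h1 h2
    rw [h1, h2, abs_mul]
  rw [e]
  refine (real_inner_le_norm _ _).trans ?_
  rw [norm_abs_eq_norm, norm_abs_eq_norm]

lemma integrable_character_mul {h : Torus L₁ L₂ → ℝ} (hh : Integrable h) (k : ℤ × ℤ) :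
    Integrable fun x => (starRingEnd ℂ) (character L₁ L₂ k x) * (h x : ℂ) := by
  refine hh.ofReal.bdd_mul (c := 1) ?_ ?_
  · exact (Complex.continuous_conj.comp (continuous_character k)).aestronglyMeasurable
  · exact Filter.Eventually.of_forall fun x => by rw [RCLike.norm_conj, norm_character]

lemma norm_fourierCoeff2_le (h : Torus L₁ L₂ → ℝ) (k : ℤ × ℤ) :
    ‖fourierCoeff2 h k‖ ≤ (L₁ * L₂)⁻¹ * ∫ x, |h x| := by
  have hA := area_pos L₁ L₂
  rw [fourierCoeff2, norm_mul, Complex.norm_real, one_div,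
    Real.norm_of_nonneg (inv_pos.2 hA).le]
  gcongr
  refine (norm_integral_le_integral_norm _).trans (le_of_eq ?_)
  congr 1
  funext x
  rw [norm_mul, RCLike.norm_conj, norm_character, one_mul, Complex.norm_real, Real.norm_eq_abs]

lemma fourierCoeff2_add {f g : Torus L₁ L₂ → ℝ} (hf : Integrable f) (hg : Integrable g)
    (k : ℤ × ℤ) :
    fourierCoeff2 (fun x => f x + g x) k = fourierCoeff2 f k + fourierCoeff2 g k := by
  rw [fourierCoeff2, fourierCoeff2, fourierCoeff2, ← mul_add,
    ← integral_add (integrable_character_mul hf k) (integrable_character_mul hg k)]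
  congr 2
  funext x
  push_cast
  ring

lemma fourierCoeff2_const_mul (c : ℝ) (f : Torus L₁ L₂ → ℝ) (k : ℤ × ℤ) :
    fourierCoeff2 (fun x => c * f x) k = c * fourierCoeff2 f k := by
  rw [fourierCoeff2, fourierCoeff2, mul_left_comm, ← integral_const_mul (c : ℂ)]
  congr 2
  funext x
  push_cast
  ring

variable (L₁ L₂) in
/-- The Fourier coefficient of a product, as a continuous bilinear map. -/
def prodCoeff (k : ℤ × ℤ) : L2 L₁ L₂ →L[ℝ] L2 L₁ L₂ →L[ℝ] ℂ :=
  LinearMap.mkContinuous₂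
    (LinearMap.mk₂ ℝ (fun f g : L2 L₁ L₂ => fourierCoeff2 (fun x => f x * g x) k)
      (fun f f' g => by
        rw [← fourierCoeff2_add (integrable_mul_L2 f g) (integrable_mul_L2 f' g)]
        apply fourierCoeff2_congr
        filter_upwards [Lp.coeFn_add f f'] with x hx
        rw [hx, Pi.add_apply, add_mul])
      (fun c f g => by
        rw [Complex.real_smul, ← fourierCoeff2_const_mul]
        apply fourierCoeff2_congr
        filter_upwards [Lp.coeFn_smul c f] with x hx
        rw [hx, Pi.smul_apply, smul_eq_mul, mul_assoc])
      (fun f g g' => by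
        rw [← fourierCoeff2_add (integrable_mul_L2 f g) (integrable_mul_L2 f g')]
        apply fourierCoeff2_congr
        filter_upwards [Lp.coeFn_add g g'] with x hx
        rw [hx, Pi.add_apply, mul_add])
      (fun c f g => by
        rw [Complex.real_smul, ← fourierCoeff2_const_mul]
        apply fourierCoeff2_congr
        filter_upwards [Lp.coeFn_smul c g] with x hx
        rw [hx, Pi.smul_apply, smul_eq_mul, mul_left_comm]))
    (L₁ * L₂)⁻¹ (fun f g => by
      rw [LinearMap.mk₂_apply, mul_assoc]
      refine (norm_fourierCoeff2_le _ k).trans ?_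
      have hA := area_pos L₁ L₂
      gcongr
      exact integral_abs_mul_le f g)

lemma prodCoeff_apply (k : ℤ × ℤ) (f g : L2 L₁ L₂) :
    prodCoeff L₁ L₂ k f g = fourierCoeff2 (fun x => f x * g x) k := rfl

lemma norm_prodCoeff_le (k : ℤ × ℤ) (f g : L2 L₁ L₂) :
    ‖prodCoeff L₁ L₂ k f g‖ ≤ (L₁ * L₂)⁻¹ * (‖f‖ * ‖g‖) := by
  rw [prodCoeff_apply]
  refine (norm_fourierCoeff2_le _ k).trans ?_
  have hA := area_pos L₁ L₂
  gcongr
  exact integral_abs_mul_le f g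

lemma prodCoeff_neg (k : ℤ × ℤ) (f g : L2 L₁ L₂) :
    prodCoeff L₁ L₂ (-k) f g = (starRingEnd ℂ) (prodCoeff L₁ L₂ k f g) := by
  rw [prodCoeff_apply, prodCoeff_apply, fourierCoeff2_neg]

lemma prodCoeff_zero (f g : L2 L₁ L₂) :
    prodCoeff L₁ L₂ 0 f g = ((inner ℝ f g / (L₁ * L₂) : ℝ) : ℂ) := by
  rw [prodCoeff_apply, fourierCoeff2, ← integral_mul_eq_inner]
  simp only [character_zero, map_one, one_mul]
  rw [integral_complex_ofReal]
  push_cast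
  ring

/-- Multiplication by a bounded function. -/
lemma exists_mulOp (b : L2 L₁ L₂) {V : ℝ} (hV : ∀ᵐ x, |b x| ≤ V) :
    ∃ M : L2 L₁ L₂ →L[ℝ] L2 L₁ L₂, ∀ f, M f =ᵐ[volume] fun x => b x * f x := by
  have hb : ∀ f : L2 L₁ L₂, ∀ᵐ x, ‖b x * f x‖ ≤ V * ‖f x‖ := fun f => by
    filter_upwards [hV] with x hx
    rw [norm_mul]
    gcongr
    exact hx
  have hm : ∀ f : L2 L₁ L₂, MemLp (fun x => b x * f x) 2 := fun f =>
    (Lp.memLp f).of_le_mul (c := V)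
      ((Lp.aestronglyMeasurable b).mul (Lp.aestronglyMeasurable f)) (hb f)
  refine ⟨LinearMap.mkContinuous
    { toFun := fun f => (hm f).toLp _
      map_add' := fun f g => ?_
      map_smul' := fun c f => ?_ } V fun f => ?_, fun f => (hm f).coeFn_toLp⟩
  · apply Lp.ext
    filter_upwards [(hm (f + g)).coeFn_toLp, (hm f).coeFn_toLp, (hm g).coeFn_toLp,
      Lp.coeFn_add f g, Lp.coeFn_add ((hm f).toLp _) ((hm g).toLp _)] with x h1 h2 h3 h4 h5
    rw [h1, h5, Pi.add_apply, h2, h3, h4, Pi.add_apply, mul_add]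
  · apply Lp.ext
    filter_upwards [(hm (c • f)).coeFn_toLp, (hm f).coeFn_toLp,
      Lp.coeFn_smul c f, Lp.coeFn_smul c ((hm f).toLp _)] with x h1 h2 h4 h5
    rw [RingHom.id_apply, h1, h5, Pi.smul_apply, h2, h4, Pi.smul_apply, smul_eq_mul, smul_eq_mul,
      mul_left_comm]
  · apply Lp.norm_le_mul_norm_of_ae_le_mul
    filter_upwards [(hm f).coeFn_toLp, hb f] with x h1 h2
    simp only [LinearMap.coe_mk, AddHom.coe_mk]
    rw [h1]
    exact h2

/-! ### The transport term -/

/-- `G` is the gradient of `u`, in terms of Fourier coefficients. -/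
def IsGrad (u : L2 L₁ L₂) (G : Fin 2 → L2 L₁ L₂) : Prop :=
  ∀ j k, coef L₁ L₂ k (G j) = Complex.I * (freq L₁ L₂ k j : ℂ) * coef L₁ L₂ k u

/-- A bounded divergence-free field with components in `L²`. -/
structure IsSolenoidal (b : Fin 2 → L2 L₁ L₂) : Prop where
  bdd : ∃ V : ℝ, ∀ j, ∀ᵐ x, |b j x| ≤ V
  div : ∀ k, ∑ j, Complex.I * (freq L₁ L₂ k j : ℂ) * coef L₁ L₂ k (b j) = 0

/-- The zero coefficient is the mean of b · ∇u. By Parseval it is a sum over k of terms containing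
the conjugate of the divergence of b. -/
lemma IsSolenoidal.sum_prodCoeff_zero {b : Fin 2 → L2 L₁ L₂} (hb : IsSolenoidal b)
    {u : L2 L₁ L₂} {G : Fin 2 → L2 L₁ L₂} (hG : IsGrad u G) :
    ∑ j, prodCoeff L₁ L₂ 0 (b j) (G j) = 0 := by
  have h1 := hasSum_sum (s := Finset.univ) fun (j : Fin 2) _ => hasSum_coef_mul (b j) (G j)
  simp only [prodCoeff_zero]
  refine h1.unique (hasSum_zero.congr_fun fun k => ?_)
  have h2 := congrArg (starRingEnd ℂ) (hb.div k)
  rw [map_sum, map_zero] at h2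
  simp only [map_mul, Complex.conj_I, Complex.conj_ofReal, neg_mul, Finset.sum_neg_distrib,
    neg_eq_zero] at h2
  simp only [hG _ k]
  calc ∑ j, (starRingEnd ℂ) (coef L₁ L₂ k (b j)) *
        (Complex.I * (freq L₁ L₂ k j : ℂ) * coef L₁ L₂ k u)
      = (∑ j, Complex.I * (freq L₁ L₂ k j : ℂ) * (starRingEnd ℂ) (coef L₁ L₂ k (b j))) *
        coef L₁ L₂ k u := by
        rw [Finset.sum_mul]
        exact Finset.sum_congr rfl fun j _ => by ring
    _ = 0 := by rw [h2, zero_mul]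

lemma inner_mode (b : L2 L₁ L₂) (z : ℂ) (m : ℤ × ℤ) :
    inner ℝ b (mode L₁ L₂ z m) =
      (L₁ * L₂) * (z * (starRingEnd ℂ) (coef L₁ L₂ m b)).re := by
  have hs : Summable fun k : ℤ × ℤ => ‖if k = m then z else 0‖ ^ 2 := by
    refine summable_of_ne_finset_zero (s := {m}) fun k hk => ?_
    simp [Finset.notMem_singleton.1 hk]
  have h := hasSum_coef_mul b (mode L₁ L₂ z m)
  have e1 : HasSum (fun k => (starRingEnd ℂ) (coef L₁ L₂ k b) * (if k = m then z / 2 else 0))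
      ((starRingEnd ℂ) (coef L₁ L₂ m b) * (z / 2)) := by
    refine (hasSum_ite_eq m ((starRingEnd ℂ) (coef L₁ L₂ m b) * (z / 2))).congr_fun fun k => ?_
    by_cases hk : k = m
    · subst hk; simp
    · simp [hk]
  have e2 : HasSum (fun k => (starRingEnd ℂ) (coef L₁ L₂ k b) *
      (if k = -m then (starRingEnd ℂ) z / 2 else 0))
      (coef L₁ L₂ m b * ((starRingEnd ℂ) z / 2)) := by
    refine (hasSum_ite_eq (-m) (coef L₁ L₂ m b * ((starRingEnd ℂ) z / 2))).congr_fun fun k => ?_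
    by_cases hk : k = -m
    · subst hk; simp [coef_neg]
    · simp [hk]
  have h2 := h.unique ((e1.add e2).congr_fun fun k => by rw [coef_mode, mul_add])
  have h3 := congrArg Complex.re h2
  rw [Complex.ofReal_re] at h3
  rw [div_eq_iff (area_pos L₁ L₂).ne'] at h3
  rw [h3, mul_comm]
  congr 1
  simp
  ring

lemma IsSolenoidal.sum_inner_mode {b : Fin 2 → L2 L₁ L₂} (hb : IsSolenoidal b) (z : ℂ)
    (m : ℤ × ℤ) :
    ∑ j, inner ℝ (b j) (mode L₁ L₂ (Complex.I * (freq L₁ L₂ m j : ℂ) * z) m) = 0 := by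
  simp only [inner_mode]
  rw [← Finset.mul_sum, ← Complex.re_sum]
  have h2 := congrArg (starRingEnd ℂ) (hb.div m)
  rw [map_sum, map_zero] at h2
  simp only [map_mul, Complex.conj_I, Complex.conj_ofReal, neg_mul, Finset.sum_neg_distrib,
    neg_eq_zero] at h2
  have : ∑ j, Complex.I * (freq L₁ L₂ m j : ℂ) * z * (starRingEnd ℂ) (coef L₁ L₂ m (b j)) =
      z * ∑ j, Complex.I * (freq L₁ L₂ m j : ℂ) * (starRingEnd ℂ) (coef L₁ L₂ m (b j)) := by
    rw [Finset.mul_sum]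
    exact Finset.sum_congr rfl fun j _ => by ring
  rw [this, h2]
  simp

lemma re_mul_re (a b : ℂ) : a.re * b.re = ((a * b).re + ((starRingEnd ℂ) a * b).re) / 2 := by
  simp

/-- Product rule: the symmetrized expression pairs b with the gradient of a product of two modes.
Such a product is a sum of modes with indices k + l and -k + l, and b is orthogonal to the gradient
of each. -/
lemma IsSolenoidal.sum_inner_mul_mode {b : Fin 2 → L2 L₁ L₂} (hb : IsSolenoidal b)
    {M : Fin 2 → L2 L₁ L₂ →L[ℝ] L2 L₁ L₂}
    (hM : ∀ j f, M j f =ᵐ[volume] fun x => b j x * f x) (c d : ℂ) (k l : ℤ × ℤ) :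
    ∑ j, inner ℝ (mode L₁ L₂ c k) (M j (mode L₁ L₂ (Complex.I * (freq L₁ L₂ l j : ℂ) * d) l)) +
    ∑ j, inner ℝ (mode L₁ L₂ d l) (M j (mode L₁ L₂ (Complex.I * (freq L₁ L₂ k j : ℂ) * c) k)) =
      0 := by
  have key : ∀ j, inner ℝ (mode L₁ L₂ c k)
        (M j (mode L₁ L₂ (Complex.I * (freq L₁ L₂ l j : ℂ) * d) l)) +
      inner ℝ (mode L₁ L₂ d l) (M j (mode L₁ L₂ (Complex.I * (freq L₁ L₂ k j : ℂ) * c) k)) =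
      inner ℝ (b j) (mode L₁ L₂ (Complex.I * (freq L₁ L₂ (k + l) j : ℂ) * (c * d / 2)) (k + l)) +
      inner ℝ (b j) (mode L₁ L₂ (Complex.I * (freq L₁ L₂ (-k + l) j : ℂ) *
        ((starRingEnd ℂ) c * d / 2)) (-k + l)) := by
    intro j
    rw [← integral_mul_eq_inner, ← integral_mul_eq_inner, ← integral_mul_eq_inner,
      ← integral_mul_eq_inner, ← integral_add (integrable_mul_L2 _ _) (integrable_mul_L2 _ _),
      ← integral_add (integrable_mul_L2 _ _) (integrable_mul_L2 _ _)]
    apply integral_congr_ae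
    filter_upwards [coeFn_mode (L₁ := L₁) (L₂ := L₂) c k, coeFn_mode (L₁ := L₁) (L₂ := L₂) d l,
      coeFn_mode (L₁ := L₁) (L₂ := L₂) (Complex.I * (freq L₁ L₂ l j : ℂ) * d) l,
      coeFn_mode (L₁ := L₁) (L₂ := L₂) (Complex.I * (freq L₁ L₂ k j : ℂ) * c) k,
      hM j (mode L₁ L₂ (Complex.I * (freq L₁ L₂ l j : ℂ) * d) l),
      hM j (mode L₁ L₂ (Complex.I * (freq L₁ L₂ k j : ℂ) * c) k),
      coeFn_mode (L₁ := L₁) (L₂ := L₂)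
        (Complex.I * (freq L₁ L₂ (k + l) j : ℂ) * (c * d / 2)) (k + l),
      coeFn_mode (L₁ := L₁) (L₂ := L₂)
        (Complex.I * (freq L₁ L₂ (-k + l) j : ℂ) * ((starRingEnd ℂ) c * d / 2)) (-k + l)]
      with x h1 h2 h3 h4 h5 h6 h7 h8
    rw [h1, h2, h5, h6, h3, h4, h7, h8, ← mul_add]
    set e := character L₁ L₂ k x with he
    set f := character L₁ L₂ l x with hf
    rw [character_add, character_add, character_neg, ← he, ← hf, freq_add, freq_add, freq_neg]
    have r1 := re_mul_re (c * e) (Complex.I * (freq L₁ L₂ l j : ℂ) * d * f)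
    have r2 := re_mul_re (d * f) (Complex.I * (freq L₁ L₂ k j : ℂ) * c * e)
    -- The second product produces the index -l + k; conjugating inside the real part moves it to -k
    -- + l, where it meets the first.
    have r3 : ((starRingEnd ℂ) (d * f) * (Complex.I * (freq L₁ L₂ k j : ℂ) * c * e)).re =
        (-((starRingEnd ℂ) (c * e) * (Complex.I * (freq L₁ L₂ k j : ℂ) * d * f))).re := by
      rw [← Complex.conj_re]
      congr 1
      simp only [map_mul, Complex.conj_conj, Complex.conj_I, Complex.conj_ofReal]
      ring
    rw [r3] at r2
    have r4 : (c * e).re * (b j x * (Complex.I * (freq L₁ L₂ l j : ℂ) * d * f).re) +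
        (d * f).re * (b j x * (Complex.I * (freq L₁ L₂ k j : ℂ) * c * e).re) =
        b j x * ((c * e).re * (Complex.I * (freq L₁ L₂ l j : ℂ) * d * f).re +
        (d * f).re * (Complex.I * (freq L₁ L₂ k j : ℂ) * c * e).re) := by ring
    rw [r4, r1, r2]
    congr 1
    have h2 : ∀ z : ℂ, z.re / 2 = (z / 2).re := fun z => by simp
    rw [← Complex.add_re, ← Complex.add_re, h2, h2, ← Complex.add_re, ← Complex.add_re]
    congr 1
    push_cast
    rw [map_mul]
    ring
  rw [← Finset.sum_add_distrib, Finset.sum_congr rfl fun j _ => key j, Finset.sum_add_distrib,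
    hb.sum_inner_mode, hb.sum_inner_mode, add_zero]

/-- For a divergence-free field `b`, the transport term `b · ∇u` is orthogonal to `u`. -/
lemma IsSolenoidal.hasSum_transport {b : Fin 2 → L2 L₁ L₂} (hb : IsSolenoidal b)
    {u : L2 L₁ L₂} {G : Fin 2 → L2 L₁ L₂} (hG : IsGrad u G) :
    HasSum (fun k => (starRingEnd ℂ) (coef L₁ L₂ k u) *
      ∑ j, prodCoeff L₁ L₂ k (b j) (G j)) 0 := by
  -- Boundedness of b makes multiplication by it continuous on L², so the identity ⟨u, b · ∇u⟩ = 0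
  -- can be checked on finite sums of modes.
  obtain ⟨V, hV⟩ := hb.bdd
  choose M hM using fun j => exists_mulOp (b j) (hV j)
  have h1 : ∀ k j, prodCoeff L₁ L₂ k (b j) (G j) = coef L₁ L₂ k (M j (G j)) := fun k j => by
    rw [coef_apply, prodCoeff_apply]
    exact fourierCoeff2_congr (hM j (G j)).symm k
  simp only [h1, ← map_sum]
  have h2 : inner ℝ u (∑ j, M j (G j)) = 0 := by
    set m : ℤ × ℤ → L2 L₁ L₂ := fun k => mode L₁ L₂ (coef L₁ L₂ k u) k with hm
    set g : Fin 2 → ℤ × ℤ → L2 L₁ L₂ := fun j k =>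
      mode L₁ L₂ (Complex.I * (freq L₁ L₂ k j : ℂ) * coef L₁ L₂ k u) k with hg
    have hu : HasSum m u := hasSum_mode_coef u
    have hGj : ∀ j, HasSum (g j) (G j) := fun j =>
      (hasSum_mode_coef (G j)).congr_fun fun k => by rw [hg, hG j k]
    have hlim : Filter.Tendsto
        (fun S : Finset (ℤ × ℤ) => inner ℝ (∑ k ∈ S, m k) (∑ j, M j (∑ l ∈ S, g j l)))
        Filter.atTop (nhds (inner ℝ u (∑ j, M j (G j)))) := by
      refine Filter.Tendsto.inner hu (tendsto_finsetSum _ fun j _ => ?_)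
      exact ((M j).continuous.tendsto _).comp (hGj j)
    -- For every finite set of frequencies the double sum vanishes because its matrix is
    -- antisymmetric.
    refine tendsto_nhds_unique hlim (tendsto_const_nhds.congr fun S => ?_)
    set T : ℤ × ℤ → ℤ × ℤ → ℝ := fun k l => ∑ j, inner ℝ (m k) (M j (g j l)) with hT
    have e1 : inner ℝ (∑ k ∈ S, m k) (∑ j, M j (∑ l ∈ S, g j l)) = ∑ k ∈ S, ∑ l ∈ S, T k l := by
      rw [sum_inner]
      refine Finset.sum_congr rfl fun k _ => ?_
      rw [inner_sum, Finset.sum_comm]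
      refine Finset.sum_congr rfl fun j _ => ?_
      rw [map_sum, inner_sum]
    have e2 : ∀ k l, T k l + T l k = 0 := fun k l =>
      hb.sum_inner_mul_mode hM (coef L₁ L₂ k u) (coef L₁ L₂ l u) k l
    have e3 : ∑ k ∈ S, ∑ l ∈ S, T k l + ∑ k ∈ S, ∑ l ∈ S, T k l = 0 := by
      nth_rewrite 2 [Finset.sum_comm]
      rw [← Finset.sum_add_distrib]
      refine Finset.sum_eq_zero fun k _ => ?_
      rw [← Finset.sum_add_distrib]
      exact Finset.sum_eq_zero fun l _ => e2 k l
    rw [e1]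
    linarith
  have h3 := hasSum_coef_mul u (∑ j, M j (G j))
  rw [h2, zero_div, Complex.ofReal_zero] at h3
  exact h3

/-! ### The linear semigroups -/

variable (L₁ L₂) in
/-- The Fourier symbol of `Δ² + a Δ`. -/
def symb (a : ℝ) (k : ℤ × ℤ) : ℝ := freqSq L₁ L₂ k ^ 2 - a * freqSq L₁ L₂ k

lemma symb_neg (a : ℝ) (k : ℤ × ℤ) : symb L₁ L₂ a (-k) = symb L₁ L₂ a k := by
  simp [symb, freqSq_neg]

/-- This is (|ξ|² - 1)² ≥ 0. The loss of 1, caused by growing modes, costs only a factor exp(x) in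
the semigroup bounds. -/
lemma half_weight_sub_one_le_symb {a : ℝ} (ha : a ∈ Icc (0 : ℝ) 1) (k : ℤ × ℤ) :
    weight L₁ L₂ k / 2 - 1 ≤ symb L₁ L₂ a k := by
  have h0 := freqSq_nonneg (L₁ := L₁) (L₂ := L₂) k
  have h1 : a * freqSq L₁ L₂ k ≤ 1 * freqSq L₁ L₂ k := mul_le_mul_of_nonneg_right ha.2 h0
  unfold weight symb
  nlinarith [sq_nonneg (freqSq L₁ L₂ k - 1)]

/-- From y^α ≤ 1 + y ≤ exp y. -/
lemma exp_neg_le_rpow {y α : ℝ} (hy : 0 < y) (h0 : 0 ≤ α) (h1 : α ≤ 1) :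
    Real.exp (-y) ≤ y ^ (-α) := by
  rw [Real.exp_neg, Real.rpow_neg hy.le]
  apply inv_anti₀ (Real.rpow_pos_of_pos hy α)
  have h2 : y ^ α ≤ 1 + y := by
    rcases le_total y 1 with h | h
    · have := Real.rpow_le_one hy.le h h0
      linarith
    · have := Real.rpow_le_rpow_of_exponent_le h h1
      rw [Real.rpow_one] at this
      linarith
  linarith [Real.add_one_le_exp y]

lemma exp_neg_mul_symb_le_exp {a x : ℝ} (ha : a ∈ Icc (0 : ℝ) 1) (hx : 0 ≤ x) (k : ℤ × ℤ) :
    Real.exp (-x * symb L₁ L₂ a k) ≤ Real.exp x := by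
  apply Real.exp_le_exp.2
  have h1 := half_weight_sub_one_le_symb (L₁ := L₁) (L₂ := L₂) ha k
  have h2 := weight_pos (L₁ := L₁) (L₂ := L₂) k
  nlinarith

lemma exp_neg_mul_symb_le {a x α : ℝ} (ha : a ∈ Icc (0 : ℝ) 1) (hx : 0 < x) (h0 : 0 ≤ α)
    (h1 : α ≤ 1) (k : ℤ × ℤ) :
    Real.exp (-x * symb L₁ L₂ a k) ≤
      2 * Real.exp x * x ^ (-α) * weight L₁ L₂ k ^ (-α) := by
  have hw := weight_pos (L₁ := L₁) (L₂ := L₂) k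
  have e1 : Real.exp (-x * symb L₁ L₂ a k) ≤
      Real.exp x * Real.exp (-(x * weight L₁ L₂ k / 2)) := by
    rw [← Real.exp_add]
    apply Real.exp_le_exp.2
    have := half_weight_sub_one_le_symb (L₁ := L₁) (L₂ := L₂) ha k
    nlinarith
  have e2 : Real.exp (-(x * weight L₁ L₂ k / 2)) ≤ (x * weight L₁ L₂ k / 2) ^ (-α) :=
    exp_neg_le_rpow (by positivity) h0 h1
  have e3 : (x * weight L₁ L₂ k / 2) ^ (-α) =
      x ^ (-α) * weight L₁ L₂ k ^ (-α) * 2 ^ α := by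
    rw [Real.div_rpow (by positivity) (by norm_num), Real.mul_rpow hx.le hw.le,
      Real.rpow_neg (by norm_num : (0 : ℝ) ≤ 2) α, div_inv_eq_mul]
  have e4 : (2 : ℝ) ^ α ≤ 2 := by
    have := Real.rpow_le_rpow_of_exponent_le (by norm_num : (1 : ℝ) ≤ 2) h1
    rwa [Real.rpow_one] at this
  calc Real.exp (-x * symb L₁ L₂ a k)
      ≤ Real.exp x * (x ^ (-α) * weight L₁ L₂ k ^ (-α) * 2 ^ α) := by
        rw [← e3]
        exact e1.trans (by gcongr)
    _ ≤ Real.exp x * (x ^ (-α) * weight L₁ L₂ k ^ (-α) * 2) := by gcongr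
    _ = 2 * Real.exp x * x ^ (-α) * weight L₁ L₂ k ^ (-α) := by ring

/-- The larger of p and q is at least their mean, so only one factor is singular at a time. It
decouples the two endpoint singularities of the Duhamel kernel. -/
lemma rpow_mul_rpow_le {p q α : ℝ} (hp : 0 < p) (hq : 0 < q) (h0 : 0 ≤ α) :
    p ^ (-α) * q ^ (-(1 / 2) : ℝ) ≤
      ((p + q) / 2) ^ (-(1 / 2) : ℝ) * p ^ (-α) + ((p + q) / 2) ^ (-α) * q ^ (-(1 / 2) : ℝ) := by
  rcases le_total p q with h | h
  · have : q ^ (-(1 / 2) : ℝ) ≤ ((p + q) / 2) ^ (-(1 / 2) : ℝ) :=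
      Real.rpow_le_rpow_of_nonpos (by positivity) (by linarith) (by norm_num)
    have h2 : 0 ≤ ((p + q) / 2) ^ (-α) * q ^ (-(1 / 2) : ℝ) := by positivity
    have h3 : p ^ (-α) * q ^ (-(1 / 2) : ℝ) ≤ p ^ (-α) * ((p + q) / 2) ^ (-(1 / 2) : ℝ) := by
      gcongr
    linarith
  · have : p ^ (-α) ≤ ((p + q) / 2) ^ (-α) :=
      Real.rpow_le_rpow_of_nonpos (by positivity) (by linarith) (by linarith)
    have h2 : 0 ≤ ((p + q) / 2) ^ (-(1 / 2) : ℝ) * p ^ (-α) := by positivity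
    have h3 : p ^ (-α) * q ^ (-(1 / 2) : ℝ) ≤ ((p + q) / 2) ^ (-α) * q ^ (-(1 / 2) : ℝ) := by
      gcongr
    linarith

lemma intervalIntegrable_sub_rpow {s t r : ℝ} (hr : -1 < r) :
    IntervalIntegrable (fun τ => (τ - s) ^ r) volume s t := by
  have h := (intervalIntegral.intervalIntegrable_rpow' (a := 0) (b := t - s) hr).comp_sub_right s
  simpa using h

lemma intervalIntegrable_rsub_rpow {s t r : ℝ} (hr : -1 < r) :
    IntervalIntegrable (fun τ => (t - τ) ^ r) volume s t := by
  have h := (intervalIntegral.intervalIntegrable_rpow' (a := t - s) (b := 0) hr).comp_sub_left t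
  simpa using h

/-- A bound for the kernel of Beta type. -/
lemma exists_beta_majorant {s t α : ℝ} (hst : s < t) (h0 : 0 ≤ α) (h1 : α < 1) :
    ∃ g : ℝ → ℝ, IntervalIntegrable g volume s t ∧
      (∀ τ ∈ Ioo s t, (t - τ) ^ (-α) * (τ - s) ^ (-(1 / 2) : ℝ) ≤ g τ) ∧
      ∫ τ in s..t, g τ ≤ 6 / (1 - α) * (t - s) ^ (1 / 2 - α) := by
  have hl : 0 < t - s := sub_pos.2 hst
  have hα : 0 < 1 - α := by linarith
  refine ⟨fun τ => ((t - s) / 2) ^ (-(1 / 2) : ℝ) * (t - τ) ^ (-α) +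
    ((t - s) / 2) ^ (-α) * (τ - s) ^ (-(1 / 2) : ℝ), ?_, fun τ hτ => ?_, ?_⟩
  · exact ((intervalIntegrable_rsub_rpow (by linarith)).const_mul _).add
      ((intervalIntegrable_sub_rpow (by norm_num)).const_mul _)
  · have := rpow_mul_rpow_le (sub_pos.2 hτ.2) (sub_pos.2 hτ.1) h0
    simpa using this
  · rw [intervalIntegral.integral_add
      ((intervalIntegrable_rsub_rpow (by linarith)).const_mul _)
      ((intervalIntegrable_sub_rpow (by norm_num)).const_mul _),
      intervalIntegral.integral_const_mul, intervalIntegral.integral_const_mul,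
      intervalIntegral.integral_comp_sub_left (fun y => y ^ (-α)),
      intervalIntegral.integral_comp_sub_right (fun y => y ^ (-(1 / 2) : ℝ)), sub_self, sub_self,
      integral_rpow (Or.inl (by linarith)), integral_rpow (Or.inl (by norm_num)),
      Real.zero_rpow (by linarith), Real.zero_rpow (by norm_num), sub_zero, sub_zero,
      Real.div_rpow hl.le (by norm_num), Real.div_rpow hl.le (by norm_num)]
    have e1 : (t - s) ^ (-(1 / 2) : ℝ) * (t - s) ^ (-α + 1) = (t - s) ^ (1 / 2 - α) := by
      rw [← Real.rpow_add hl]; congr 1; ring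
    have e2 : (t - s) ^ (-α) * (t - s) ^ (-(1 / 2) + 1 : ℝ) = (t - s) ^ (1 / 2 - α) := by
      rw [← Real.rpow_add hl]; congr 1; ring
    have b1 : (2 : ℝ) ^ (1 / 2 : ℝ) ≤ 2 := by
      have := Real.rpow_le_rpow_of_exponent_le (by norm_num : (1 : ℝ) ≤ 2)
        (by norm_num : (1 / 2 : ℝ) ≤ 1)
      rwa [Real.rpow_one] at this
    have b2 : (2 : ℝ) ^ α ≤ 2 := by
      have := Real.rpow_le_rpow_of_exponent_le (by norm_num : (1 : ℝ) ≤ 2) h1.le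
      rwa [Real.rpow_one] at this
    rw [Real.rpow_neg (by norm_num : (0 : ℝ) ≤ 2) (1 / 2 : ℝ),
      Real.rpow_neg (by norm_num : (0 : ℝ) ≤ 2) α, div_inv_eq_mul, div_inv_eq_mul]
    set E := (t - s) ^ (1 / 2 - α) with hE
    have hE0 : 0 ≤ E := by positivity
    calc (t - s) ^ (-(1 / 2) : ℝ) * 2 ^ (1 / 2 : ℝ) * ((t - s) ^ (-α + 1) / (-α + 1)) +
          (t - s) ^ (-α) * 2 ^ α * ((t - s) ^ (-(1 / 2) + 1 : ℝ) / (-(1 / 2) + 1))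
        = 2 ^ (1 / 2 : ℝ) * (((t - s) ^ (-(1 / 2) : ℝ) * (t - s) ^ (-α + 1)) / (1 - α)) +
          2 * 2 ^ α * ((t - s) ^ (-α) * (t - s) ^ (-(1 / 2) + 1 : ℝ)) := by
          rw [show -α + 1 = 1 - α by ring]; ring
      _ ≤ 2 * (E / (1 - α)) + 2 * 2 * E := by
          rw [e1, e2]
          gcongr
      _ ≤ 6 / (1 - α) * E := by
          have : E ≤ E / (1 - α) := by
            rw [le_div_iff₀ hα]; nlinarith
          have e : 6 / (1 - α) * E = 6 * (E / (1 - α)) := by ring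
          rw [e]; linarith

/-- The bound for Duhamel's integral, for each Fourier coefficient. -/
lemma norm_duhamel_le {a s t α D : ℝ} {f : ℝ → ℂ} (ha : a ∈ Icc (0 : ℝ) 1) (hst : s ≤ t)
    (h0 : 0 ≤ α) (h1 : α < 1) (hD : 0 ≤ D)
    (hf : ∀ τ ∈ Ioo s t, ‖f τ‖ ≤ D * (τ - s) ^ (-(1 / 2) : ℝ)) (k : ℤ × ℤ) :
    ‖∫ τ in s..t, Real.exp (-(t - τ) * symb L₁ L₂ a k) * f τ‖ ≤
      D * (12 / (1 - α)) * Real.exp (t - s) * (t - s) ^ (1 / 2 - α) * weight L₁ L₂ k ^ (-α) := by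
  rcases hst.eq_or_lt with rfl | hst
  · have hα : 0 < 1 - α := by linarith
    have := weight_pos (L₁ := L₁) (L₂ := L₂) k
    rw [intervalIntegral.integral_same, norm_zero, sub_self]
    positivity
  obtain ⟨g, hg, hgb, hgi⟩ := exists_beta_majorant hst h0 h1
  have hw := weight_pos (L₁ := L₁) (L₂ := L₂) k
  set P := D * (2 * Real.exp (t - s)) * weight L₁ L₂ k ^ (-α) with hP
  have hP0 : 0 ≤ P := by positivity
  have hb : ∀ᵐ τ ∂volume, τ ∈ Ioc s t →
      ‖(Real.exp (-(t - τ) * symb L₁ L₂ a k) : ℂ) * f τ‖ ≤ P * g τ := by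
    -- The kernel is singular at τ = t, a null set.
    have hne : ∀ᵐ τ : ℝ, τ ≠ t := by simp [ae_iff, measure_singleton]
    filter_upwards [hne] with τ hτ hτ2
    have hτ' : τ ∈ Ioo s t := ⟨hτ2.1, lt_of_le_of_ne hτ2.2 hτ⟩
    have hx : 0 < t - τ := sub_pos.2 hτ'.2
    have hy : 0 < τ - s := sub_pos.2 hτ'.1
    rw [norm_mul, Complex.norm_real, Real.norm_of_nonneg (Real.exp_pos _).le]
    calc Real.exp (-(t - τ) * symb L₁ L₂ a k) * ‖f τ‖
        ≤ (2 * Real.exp (t - τ) * (t - τ) ^ (-α) * weight L₁ L₂ k ^ (-α)) *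
          (D * (τ - s) ^ (-(1 / 2) : ℝ)) := by
          gcongr
          · exact exp_neg_mul_symb_le ha hx h0 h1.le k
          · exact hf τ hτ'
      _ ≤ (2 * Real.exp (t - s) * (t - τ) ^ (-α) * weight L₁ L₂ k ^ (-α)) *
          (D * (τ - s) ^ (-(1 / 2) : ℝ)) := by
          gcongr
          exact hτ'.1.le
      _ = P * ((t - τ) ^ (-α) * (τ - s) ^ (-(1 / 2) : ℝ)) := by rw [hP]; ring
      _ ≤ P * g τ := by gcongr; exact hgb τ hτ'
  refine (intervalIntegral.norm_integral_le_of_norm_le hst.le hb (hg.const_mul P)).trans ?_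
  rw [intervalIntegral.integral_const_mul]
  calc P * ∫ τ in s..t, g τ ≤ P * (6 / (1 - α) * (t - s) ^ (1 / 2 - α)) := by gcongr
    _ = D * (12 / (1 - α)) * Real.exp (t - s) * (t - s) ^ (1 / 2 - α) *
        weight L₁ L₂ k ^ (-α) := by rw [hP]; ring

/-! ### Functions with decaying coefficients -/

variable (L₁ L₂) in
/-- The `L²` norm of the function with coefficients `(1 + |ξ|⁴)^{-3/8}`. -/
def decayConst : ℝ := Real.sqrt ((L₁ * L₂) * ∑' k, weight L₁ L₂ k ^ (-(3 / 4) : ℝ))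

lemma decayConst_nonneg : 0 ≤ decayConst L₁ L₂ := Real.sqrt_nonneg _

lemma sq_mul_weight_rpow (P : ℝ) (k : ℤ × ℤ) : (P * weight L₁ L₂ k ^ (-(3 / 8) : ℝ)) ^ 2 =
    P ^ 2 * weight L₁ L₂ k ^ (-(3 / 4) : ℝ) := by
  rw [mul_pow, ← Real.rpow_natCast (weight L₁ L₂ k ^ (-(3 / 8) : ℝ)),
    ← Real.rpow_mul (weight_pos k).le]
  norm_num

lemma summable_of_decay {c : ℤ × ℤ → ℂ} {P : ℝ}
    (h : ∀ k, ‖c k‖ ≤ P * weight L₁ L₂ k ^ (-(3 / 8) : ℝ)) : Summable fun k => ‖c k‖ ^ 2 := by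
  refine Summable.of_nonneg_of_le (fun _ => by positivity) (fun k => ?_)
    ((summable_weight_rpow L₁ L₂).mul_left (P ^ 2))
  rw [← sq_mul_weight_rpow]
  gcongr
  exact h k

lemma norm_ofCoeff_le_of_decay {c : ℤ × ℤ → ℂ} {P : ℝ} (hP : 0 ≤ P)
    (h : ∀ k, ‖c k‖ ≤ P * weight L₁ L₂ k ^ (-(3 / 8) : ℝ))
    (hs : ∀ k, c (-k) = (starRingEnd ℂ) (c k)) :
    ‖ofCoeff L₁ L₂ c‖ ≤ decayConst L₁ L₂ * P := by
  have hA := (area_pos L₁ L₂).le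
  rw [decayConst, ← abs_of_nonneg (norm_nonneg (ofCoeff L₁ L₂ c)), ← Real.sqrt_sq_eq_abs,
    ← Real.sqrt_sq hP, ← Real.sqrt_mul' _ (sq_nonneg P)]
  apply Real.sqrt_le_sqrt
  rw [norm_ofCoeff_sq (summable_of_decay h) hs, mul_assoc (L₁ * L₂)]
  refine mul_le_mul_of_nonneg_left ?_ hA
  rw [← tsum_mul_right]
  refine (summable_of_decay h).tsum_le_tsum (fun k => ?_)
    ((summable_weight_rpow L₁ L₂).mul_right (P ^ 2))
  rw [mul_comm, ← sq_mul_weight_rpow]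
  gcongr
  exact h k

variable (L₁ L₂) in
/-- The gradient of the function with coefficients `x`. -/
def gradOf (x : ℤ × ℤ → ℂ) : Fin 2 → L2 L₁ L₂ := fun j =>
  ofCoeff L₁ L₂ fun k => Complex.I * (freq L₁ L₂ k j : ℂ) * x k

lemma grad_symm {x : ℤ × ℤ → ℂ} (hs : ∀ k, x (-k) = (starRingEnd ℂ) (x k)) (j : Fin 2)
    (k : ℤ × ℤ) : Complex.I * (freq L₁ L₂ (-k) j : ℂ) * x (-k) =
      (starRingEnd ℂ) (Complex.I * (freq L₁ L₂ k j : ℂ) * x k) := by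
  simp [hs, freq_neg]

lemma norm_grad_coeff_sq_le (x : ℤ × ℤ → ℂ) (j : Fin 2) (k : ℤ × ℤ) :
    ‖Complex.I * (freq L₁ L₂ k j : ℂ) * x k‖ ^ 2 ≤ freqSq L₁ L₂ k * ‖x k‖ ^ 2 := by
  rw [norm_mul, norm_mul, Complex.norm_I, one_mul, Complex.norm_real, mul_pow, Real.norm_eq_abs,
    sq_abs]
  gcongr
  exact freq_sq_le k j

lemma summable_grad_coeff {x : ℤ × ℤ → ℂ} (hx : Summable fun k => freqSq L₁ L₂ k * ‖x k‖ ^ 2)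
    (j : Fin 2) : Summable fun k => ‖Complex.I * (freq L₁ L₂ k j : ℂ) * x k‖ ^ 2 :=
  Summable.of_nonneg_of_le (fun _ => by positivity) (fun k => norm_grad_coeff_sq_le x j k) hx

lemma coef_gradOf {x : ℤ × ℤ → ℂ} (hx : Summable fun k => freqSq L₁ L₂ k * ‖x k‖ ^ 2)
    (hs : ∀ k, x (-k) = (starRingEnd ℂ) (x k)) (j : Fin 2) (k : ℤ × ℤ) :
    coef L₁ L₂ k (gradOf L₁ L₂ x j) = Complex.I * (freq L₁ L₂ k j : ℂ) * x k :=
  coef_ofCoeff (summable_grad_coeff hx j) (grad_symm hs j) k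

/-- A derivative costs the power 1/4 of the weight. Decay 5/8 leaves 3/8, whose square 3/4 is
summable. -/
lemma grad_decay {x : ℤ × ℤ → ℂ} {P : ℝ}
    (h : ∀ k, ‖x k‖ ≤ P * weight L₁ L₂ k ^ (-(5 / 8) : ℝ)) (j : Fin 2) (k : ℤ × ℤ) :
    ‖Complex.I * (freq L₁ L₂ k j : ℂ) * x k‖ ≤ P * weight L₁ L₂ k ^ (-(3 / 8) : ℝ) := by
  have hw := weight_pos (L₁ := L₁) (L₂ := L₂) k
  have h1 : |freq L₁ L₂ k j| ≤ weight L₁ L₂ k ^ (1 / 4 : ℝ) := by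
    have : |freq L₁ L₂ k j| ≤ Real.sqrt (freqSq L₁ L₂ k) := Real.abs_le_sqrt (freq_sq_le k j)
    refine this.trans ?_
    rw [Real.sqrt_eq_rpow]
    calc freqSq L₁ L₂ k ^ (1 / 2 : ℝ) ≤ (weight L₁ L₂ k ^ (1 / 2 : ℝ)) ^ (1 / 2 : ℝ) :=
          Real.rpow_le_rpow (freqSq_nonneg k) (freqSq_le_weight_rpow k) (by norm_num)
      _ = weight L₁ L₂ k ^ (1 / 4 : ℝ) := by rw [← Real.rpow_mul hw.le]; norm_num
  rw [norm_mul, norm_mul, Complex.norm_I, one_mul, Complex.norm_real, Real.norm_eq_abs]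
  calc |freq L₁ L₂ k j| * ‖x k‖
      ≤ weight L₁ L₂ k ^ (1 / 4 : ℝ) * (P * weight L₁ L₂ k ^ (-(5 / 8) : ℝ)) := by
        gcongr
        exact h k
    _ = P * (weight L₁ L₂ k ^ (1 / 4 : ℝ) * weight L₁ L₂ k ^ (-(5 / 8) : ℝ)) := by ring
    _ = P * weight L₁ L₂ k ^ (-(3 / 8) : ℝ) := by rw [← Real.rpow_add hw]; norm_num

lemma summable_grad_of_decay {x : ℤ × ℤ → ℂ} {P : ℝ}
    (h : ∀ k, ‖x k‖ ≤ P * weight L₁ L₂ k ^ (-(5 / 8) : ℝ)) :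
    Summable fun k => freqSq L₁ L₂ k * ‖x k‖ ^ 2 := by
  have h1 := (summable_of_decay (grad_decay h 0)).add (summable_of_decay (grad_decay h 1))
  refine h1.congr fun k => ?_
  simp only [norm_mul, Complex.norm_I, one_mul, Complex.norm_real, mul_pow, Real.norm_eq_abs,
    sq_abs, freqSq, Fin.sum_univ_two]
  ring

lemma norm_gradOf_le_of_decay {x : ℤ × ℤ → ℂ} {P : ℝ} (hP : 0 ≤ P)
    (h : ∀ k, ‖x k‖ ≤ P * weight L₁ L₂ k ^ (-(5 / 8) : ℝ))
    (hs : ∀ k, x (-k) = (starRingEnd ℂ) (x k)) :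
    ‖gradOf L₁ L₂ x‖ ≤ decayConst L₁ L₂ * P :=
  (pi_norm_le_iff_of_nonneg (mul_nonneg decayConst_nonneg hP)).2 fun j =>
    norm_ofCoeff_le_of_decay hP (grad_decay h j) (grad_symm hs j)

/-! ### The nonlinearity -/

/-- The Fourier coefficients of `-(a / 2) |G|² - b · G`. -/
def force (a : ℝ) (b G : Fin 2 → L2 L₁ L₂) (k : ℤ × ℤ) : ℂ :=
  -((a / 2 : ℝ) * ∑ j, prodCoeff L₁ L₂ k (G j) (G j)) - ∑ j, prodCoeff L₁ L₂ k (b j) (G j)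

lemma force_zero (a : ℝ) (b : Fin 2 → L2 L₁ L₂) (k : ℤ × ℤ) : force a b 0 k = 0 := by
  simp [force]

lemma force_neg (a : ℝ) (b G : Fin 2 → L2 L₁ L₂) (k : ℤ × ℤ) :
    force a b G (-k) = (starRingEnd ℂ) (force a b G k) := by
  simp only [force, prodCoeff_neg, map_sub, map_neg, map_mul, map_sum, Complex.conj_ofReal]

/-- The quadratic term is factored as G² - H² = G(G - H) + (G - H)H, and coefficients are bounded by
L¹ norms of products. The factor 2 counts the components. -/
lemma norm_force_sub_le {a : ℝ} (ha : a ∈ Icc (0 : ℝ) 1) (b G H : Fin 2 → L2 L₁ L₂)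
    (k : ℤ × ℤ) : ‖force a b G k - force a b H k‖ ≤
      2 / (L₁ * L₂) * ((‖b‖ + ‖G‖ + ‖H‖) * ‖G - H‖) := by
  have hA := inv_pos.2 (area_pos L₁ L₂)
  have e : force a b G k - force a b H k =
      ∑ j, (-((a / 2 : ℝ) * (prodCoeff L₁ L₂ k (G j) ((G - H) j) +
        prodCoeff L₁ L₂ k ((G - H) j) (H j))) - prodCoeff L₁ L₂ k (b j) ((G - H) j)) := by
    simp only [force, Pi.sub_apply, map_sub, sub_apply, Fin.sum_univ_two]
    ring
  rw [e]
  refine (norm_sum_le _ _).trans ?_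
  have hb : ∀ j ∈ Finset.univ, ‖-(((a / 2 : ℝ) : ℂ) * (prodCoeff L₁ L₂ k (G j) ((G - H) j) +
        prodCoeff L₁ L₂ k ((G - H) j) (H j))) - prodCoeff L₁ L₂ k (b j) ((G - H) j)‖ ≤
      (L₁ * L₂)⁻¹ * ((‖b‖ + ‖G‖ + ‖H‖) * ‖G - H‖) := by
    intro j _
    have h1 := norm_prodCoeff_le k (G j) ((G - H) j)
    have h2 := norm_prodCoeff_le k ((G - H) j) (H j)
    have h3 := norm_prodCoeff_le k (b j) ((G - H) j)
    have g1 : ‖G j‖ * ‖(G - H) j‖ ≤ ‖G‖ * ‖G - H‖ := by gcongr <;> exact norm_le_pi_norm _ j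
    have g2 : ‖(G - H) j‖ * ‖H j‖ ≤ ‖G - H‖ * ‖H‖ := by gcongr <;> exact norm_le_pi_norm _ j
    have g3 : ‖b j‖ * ‖(G - H) j‖ ≤ ‖b‖ * ‖G - H‖ := by gcongr <;> exact norm_le_pi_norm _ j
    have h4 : ‖((a / 2 : ℝ) : ℂ)‖ ≤ 1 := by
      rw [Complex.norm_real, Real.norm_eq_abs, abs_le]
      constructor <;> linarith [ha.1, ha.2]
    calc _ ≤ ‖((a / 2 : ℝ) : ℂ)‖ * (‖prodCoeff L₁ L₂ k (G j) ((G - H) j)‖ +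
          ‖prodCoeff L₁ L₂ k ((G - H) j) (H j)‖) + ‖prodCoeff L₁ L₂ k (b j) ((G - H) j)‖ := by
          refine (norm_sub_le _ _).trans ?_
          rw [norm_neg, norm_mul]
          gcongr
          exact norm_add_le _ _
      _ ≤ 1 * ((L₁ * L₂)⁻¹ * (‖G‖ * ‖G - H‖) + (L₁ * L₂)⁻¹ * (‖G - H‖ * ‖H‖)) +
          (L₁ * L₂)⁻¹ * (‖b‖ * ‖G - H‖) := by
          gcongr
          · exact h1.trans (by gcongr)
          · exact h2.trans (by gcongr)
          · exact h3.trans (by gcongr)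
      _ = _ := by ring
  refine (Finset.sum_le_sum hb).trans (le_of_eq ?_)
  rw [Finset.sum_const, Finset.card_univ, Fintype.card_fin, nsmul_eq_mul]
  push_cast
  ring

/-- A bounded measurable divergence-free field, as a function of time. -/
structure IsField (b : ℝ → Fin 2 → L2 L₁ L₂) (V : ℝ) : Prop where
  meas : AEStronglyMeasurable b volume
  norm_le : ∀ τ, ‖b τ‖ ≤ V
  sol : ∀ τ, IsSolenoidal (b τ)

lemma IsField.nonneg {b : ℝ → Fin 2 → L2 L₁ L₂} {V : ℝ} (hb : IsField b V) : 0 ≤ V :=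
  (norm_nonneg _).trans (hb.norm_le 0)

lemma aestronglyMeasurable_force (a : ℝ) {b G : ℝ → Fin 2 → L2 L₁ L₂} {ν : Measure ℝ}
    (hb : AEStronglyMeasurable b ν) (hG : AEStronglyMeasurable G ν) (k : ℤ × ℤ) :
    AEStronglyMeasurable (fun τ => force a (b τ) (G τ) k) ν := by
  have hp : Continuous fun p : (Fin 2 → L2 L₁ L₂) × (Fin 2 → L2 L₁ L₂) => force a p.1 p.2 k := by
    have hq : ∀ f g : (Fin 2 → L2 L₁ L₂) × (Fin 2 → L2 L₁ L₂) → L2 L₁ L₂, Continuous f →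
        Continuous g → Continuous fun p => prodCoeff L₁ L₂ k (f p) (g p) :=
      fun f g hf hg => ((prodCoeff L₁ L₂ k).continuous.comp hf).clm_apply hg
    have h1 : ∀ j, Continuous fun p : (Fin 2 → L2 L₁ L₂) × (Fin 2 → L2 L₁ L₂) => p.1 j :=
      fun j => (continuous_apply j).comp continuous_fst
    have h2 : ∀ j, Continuous fun p : (Fin 2 → L2 L₁ L₂) × (Fin 2 → L2 L₁ L₂) => p.2 j :=
      fun j => (continuous_apply j).comp continuous_snd
    exact (continuous_const.mul (continuous_finsetSum _ fun j _ => hq _ _ (h2 j) (h2 j))).neg.sub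
      (continuous_finsetSum _ fun j _ => hq _ _ (h1 j) (h2 j))
  exact Continuous.comp_aestronglyMeasurable
    (g := fun p : (Fin 2 → L2 L₁ L₂) × (Fin 2 → L2 L₁ L₂) => force a p.1 p.2 k)
    (f := fun τ => (b τ, G τ)) hp (hb.prodMk hG)

/-- `G` is measurable on `(s, T]` and `‖G t‖ ≤ M (t - s)^{-1/4}`. -/
structure IsAdmissible (s T M : ℝ) (G : ℝ → Fin 2 → L2 L₁ L₂) : Prop where
  meas : AEStronglyMeasurable G (volume.restrict (Ioc s T))
  bound : ∀ t ∈ Ioc s T, ‖G t‖ ≤ M * (t - s) ^ (-(1 / 4) : ℝ)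

lemma rpow_neg_quarter_sq {y : ℝ} (hy : 0 < y) :
    y ^ (-(1 / 4) : ℝ) * y ^ (-(1 / 4) : ℝ) = y ^ (-(1 / 2) : ℝ) := by
  rw [← Real.rpow_add hy]; norm_num

/-- Lets the transport term, which is only as singular as y^{-1/4}, share the bound y^{-1/2} of the
quadratic term. -/
lemma rpow_neg_quarter_le {y ℓ : ℝ} (hy : 0 < y) (hl : y ≤ ℓ) :
    y ^ (-(1 / 4) : ℝ) ≤ (1 + ℓ) * y ^ (-(1 / 2) : ℝ) := by
  have e : y ^ (-(1 / 4) : ℝ) = y ^ (1 / 4 : ℝ) * y ^ (-(1 / 2) : ℝ) := by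
    rw [← Real.rpow_add hy]; norm_num
  rw [e]
  gcongr
  rcases le_total y 1 with h | h
  · have := Real.rpow_le_one hy.le h (by norm_num : (0 : ℝ) ≤ 1 / 4)
    linarith
  · have := Real.rpow_le_rpow_of_exponent_le h (by norm_num : (1 / 4 : ℝ) ≤ 1)
    rw [Real.rpow_one] at this
    linarith

/-- The difference of the forces of two admissible functions. -/
lemma norm_force_sub_le_of_bound {a V M D ℓ y : ℝ} (ha : a ∈ Icc (0 : ℝ) 1) {b G H : Fin 2 → L2 L₁ L₂}
    (hV : 0 ≤ V) (hM : 0 ≤ M) (hD : 0 ≤ D) (hy : 0 < y) (hl : y ≤ ℓ) (hb : ‖b‖ ≤ V)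
    (hG : ‖G‖ ≤ M * y ^ (-(1 / 4) : ℝ)) (hH : ‖H‖ ≤ M * y ^ (-(1 / 4) : ℝ))
    (hGH : ‖G - H‖ ≤ D * y ^ (-(1 / 4) : ℝ)) (k : ℤ × ℤ) :
    ‖force a b G k - force a b H k‖ ≤
      2 / (L₁ * L₂) * ((V * (1 + ℓ) + 2 * M) * D) * y ^ (-(1 / 2) : ℝ) := by
  have hA := area_pos L₁ L₂
  refine (norm_force_sub_le ha b G H k).trans ?_
  rw [mul_assoc (2 / (L₁ * L₂))]
  refine mul_le_mul_of_nonneg_left ?_ (by positivity)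
  calc (‖b‖ + ‖G‖ + ‖H‖) * ‖G - H‖
      ≤ (V + M * y ^ (-(1 / 4) : ℝ) + M * y ^ (-(1 / 4) : ℝ)) * (D * y ^ (-(1 / 4) : ℝ)) := by
        gcongr
    _ = V * D * y ^ (-(1 / 4) : ℝ) + 2 * M * D * (y ^ (-(1 / 4) : ℝ) * y ^ (-(1 / 4) : ℝ)) := by
        ring
    _ ≤ V * D * ((1 + ℓ) * y ^ (-(1 / 2) : ℝ)) + 2 * M * D * y ^ (-(1 / 2) : ℝ) := by
        rw [rpow_neg_quarter_sq hy]
        gcongr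
        exact rpow_neg_quarter_le hy hl
    _ = (V * (1 + ℓ) + 2 * M) * D * y ^ (-(1 / 2) : ℝ) := by ring

lemma IsAdmissible.norm_force_le {a V s T M : ℝ} (ha : a ∈ Icc (0 : ℝ) 1)
    {b G : ℝ → Fin 2 → L2 L₁ L₂} (hb : IsField b V) (hM : 0 ≤ M) (hG : IsAdmissible s T M G)
    {τ : ℝ} (hτ : τ ∈ Ioc s T) (k : ℤ × ℤ) :
    ‖force a (b τ) (G τ) k‖ ≤
      2 / (L₁ * L₂) * ((V * (1 + (T - s)) + 2 * M) * M) * (τ - s) ^ (-(1 / 2) : ℝ) := by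
  have hy : 0 < τ - s := sub_pos.2 hτ.1
  have h := norm_force_sub_le_of_bound ha hb.nonneg hM hM hy
    (sub_le_sub_right hτ.2 s) (hb.norm_le τ)
    (hG.bound τ hτ) (H := 0) (by rw [norm_zero]; positivity)
    (by rw [sub_zero]; exact hG.bound τ hτ) k
  simpa [force_zero] using h

lemma IsAdmissible.intervalIntegrable_force {a V s T M : ℝ} (ha : a ∈ Icc (0 : ℝ) 1)
    {b G : ℝ → Fin 2 → L2 L₁ L₂} (hb : IsField b V) (hM : 0 ≤ M) (hG : IsAdmissible s T M G)
    (hsT : s ≤ T) (k : ℤ × ℤ) :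
    IntervalIntegrable (fun τ => force a (b τ) (G τ) k) volume s T := by
  rw [intervalIntegrable_iff_integrableOn_Ioc_of_le hsT]
  have h1 : IntegrableOn (fun τ => 2 / (L₁ * L₂) * ((V * (1 + (T - s)) + 2 * M) * M) *
      (τ - s) ^ (-(1 / 2) : ℝ)) (Ioc s T) := by
    rw [← intervalIntegrable_iff_integrableOn_Ioc_of_le hsT]
    exact (intervalIntegrable_sub_rpow (by norm_num)).const_mul _
  refine Integrable.mono' h1 (aestronglyMeasurable_force a hb.meas.restrict hG.meas k) ?_
  rw [ae_restrict_iff' measurableSet_Ioc]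
  exact Filter.Eventually.of_forall fun τ hτ => hG.norm_force_le ha hb hM hτ k

/-! ### The Duhamel map -/

/-- The Fourier coefficients of Duhamel's integral. -/
def duhamel (a : ℝ) (b G : ℝ → Fin 2 → L2 L₁ L₂) (s t : ℝ) (k : ℤ × ℤ) : ℂ :=
  ∫ τ in s..t, (Real.exp (-(t - τ) * symb L₁ L₂ a k) : ℂ) * force a (b τ) (G τ) k

/-- The Fourier coefficients of the right-hand side of Duhamel's formula. -/
def flowCoeff (a : ℝ) (b G : ℝ → Fin 2 → L2 L₁ L₂) (s : ℝ) (c : ℤ × ℤ → ℂ) (t : ℝ)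
    (k : ℤ × ℤ) : ℂ :=
  Real.exp (-(t - s) * symb L₁ L₂ a k) * c k + duhamel a b G s t k

lemma duhamel_neg (a : ℝ) (b G : ℝ → Fin 2 → L2 L₁ L₂) {s t : ℝ} (k : ℤ × ℤ) :
    duhamel a b G s t (-k) = (starRingEnd ℂ) (duhamel a b G s t k) := by
  simp only [duhamel, intervalIntegral, map_sub, ← integral_conj]
  simp only [symb_neg, force_neg, map_mul, Complex.conj_ofReal]

lemma flowCoeff_neg (a : ℝ) (b G : ℝ → Fin 2 → L2 L₁ L₂) {s t : ℝ} {c : ℤ × ℤ → ℂ}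
    (hs : ∀ k, c (-k) = (starRingEnd ℂ) (c k)) (k : ℤ × ℤ) :
    flowCoeff a b G s c t (-k) = (starRingEnd ℂ) (flowCoeff a b G s c t k) := by
  simp only [flowCoeff, duhamel_neg, symb_neg, hs, map_add, map_mul, Complex.conj_ofReal]

/-- Once the final time is factored out, the integral is a primitive in t. Continuity, restarting
and differentiation all rest on this form. -/
lemma duhamel_eq_exp_mul (a : ℝ) (b G : ℝ → Fin 2 → L2 L₁ L₂) (s t : ℝ) (k : ℤ × ℤ) :
    duhamel a b G s t k = Real.exp (-t * symb L₁ L₂ a k) *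
      ∫ τ in s..t, (Real.exp (τ * symb L₁ L₂ a k) : ℂ) * force a (b τ) (G τ) k := by
  rw [duhamel, ← intervalIntegral.integral_const_mul]
  congr 1
  funext τ
  rw [← mul_assoc, ← Complex.ofReal_mul, ← Real.exp_add]
  congr 3
  ring

section

variable {a V s T M : ℝ} {b G : ℝ → Fin 2 → L2 L₁ L₂}

lemma IsAdmissible.intervalIntegrable_exp_mul (ha : a ∈ Icc (0 : ℝ) 1) (hb : IsField b V)
    (hM : 0 ≤ M) (hG : IsAdmissible s T M G) (hsT : s ≤ T) (k : ℤ × ℤ) :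
    IntervalIntegrable (fun τ => (Real.exp (τ * symb L₁ L₂ a k) : ℂ) * force a (b τ) (G τ) k)
      volume s T := by
  refine (hG.intervalIntegrable_force ha hb hM hsT k).continuousOn_mul ?_
  fun_prop

lemma IsAdmissible.intervalIntegrable_duhamel (ha : a ∈ Icc (0 : ℝ) 1) (hb : IsField b V)
    (hM : 0 ≤ M) (hG : IsAdmissible s T M G) (hsT : s ≤ T) (t : ℝ) (k : ℤ × ℤ) :
    IntervalIntegrable
      (fun τ => (Real.exp (-(t - τ) * symb L₁ L₂ a k) : ℂ) * force a (b τ) (G τ) k)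
      volume s T := by
  refine (hG.intervalIntegrable_force ha hb hM hsT k).continuousOn_mul ?_
  fun_prop

lemma IsAdmissible.mono (hG : IsAdmissible s T M G) {T' : ℝ} (h : T' ≤ T) :
    IsAdmissible s T' M G :=
  ⟨hG.meas.mono_measure (Measure.restrict_mono (Ioc_subset_Ioc_right h) le_rfl),
    fun t ht => hG.bound t ⟨ht.1, ht.2.trans h⟩⟩

/-- The singular factor grows when the origin moves to the right, so the same constant M serves at
every later starting time. -/
lemma IsAdmissible.restart (hM : 0 ≤ M) (hG : IsAdmissible s T M G) {s' : ℝ} (h : s ≤ s') :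
    IsAdmissible s' T M G := by
  refine ⟨hG.meas.mono_measure (Measure.restrict_mono (Ioc_subset_Ioc_left h) le_rfl),
    fun t ht => (hG.bound t ⟨h.trans_lt ht.1, ht.2⟩).trans ?_⟩
  have : 0 < t - s' := sub_pos.2 ht.1
  have := Real.rpow_le_rpow_of_nonpos this (by linarith : t - s' ≤ t - s)
    (by norm_num : (-(1 / 4) : ℝ) ≤ 0)
  gcongr

lemma continuousOn_duhamel (ha : a ∈ Icc (0 : ℝ) 1) (hb : IsField b V)
    (hM : 0 ≤ M) (hG : IsAdmissible s T M G) (hsT : s ≤ T) (k : ℤ × ℤ) :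
    ContinuousOn (fun t => duhamel a b G s t k) (Icc s T) := by
  simp_rw [duhamel_eq_exp_mul]
  have h := intervalIntegral.continuousOn_primitive_interval
    ((intervalIntegrable_iff_integrableOn_Icc_of_le hsT).1
      (hG.intervalIntegrable_exp_mul ha hb hM hsT k) |> fun h => by rwa [uIcc_of_le hsT])
  rw [uIcc_of_le hsT] at h
  refine ContinuousOn.mul ?_ h
  fun_prop

lemma continuousOn_flowCoeff (ha : a ∈ Icc (0 : ℝ) 1) (hb : IsField b V)
    (hM : 0 ≤ M) (hG : IsAdmissible s T M G) (hsT : s ≤ T) (c : ℤ × ℤ → ℂ) (k : ℤ × ℤ) :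
    ContinuousOn (fun t => flowCoeff a b G s c t k) (Icc s T) := by
  refine ContinuousOn.add ?_ (continuousOn_duhamel ha hb hM hG hsT k)
  fun_prop

/-- Duhamel's integral gains any power of the weight less than one. -/
lemma norm_duhamel_le_weight (ha : a ∈ Icc (0 : ℝ) 1) (hb : IsField b V)
    (hM : 0 ≤ M) (hG : IsAdmissible s T M G) {t α : ℝ} (ht : t ∈ Icc s T) (h0 : 0 ≤ α)
    (h1 : α < 1) (k : ℤ × ℤ) :
    ‖duhamel a b G s t k‖ ≤ (2 / (L₁ * L₂) * ((V * (1 + (T - s)) + 2 * M) * M)) * (12 / (1 - α)) *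
      Real.exp (t - s) * (t - s) ^ (1 / 2 - α) * weight L₁ L₂ k ^ (-α) := by
  have hA := area_pos L₁ L₂
  have hV := hb.nonneg
  have hT : 0 ≤ T - s := by linarith [ht.1, ht.2]
  refine norm_duhamel_le ha ht.1 h0 h1 (by positivity) (fun τ hτ => ?_) k
  exact hG.norm_force_le ha hb hM ⟨hτ.1, hτ.2.le.trans ht.2⟩ k

lemma freqSq_mul_norm_add_sq_le (x y : ℂ) (k : ℤ × ℤ) :
    freqSq L₁ L₂ k * ‖x + y‖ ^ 2 ≤
      2 * (freqSq L₁ L₂ k * ‖x‖ ^ 2) + 2 * (freqSq L₁ L₂ k * ‖y‖ ^ 2) := by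
  have h1 : ‖x + y‖ ^ 2 ≤ 2 * ‖x‖ ^ 2 + 2 * ‖y‖ ^ 2 := by
    have h2 : ‖x + y‖ ^ 2 ≤ (‖x‖ + ‖y‖) ^ 2 := by gcongr; exact norm_add_le x y
    nlinarith [sq_nonneg (‖x‖ - ‖y‖)]
  have := mul_le_mul_of_nonneg_left h1 (freqSq_nonneg (L₁ := L₁) (L₂ := L₂) k)
  linarith

lemma freqSq_mul_exp_sq_le (ha : a ∈ Icc (0 : ℝ) 1) {x : ℝ} (hx : 0 < x) (k : ℤ × ℤ) :
    freqSq L₁ L₂ k * Real.exp (-x * symb L₁ L₂ a k) ^ 2 ≤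
      (2 * Real.exp x * x ^ (-(1 / 4) : ℝ)) ^ 2 := by
  have hw := weight_pos (L₁ := L₁) (L₂ := L₂) k
  have h1 := exp_neg_mul_symb_le (L₁ := L₁) (L₂ := L₂) ha hx (by norm_num : (0 : ℝ) ≤ 1 / 4)
    (by norm_num) k
  have h2 : (weight L₁ L₂ k ^ (-(1 / 4) : ℝ)) ^ 2 = weight L₁ L₂ k ^ (-(1 / 2) : ℝ) := by
    rw [← Real.rpow_natCast, ← Real.rpow_mul hw.le]; norm_num
  calc freqSq L₁ L₂ k * Real.exp (-x * symb L₁ L₂ a k) ^ 2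
      ≤ weight L₁ L₂ k ^ (1 / 2 : ℝ) *
        (2 * Real.exp x * x ^ (-(1 / 4) : ℝ) * weight L₁ L₂ k ^ (-(1 / 4) : ℝ)) ^ 2 := by
        gcongr
        exact freqSq_le_weight_rpow k
    _ = (2 * Real.exp x * x ^ (-(1 / 4) : ℝ)) ^ 2 *
        (weight L₁ L₂ k ^ (1 / 2 : ℝ) * weight L₁ L₂ k ^ (-(1 / 2) : ℝ)) := by
        rw [mul_pow _ (weight L₁ L₂ k ^ (-(1 / 4) : ℝ)), h2]; ring
    _ = _ := by rw [← Real.rpow_add hw]; norm_num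

lemma summable_grad_linear (ha : a ∈ Icc (0 : ℝ) 1) {x : ℝ} (hx : 0 < x) {c : ℤ × ℤ → ℂ}
    (hc : Summable fun k => ‖c k‖ ^ 2) :
    Summable fun k => freqSq L₁ L₂ k * ‖Real.exp (-x * symb L₁ L₂ a k) * c k‖ ^ 2 := by
  refine Summable.of_nonneg_of_le (fun k => mul_nonneg (freqSq_nonneg k) (by positivity))
    (fun k => ?_) (hc.mul_left ((2 * Real.exp x * x ^ (-(1 / 4) : ℝ)) ^ 2))
  rw [norm_mul, Complex.norm_real, Real.norm_of_nonneg (Real.exp_pos _).le, mul_pow, ← mul_assoc]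
  gcongr
  exact freqSq_mul_exp_sq_le ha hx k

lemma duhamel_grad_decay (ha : a ∈ Icc (0 : ℝ) 1) (hb : IsField b V)
    (hM : 0 ≤ M) (hG : IsAdmissible s T M G) {t : ℝ} (ht : t ∈ Ioc s T) :
    ∃ P, 0 ≤ P ∧ ∀ k, ‖duhamel a b G s t k‖ ≤ P * weight L₁ L₂ k ^ (-(5 / 8) : ℝ) := by
  have hA := area_pos L₁ L₂
  have hV := hb.nonneg
  have hT : 0 ≤ T - s := by linarith [ht.1, ht.2]
  have hT : 0 < t - s := sub_pos.2 ht.1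
  exact ⟨_, by positivity, fun k => norm_duhamel_le_weight ha hb hM hG (Ioc_subset_Icc_self ht)
    (by norm_num) (by norm_num : (5 / 8 : ℝ) < 1) k⟩

lemma summable_grad_flowCoeff (ha : a ∈ Icc (0 : ℝ) 1) (hb : IsField b V)
    (hM : 0 ≤ M) (hG : IsAdmissible s T M G) {c : ℤ × ℤ → ℂ} (hc : Summable fun k => ‖c k‖ ^ 2)
    {t : ℝ} (ht : t ∈ Ioc s T) :
    Summable fun k => freqSq L₁ L₂ k * ‖flowCoeff a b G s c t k‖ ^ 2 := by
  obtain ⟨P, -, hP⟩ := duhamel_grad_decay ha hb hM hG ht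
  have h1 := ((summable_grad_linear (L₁ := L₁) (L₂ := L₂) ha (sub_pos.2 ht.1) hc).mul_left 2).add
    ((summable_grad_of_decay hP).mul_left 2)
  exact Summable.of_nonneg_of_le (fun k => mul_nonneg (freqSq_nonneg k) (by positivity))
    (fun k => freqSq_mul_norm_add_sq_le _ _ k) h1

/-- The exponent 3/8 is below 1/2, so the time factor is a positive power and the bound is uniform
up to t = s, while 3/8 is still enough for square summability. -/
lemma duhamel_decay (ha : a ∈ Icc (0 : ℝ) 1) (hb : IsField b V)
    (hM : 0 ≤ M) (hG : IsAdmissible s T M G) : ∃ P, ∀ t ∈ Icc s T, ∀ k,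
      ‖duhamel a b G s t k‖ ≤ P * weight L₁ L₂ k ^ (-(3 / 8) : ℝ) := by
  have hA := area_pos L₁ L₂
  have hV := hb.nonneg
  refine ⟨(2 / (L₁ * L₂) * ((V * (1 + (T - s)) + 2 * M) * M)) * (12 / (1 - 3 / 8)) *
      Real.exp (T - s) * (T - s) ^ (1 / 2 - 3 / 8 : ℝ), fun t ht k => ?_⟩
  have hT : 0 ≤ T - s := by linarith [ht.1, ht.2]
  have ht0 : 0 ≤ t - s := by linarith [ht.1]
  have hw := weight_pos (L₁ := L₁) (L₂ := L₂) k
  refine (norm_duhamel_le_weight ha hb hM hG ht (by norm_num)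
    (by norm_num : (3 / 8 : ℝ) < 1) k).trans ?_
  gcongr
  · exact ht.2
  · exact ht.2

/-- A majorant uniform in time, as needed for continuity in L² down to the initial time. -/
lemma norm_flowCoeff_le (ha : a ∈ Icc (0 : ℝ) 1) (hb : IsField b V)
    (hM : 0 ≤ M) (hG : IsAdmissible s T M G) {c : ℤ × ℤ → ℂ}
    (hc : Summable fun k => ‖c k‖ ^ 2) : ∃ m : ℤ × ℤ → ℝ, (Summable fun k => m k ^ 2) ∧
      ∀ t ∈ Icc s T, ∀ k, ‖flowCoeff a b G s c t k‖ ≤ m k := by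
  obtain ⟨P, hP⟩ := duhamel_decay ha hb hM hG
  refine ⟨fun k => Real.exp (T - s) * ‖c k‖ + P * weight L₁ L₂ k ^ (-(3 / 8) : ℝ), ?_, ?_⟩
  · refine Summable.of_nonneg_of_le (fun _ => sq_nonneg _) (fun k => add_sq_le)
      (Summable.mul_left 2 (Summable.add (?_ : Summable fun k => (Real.exp (T - s) * ‖c k‖) ^ 2)
        (?_ : Summable fun k => (P * weight L₁ L₂ k ^ (-(3 / 8) : ℝ)) ^ 2)))
    · simp_rw [mul_pow]; exact hc.mul_left _
    · exact ((summable_weight_rpow L₁ L₂).mul_left (P ^ 2)).congr fun k =>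
        (sq_mul_weight_rpow P k).symm
  · intro t ht k
    refine (norm_add_le _ _).trans (add_le_add ?_ (hP t ht k))
    rw [norm_mul, Complex.norm_real, Real.norm_of_nonneg (Real.exp_pos _).le]
    refine mul_le_mul_of_nonneg_right ?_ (norm_nonneg _)
    refine (exp_neg_mul_symb_le_exp ha (by linarith [ht.1]) k).trans ?_
    exact Real.exp_le_exp.2 (by linarith [ht.2])

lemma summable_flowCoeff (ha : a ∈ Icc (0 : ℝ) 1) (hb : IsField b V)
    (hM : 0 ≤ M) (hG : IsAdmissible s T M G) {c : ℤ × ℤ → ℂ} (hc : Summable fun k => ‖c k‖ ^ 2)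
    {t : ℝ} (ht : t ∈ Icc s T) : Summable fun k => ‖flowCoeff a b G s c t k‖ ^ 2 := by
  obtain ⟨m, hm, h⟩ := norm_flowCoeff_le ha hb hM hG hc
  refine Summable.of_nonneg_of_le (fun _ => sq_nonneg _) (fun k => ?_) hm
  gcongr
  exact h t ht k

end

/-! ### The contraction estimate for the gradient. -/

lemma gradOf_sub {x y : ℤ × ℤ → ℂ} (hx : Summable fun k => freqSq L₁ L₂ k * ‖x k‖ ^ 2)
    (hy : Summable fun k => freqSq L₁ L₂ k * ‖y k‖ ^ 2)
    (hsx : ∀ k, x (-k) = (starRingEnd ℂ) (x k)) (hsy : ∀ k, y (-k) = (starRingEnd ℂ) (y k)) :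
    gradOf L₁ L₂ x - gradOf L₁ L₂ y = gradOf L₁ L₂ (fun k => x k - y k) := by
  have hd : Summable fun k => freqSq L₁ L₂ k * ‖x k - y k‖ ^ 2 := by
    refine Summable.of_nonneg_of_le (fun k => mul_nonneg (freqSq_nonneg k) (by positivity))
      (fun k => ?_) ((hx.mul_left 2).add (hy.mul_left 2))
    have := freqSq_mul_norm_add_sq_le (L₁ := L₁) (L₂ := L₂) (x k) (-y k) k
    rwa [norm_neg, ← sub_eq_add_neg] at this
  have hsd : ∀ k, x (-k) - y (-k) = (starRingEnd ℂ) (x k - y k) := fun k => by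
    rw [hsx, hsy, map_sub]
  funext j
  apply ext_coef
  intro k
  rw [Pi.sub_apply, map_sub, coef_gradOf hx hsx, coef_gradOf hy hsy, coef_gradOf hd hsd]
  ring

variable (L₁ L₂) in
/-- The constant in the contraction estimate. -/
def contrConst : ℝ := decayConst L₁ L₂ * (2 / (L₁ * L₂) * 2 * 32 * Real.exp 1)

lemma contrConst_nonneg : 0 ≤ contrConst L₁ L₂ := by
  have := area_pos L₁ L₂
  have := decayConst_nonneg (L₁ := L₁) (L₂ := L₂)
  unfold contrConst
  positivity

/-- The linear parts cancel and the difference of forces has size D(τ - s)^{-1/2}. Smoothing with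
exponent 5/8 yields (t - s)^{-1/8}, better than the norm requires by the factor (t - s)^{1/8}, and a
short interval makes this factor small. -/
lemma contraction {a V R δ s T D : ℝ} {b G H : ℝ → Fin 2 → L2 L₁ L₂} (ha : a ∈ Icc (0 : ℝ) 1)
    (hb : IsField b V) (hR : 0 ≤ R) (hδ : δ ≤ 1) (hT : T - s ≤ δ)
    (hsmall : contrConst L₁ L₂ * (V + R) * δ ^ (1 / 8 : ℝ) ≤ 1 / 2)
    {c : ℤ × ℤ → ℂ} (hc : Summable fun k => ‖c k‖ ^ 2) (hs : ∀ k, c (-k) = (starRingEnd ℂ) (c k))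
    (hG : IsAdmissible s T R G) (hH : IsAdmissible s T R H) (hD : 0 ≤ D)
    (hGH : ∀ t ∈ Ioc s T, ‖G t - H t‖ ≤ D * (t - s) ^ (-(1 / 4) : ℝ)) :
    ∀ t ∈ Ioc s T, ‖gradOf L₁ L₂ (flowCoeff a b G s c t) - gradOf L₁ L₂ (flowCoeff a b H s c t)‖ ≤
      D / 2 * (t - s) ^ (-(1 / 4) : ℝ) := by
  intro t ht
  have hA := area_pos L₁ L₂
  have hV := hb.nonneg
  have hts : 0 < t - s := sub_pos.2 ht.1
  have hsT : s ≤ T := (ht.1.trans_le ht.2).le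
  have htδ : t - s ≤ δ := by linarith [ht.2]
  rw [gradOf_sub (summable_grad_flowCoeff ha hb hR hG hc ht)
    (summable_grad_flowCoeff ha hb hR hH hc ht) (flowCoeff_neg a b G hs) (flowCoeff_neg a b H hs)]
  set Q := 2 / (L₁ * L₂) * ((V * (1 + 1) + 2 * R) * D) with hQ
  have hQ0 : 0 ≤ Q := by positivity
  set P := Q * (12 / (1 - 5 / 8)) * Real.exp (t - s) * (t - s) ^ (1 / 2 - 5 / 8 : ℝ) with hP
  have hP0 : 0 ≤ P := by positivity
  have hd : ∀ k, flowCoeff a b G s c t k - flowCoeff a b H s c t k =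
      ∫ τ in s..t, (Real.exp (-(t - τ) * symb L₁ L₂ a k) : ℂ) *
        (force a (b τ) (G τ) k - force a (b τ) (H τ) k) := by
    intro k
    rw [flowCoeff, flowCoeff, add_sub_add_left_eq_sub, duhamel, duhamel,
      ← intervalIntegral.integral_sub
        ((hG.mono ht.2).intervalIntegrable_duhamel ha hb hR ht.1.le t k)
        ((hH.mono ht.2).intervalIntegrable_duhamel ha hb hR ht.1.le t k)]
    congr 1
    funext τ
    ring
  have hk : ∀ k, ‖flowCoeff a b G s c t k - flowCoeff a b H s c t k‖ ≤
      P * weight L₁ L₂ k ^ (-(5 / 8) : ℝ) := by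
    intro k
    rw [hd k, hP]
    refine norm_duhamel_le ha ht.1.le (by norm_num) (by norm_num) hQ0 (fun τ hτ => ?_) k
    have hτ' : τ ∈ Ioc s T := ⟨hτ.1, hτ.2.le.trans ht.2⟩
    exact norm_force_sub_le_of_bound ha hV hR hD (sub_pos.2 hτ.1) (by linarith [hτ'.2])
      (hb.norm_le τ) (hG.bound τ hτ') (hH.bound τ hτ') (hGH τ hτ') k
  refine (norm_gradOf_le_of_decay hP0 hk fun k => by
    rw [flowCoeff_neg a b G hs, flowCoeff_neg a b H hs, map_sub]).trans ?_
  have e1 : (t - s) ^ (1 / 2 - 5 / 8 : ℝ) = (t - s) ^ (1 / 8 : ℝ) * (t - s) ^ (-(1 / 4) : ℝ) := by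
    rw [← Real.rpow_add hts]; norm_num
  have e2 : (t - s) ^ (1 / 8 : ℝ) ≤ δ ^ (1 / 8 : ℝ) :=
    Real.rpow_le_rpow hts.le htδ (by norm_num)
  have e3 : Real.exp (t - s) ≤ Real.exp 1 := Real.exp_le_exp.2 (htδ.trans hδ)
  have hS := decayConst_nonneg (L₁ := L₁) (L₂ := L₂)
  calc decayConst L₁ L₂ * P
      = decayConst L₁ L₂ * (Q * 32 * Real.exp (t - s) * ((t - s) ^ (1 / 8 : ℝ) *
          (t - s) ^ (-(1 / 4) : ℝ))) := by rw [hP, e1]; norm_num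
    _ ≤ decayConst L₁ L₂ * (Q * 32 * Real.exp 1 * (δ ^ (1 / 8 : ℝ) *
          (t - s) ^ (-(1 / 4) : ℝ))) := by gcongr
    _ = contrConst L₁ L₂ * (V + R) * δ ^ (1 / 8 : ℝ) * (D * (t - s) ^ (-(1 / 4) : ℝ)) := by
        rw [hQ, contrConst]; ring
    _ ≤ 1 / 2 * (D * (t - s) ^ (-(1 / 4) : ℝ)) := by gcongr
    _ = D / 2 * (t - s) ^ (-(1 / 4) : ℝ) := by ring

-- The eighth power undoes the exponent 1/8.
lemma exists_small (X : ℝ) (hX : 0 ≤ X) : ∃ δ : ℝ, 0 < δ ∧ δ ≤ 1 ∧ X * δ ^ (1 / 8 : ℝ) ≤ 1 / 2 := by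
  refine ⟨(1 / (2 * X + 2)) ^ (8 : ℝ), by positivity, ?_, ?_⟩
  · apply Real.rpow_le_one (by positivity) _ (by norm_num)
    rw [div_le_one (by positivity)]; linarith
  · rw [← Real.rpow_mul (by positivity)]
    norm_num
    rw [← div_eq_mul_inv, div_le_div_iff₀ (by positivity) (by norm_num)]
    linarith

/-! ### The projection onto mean-free functions -/

lemma coef_const (c : ℝ) (k : ℤ × ℤ) :
    coef L₁ L₂ k (Lp.const 2 volume c) = if k = 0 then (c : ℂ) else 0 := by
  rw [coef_apply, fourierCoeff2_congr (Lp.coeFn_const 2 volume c), fourierCoeff2]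
  simp only [Function.const_apply]
  rw [integral_mul_const, integral_conj, integral_character]
  have := (area_pos L₁ L₂).ne'
  split_ifs
  · rw [Complex.conj_ofReal, ← mul_assoc, ← Complex.ofReal_mul, one_div, inv_mul_cancel₀ this,
      Complex.ofReal_one, one_mul]
  · simp

lemma measureReal_univ_torus : (volume : Measure (Torus L₁ L₂)).real univ = L₁ * L₂ := by
  have h := integral_character (L₁ := L₁) (L₂ := L₂) 0
  simp only [character_zero, if_true] at h
  rw [integral_const, Complex.real_smul, mul_one] at h
  exact_mod_cast h

lemma coef_zero (u : L2 L₁ L₂) : coef L₁ L₂ 0 u = ((⨍ x, u x : ℝ) : ℂ) := by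
  rw [coef_apply, fourierCoeff2, average_eq, measureReal_univ_torus]
  simp only [character_zero, map_one, one_mul]
  rw [integral_complex_ofReal, smul_eq_mul, Complex.ofReal_mul, one_div]

lemma coef_meanFree (u : L2 L₁ L₂) (k : ℤ × ℤ) :
    coef L₁ L₂ k (meanFree u) = if k = 0 then 0 else coef L₁ L₂ k u := by
  rw [meanFree, map_sub, coef_const]
  split_ifs with h
  · rw [h, coef_zero, sub_self]
  · rw [sub_zero]

lemma integral_meanFree (u : L2 L₁ L₂) : ∫ x, meanFree u x = 0 := by
  have h := coef_zero (meanFree u)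
  rw [coef_meanFree, if_pos rfl] at h
  have h2 : ⨍ x, meanFree u x = 0 := by exact_mod_cast h.symm
  rw [average_eq, measureReal_univ_torus, smul_eq_mul] at h2
  exact (mul_eq_zero.1 h2).resolve_left (inv_ne_zero (area_pos L₁ L₂).ne')

lemma meanFree_meanFree (u : L2 L₁ L₂) : meanFree (meanFree u) = meanFree u :=
  ext_coef fun k => by rw [coef_meanFree, coef_meanFree]; split_ifs <;> rfl

lemma meanFree_sub (u w : L2 L₁ L₂) : meanFree (u - w) = meanFree u - meanFree w :=
  ext_coef fun k => by
    rw [map_sub, coef_meanFree, coef_meanFree, coef_meanFree, map_sub]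
    split_ifs <;> simp

lemma norm_meanFree_sq (u : L2 L₁ L₂) :
    ‖meanFree u‖ ^ 2 = (L₁ * L₂) * ∑' k, ‖coef L₁ L₂ k (meanFree u)‖ ^ 2 :=
  norm_sq_eq_tsum _

lemma norm_meanFree_le (u : L2 L₁ L₂) : ‖meanFree u‖ ≤ ‖u‖ := by
  have hA := (area_pos L₁ L₂).le
  apply le_of_sq_le_sq _ (norm_nonneg _)
  rw [norm_sq_eq_tsum, norm_sq_eq_tsum]
  refine mul_le_mul_of_nonneg_left ?_ hA
  refine (summable_norm_coef_sq _).tsum_le_tsum (fun k => ?_) (summable_norm_coef_sq _)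
  rw [coef_meanFree]
  split_ifs
  · simp
  · exact le_rfl

lemma norm_sq_le_meanFree (u : L2 L₁ L₂) :
    ‖u‖ ^ 2 = ‖meanFree u‖ ^ 2 + (L₁ * L₂) * ‖coef L₁ L₂ 0 u‖ ^ 2 := by
  rw [norm_sq_eq_tsum u, norm_sq_eq_tsum (meanFree u), ← mul_add,
    (summable_norm_coef_sq u).tsum_eq_add_tsum_ite 0, add_comm]
  congr 3
  funext k
  rw [coef_meanFree]
  split_ifs <;> simp

/-! ### Solutions in terms of Fourier coefficients -/

/-- `u` is a mild solution on `[s, T]` with data `u₀` and gradient `G`, in terms of Fourier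
coefficients. -/
structure Sol (a : ℝ) (b : ℝ → Fin 2 → L2 L₁ L₂) (s T : ℝ) (u₀ : L2 L₁ L₂) (u : ℝ → L2 L₁ L₂)
    (G : ℝ → Fin 2 → L2 L₁ L₂) : Prop where
  grad : ∀ t ∈ Ioc s T, IsGrad (u t) (G t)
  adm : ∃ M, 0 ≤ M ∧ IsAdmissible s T M G
  duh : ∀ t ∈ Icc s T, ∀ k,
    coef L₁ L₂ k (u t) = flowCoeff a b G s (fun k => coef L₁ L₂ k u₀) t k

section

variable {a V s T : ℝ} {b G : ℝ → Fin 2 → L2 L₁ L₂} {u₀ : L2 L₁ L₂} {u : ℝ → L2 L₁ L₂}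

lemma Sol.continuousOn (ha : a ∈ Icc (0 : ℝ) 1) (hb : IsField b V) (h : Sol a b s T u₀ u G) :
    ContinuousOn u (Icc s T) := by
  rcases lt_or_ge T s with hsT | hsT
  · rw [Icc_eq_empty (not_le.2 hsT)]; exact continuousOn_empty u
  obtain ⟨M, hM, hG⟩ := h.adm
  obtain ⟨m, hm, hb'⟩ := norm_flowCoeff_le ha hb hM hG (summable_norm_coef_sq u₀)
  refine continuousOn_of_coef hm (fun t ht k => ?_) fun k => ?_
  · rw [h.duh t ht k]; exact hb' t ht k
  · exact (continuousOn_flowCoeff ha hb hM hG hsT _ k).congr fun t ht => h.duh t ht k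

/-- The gradient of a solution is a fixed point of the Picard map, so `contraction` applies to it.
-/
lemma Sol.eq_gradOf (ha : a ∈ Icc (0 : ℝ) 1) (hb : IsField b V) (h : Sol a b s T u₀ u G) {t : ℝ}
    (ht : t ∈ Ioc s T) : G t = gradOf L₁ L₂ (flowCoeff a b G s (fun k => coef L₁ L₂ k u₀) t) := by
  obtain ⟨M, hM, hG⟩ := h.adm
  funext j
  apply ext_coef
  intro k
  rw [coef_gradOf (summable_grad_flowCoeff ha hb hM hG (summable_norm_coef_sq u₀) ht)
    (flowCoeff_neg a b G (coef_neg u₀)), h.grad t ht, h.duh t (Ioc_subset_Icc_self ht)]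

lemma Sol.apply_left (h : Sol a b s T u₀ u G) (hsT : s ≤ T) : u s = u₀ := by
  apply ext_coef
  intro k
  rw [h.duh s ⟨le_rfl, hsT⟩]
  simp [flowCoeff, duhamel]

lemma Sol.mono (h : Sol a b s T u₀ u G) {T' : ℝ} (hT : T' ≤ T) : Sol a b s T' u₀ u G := by
  obtain ⟨M, hM, hG⟩ := h.adm
  exact ⟨fun t ht => h.grad t ⟨ht.1, ht.2.trans hT⟩, ⟨M, hM, hG.mono hT⟩,
    fun t ht => h.duh t ⟨ht.1, ht.2.trans hT⟩⟩

/-- Semigroup property of Duhamel's formula: split the primitive at s' and recombine the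
exponentials. -/
lemma flowCoeff_restart (ha : a ∈ Icc (0 : ℝ) 1) (hb : IsField b V) {M : ℝ} (hM : 0 ≤ M)
    (hG : IsAdmissible s T M G) {s' t : ℝ} (hs : s ≤ s') (hst : s' ≤ t) (ht : t ≤ T)
    (c : ℤ × ℤ → ℂ) (k : ℤ × ℤ) :
    flowCoeff a b G s c t k = flowCoeff a b G s' (flowCoeff a b G s c s') t k := by
  have e0 := intervalIntegral.integral_add_adjacent_intervals
    ((hG.mono (hst.trans ht)).intervalIntegrable_exp_mul ha hb hM hs k)
    (((hG.restart hM hs).mono ht).intervalIntegrable_exp_mul ha hb hM hst k)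
  simp only [flowCoeff, duhamel_eq_exp_mul]
  rw [← e0, mul_add, mul_add, ← mul_assoc, ← mul_assoc, ← Complex.ofReal_mul, ← Complex.ofReal_mul,
    ← Real.exp_add, ← Real.exp_add,
    show -(t - s') * symb L₁ L₂ a k + -(s' - s) * symb L₁ L₂ a k = -(t - s) * symb L₁ L₂ a k by ring,
    show -(t - s') * symb L₁ L₂ a k + -s' * symb L₁ L₂ a k = -t * symb L₁ L₂ a k by ring]
  ring

lemma Sol.restart (ha : a ∈ Icc (0 : ℝ) 1) (hb : IsField b V) (h : Sol a b s T u₀ u G) {s' : ℝ}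
    (hs : s ≤ s') : Sol a b s' T (u s') u G := by
  obtain ⟨M, hM, hG⟩ := h.adm
  refine ⟨fun t ht => h.grad t ⟨hs.trans_lt ht.1, ht.2⟩, ⟨M, hM, hG.restart hM hs⟩,
    fun t ht k => ?_⟩
  rw [h.duh t ⟨hs.trans ht.1, ht.2⟩, flowCoeff_restart ha hb hM hG hs ht.1 ht.2]
  congr 1
  funext k
  rw [h.duh s' ⟨hs, ht.1.trans ht.2⟩]

/-- The coefficients of Duhamel's formula depend only on the gradient up to the given time. -/
lemma flowCoeff_congr {G' : ℝ → Fin 2 → L2 L₁ L₂} {t : ℝ} (hst : s ≤ t)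
    (h : ∀ τ ∈ Ioc s t, G τ = G' τ) (c : ℤ × ℤ → ℂ) (k : ℤ × ℤ) :
    flowCoeff a b G s c t k = flowCoeff a b G' s c t k := by
  rw [flowCoeff, flowCoeff, duhamel, duhamel]
  congr 1
  apply intervalIntegral.integral_congr_ae
  rw [uIoc_of_le hst]
  exact Filter.Eventually.of_forall fun τ hτ => by rw [h τ hτ]

lemma Sol.eqOn_of_grad {G' : ℝ → Fin 2 → L2 L₁ L₂} {u' : ℝ → L2 L₁ L₂}
    (h : Sol a b s T u₀ u G) (h' : Sol a b s T u₀ u' G') (hGG : ∀ t ∈ Ioc s T, G t = G' t) :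
    ∀ t ∈ Icc s T, u t = u' t := by
  intro t ht
  apply ext_coef
  intro k
  rw [h.duh t ht, h'.duh t ht]
  exact flowCoeff_congr ht.1 (fun τ hτ => hGG τ ⟨hτ.1, hτ.2.trans ht.2⟩) _ k

/-! ### Uniqueness and gluing of solutions. -/

lemma IsGrad.unique {w : L2 L₁ L₂} {F F' : Fin 2 → L2 L₁ L₂} (h : IsGrad w F) (h' : IsGrad w F') :
    F = F' := by
  funext j
  exact ext_coef fun k => by rw [h j k, h' j k]

/-- Both gradients are fixed points, so the crude bound 2M on their weighted distance can be halved
indefinitely. -/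
lemma Sol.unique_short (ha : a ∈ Icc (0 : ℝ) 1) (hb : IsField b V) {M δ : ℝ} (hM : 0 ≤ M)
    (hδ : δ ≤ 1) (hT : T - s ≤ δ)
    (hsmall : contrConst L₁ L₂ * (V + M) * δ ^ (1 / 8 : ℝ) ≤ 1 / 2)
    {G' : ℝ → Fin 2 → L2 L₁ L₂} {u' : ℝ → L2 L₁ L₂}
    (h : Sol a b s T u₀ u G) (h' : Sol a b s T u₀ u' G')
    (hG : IsAdmissible s T M G) (hG' : IsAdmissible s T M G') :
    ∀ t ∈ Icc s T, u t = u' t := by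
  refine h.eqOn_of_grad h' fun t ht => ?_
  have key : ∀ n : ℕ, ∀ t ∈ Ioc s T, ‖G t - G' t‖ ≤
      (2 * M / 2 ^ n) * (t - s) ^ (-(1 / 4) : ℝ) := by
    intro n
    induction n with
    | zero =>
      intro t ht
      have := norm_sub_le (G t) (G' t)
      have h1 := hG.bound t ht
      have h2 := hG'.bound t ht
      simp only [pow_zero, div_one]
      linarith
    | succ n ih =>
      intro t ht
      have := contraction ha hb hM hδ hT hsmall (summable_norm_coef_sq u₀) (coef_neg u₀) hG hG'
        (by positivity) ih t ht
      rw [← h.eq_gradOf ha hb ht, ← h'.eq_gradOf ha hb ht] at this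
      rwa [pow_succ, ← div_div]
  have hlim : Filter.Tendsto (fun n : ℕ => (2 * M / 2 ^ n) * (t - s) ^ (-(1 / 4) : ℝ))
      Filter.atTop (nhds 0) := by
    have h1 := (tendsto_pow_atTop_nhds_zero_of_lt_one (by norm_num : (0 : ℝ) ≤ 1 / 2)
      (by norm_num)).const_mul (2 * M)
    have h2 := h1.mul_const ((t - s) ^ (-(1 / 4) : ℝ))
    simp only [mul_zero, zero_mul] at h2
    refine h2.congr fun n => ?_
    rw [div_pow, one_pow, mul_one_div]
  have h0 := ge_of_tendsto' hlim fun n => key n t ht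
  exact sub_eq_zero.1 (norm_le_zero_iff.1 h0)

lemma Sol.unique (ha : a ∈ Icc (0 : ℝ) 1) (hb : IsField b V)
    {G' : ℝ → Fin 2 → L2 L₁ L₂} {u' : ℝ → L2 L₁ L₂}
    (h : Sol a b s T u₀ u G) (h' : Sol a b s T u₀ u' G') : ∀ t ∈ Icc s T, u t = u' t := by
  intro t ht
  have hsT : s ≤ T := ht.1.trans ht.2
  obtain ⟨M₁, hM₁, hG₁⟩ := h.adm
  obtain ⟨M₂, hM₂, hG₂⟩ := h'.adm
  set M := M₁ + M₂ with hMdef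
  have hM : 0 ≤ M := by positivity
  have hG : IsAdmissible s T M G := ⟨hG₁.meas, fun t ht => (hG₁.bound t ht).trans (by
    have : 0 < t - s := sub_pos.2 ht.1
    gcongr; linarith)⟩
  have hG' : IsAdmissible s T M G' := ⟨hG₂.meas, fun t ht => (hG₂.bound t ht).trans (by
    have : 0 < t - s := sub_pos.2 ht.1
    gcongr; linarith)⟩
  -- Restarting preserves the bound M, so one step length δ works along the whole interval.
  obtain ⟨δ, hδ0, hδ1, hδ⟩ := exists_small (contrConst L₁ L₂ * (V + M))
    (mul_nonneg contrConst_nonneg (add_nonneg hb.nonneg hM))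
  have key : ∀ n : ℕ, ∀ t ∈ Icc s T, t ≤ s + n * δ → u t = u' t := by
    intro n
    induction n with
    | zero =>
      intro t ht hts
      have : t = s := le_antisymm (by simpa using hts) ht.1
      rw [this, h.apply_left hsT, h'.apply_left hsT]
    | succ n ih =>
      intro t ht hts
      rcases le_or_gt t (s + n * δ) with hle | hlt
      · exact ih t ht hle
      have hs' : s ≤ s + n * δ := by
        have : 0 ≤ (n : ℝ) * δ := by positivity
        linarith
      have e := ih (s + n * δ) ⟨hs', hlt.le.trans ht.2⟩ le_rfl
      have r1 := (h.restart ha hb hs').mono ht.2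
      have r2 := (h'.restart ha hb hs').mono ht.2
      rw [← e] at r2
      refine r1.unique_short ha hb hM hδ1 ?_ hδ r2 ((hG.restart hM hs').mono ht.2)
        ((hG'.restart hM hs').mono ht.2) t ⟨hlt.le, le_rfl⟩
      push_cast at hts
      linarith
  obtain ⟨n, hn⟩ := exists_nat_ge ((t - s) / δ)
  refine key n t ht ?_
  rw [div_le_iff₀ hδ0] at hn
  linarith

/-- Gluing two solutions that overlap. -/
lemma Sol.glue (ha : a ∈ Icc (0 : ℝ) 1) (hb : IsField b V) {s' T' : ℝ}
    {G' : ℝ → Fin 2 → L2 L₁ L₂} {u' : ℝ → L2 L₁ L₂}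
    (h : Sol a b s T u₀ u G) (hs : s ≤ s') (hs' : s' < T) (hT : T ≤ T')
    (h' : Sol a b s' T' (u s') u' G') :
    Sol a b s T' u₀ (fun t => if t ≤ T then u t else u' t)
      (fun t => if t ≤ T then G t else G' t) := by
  obtain ⟨M₁, hM₁, hG₁⟩ := h.adm
  obtain ⟨M₂, hM₂, hG₂⟩ := h'.adm
  -- Uniqueness on the overlap identifies the two solutions, hence also their gradients, so the
  -- Duhamel integral from s' can be computed with either.
  have huu : ∀ t ∈ Icc s' T, u t = u' t := (h.restart ha hb hs).unique ha hb (h'.mono hT)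
  have hGG : ∀ t ∈ Ioc s' T, G t = G' t := fun t ht => by
    have h1 := h.grad t ⟨hs.trans_lt ht.1, ht.2⟩
    rw [huu t (Ioc_subset_Icc_self ht)] at h1
    exact h1.unique (h'.grad t ⟨ht.1, ht.2.trans hT⟩)
  have hTs : 0 < T - s' := sub_pos.2 hs'
  -- The second gradient is used only for t > T, where t - s' exceeds T - s' > 0 and its singularity
  -- at s' is not met. The factor (T' - s)^{1/4} turns the resulting constant into a multiple of (t
  -- - s)^{-1/4}.
  have hG : IsAdmissible s T'
      (M₁ + M₂ * ((T - s') ^ (-(1 / 4) : ℝ) * (T' - s) ^ (1 / 4 : ℝ)))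
      (fun t => if t ≤ T then G t else G' t) := by
    constructor
    · have hm : AEStronglyMeasurable (fun t => if t ≤ T then G t else G' t)
          (volume.restrict (Ioc s T ∪ Ioc T T')) := by
        rw [aestronglyMeasurable_union_iff]
        constructor
        · refine hG₁.meas.congr ?_
          filter_upwards [ae_restrict_mem measurableSet_Ioc] with t ht
          rw [if_pos ht.2]
        · refine (hG₂.meas.mono_measure (Measure.restrict_mono
            (Ioc_subset_Ioc_left hs'.le) le_rfl)).congr ?_
          filter_upwards [ae_restrict_mem measurableSet_Ioc] with t ht
          rw [if_neg (not_le.2 ht.1)]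
      rwa [Ioc_union_Ioc_eq_Ioc (hs.trans hs'.le) hT] at hm
    · intro t ht
      have hts : 0 < t - s := sub_pos.2 ht.1
      have hT's : 0 < T' - s := by linarith [ht.1.trans_le ht.2]
      have hK : 0 ≤ M₂ * ((T - s') ^ (-(1 / 4) : ℝ) * (T' - s) ^ (1 / 4 : ℝ)) := by positivity
      by_cases htT : t ≤ T
      · rw [if_pos htT]
        refine (hG₁.bound t ⟨ht.1, htT⟩).trans ?_
        gcongr
        linarith
      · rw [if_neg htT]
        rw [not_le] at htT
        refine (hG₂.bound t ⟨hs'.trans htT, ht.2⟩).trans ?_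
        have e1 : (t - s') ^ (-(1 / 4) : ℝ) ≤ (T - s') ^ (-(1 / 4) : ℝ) :=
          Real.rpow_le_rpow_of_nonpos hTs (by linarith) (by norm_num)
        have e2 : 1 ≤ (T' - s) ^ (1 / 4 : ℝ) * (t - s) ^ (-(1 / 4) : ℝ) := by
          rw [Real.rpow_neg hts.le, ← div_eq_mul_inv, one_le_div (by positivity)]
          exact Real.rpow_le_rpow hts.le (by linarith [ht.2]) (by norm_num)
        have e3 : 0 ≤ M₁ * (t - s) ^ (-(1 / 4) : ℝ) := by positivity
        calc M₂ * (t - s') ^ (-(1 / 4) : ℝ) ≤ M₂ * (T - s') ^ (-(1 / 4) : ℝ) * 1 := by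
              rw [mul_one]; gcongr
          _ ≤ M₂ * (T - s') ^ (-(1 / 4) : ℝ) * ((T' - s) ^ (1 / 4 : ℝ) *
              (t - s) ^ (-(1 / 4) : ℝ)) := by gcongr
          _ ≤ _ := by rw [add_mul]; linarith
  refine ⟨fun t ht => ?_, ⟨_, ?_, hG⟩, fun t ht k => ?_⟩
  · by_cases htT : t ≤ T
    · simp only [if_pos htT]
      exact h.grad t ⟨ht.1, htT⟩
    · simp only [if_neg htT]
      exact h'.grad t ⟨hs'.trans (not_le.1 htT), ht.2⟩
  · have : 0 ≤ T' - s := by linarith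
    positivity
  · by_cases htT : t ≤ T
    · simp only [if_pos htT]
      rw [h.duh t ⟨ht.1, htT⟩]
      exact flowCoeff_congr ht.1 (fun τ hτ => by rw [if_pos (hτ.2.trans htT)]) _ k
    · have htT' : T < t := not_le.1 htT
      have hM : 0 ≤ M₁ + M₂ * ((T - s') ^ (-(1 / 4) : ℝ) * (T' - s) ^ (1 / 4 : ℝ)) := by
        have : 0 ≤ T' - s := by linarith
        positivity
      simp only [if_neg htT]
      rw [flowCoeff_restart ha hb hM hG hs (hs'.trans htT').le ht.2,
        h'.duh t ⟨(hs'.trans htT').le, ht.2⟩]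
      rw [flowCoeff_congr (G := G') (G' := fun t => if t ≤ T then G t else G' t)
        (hs'.trans htT').le (fun τ hτ => ?_)]
      · congr 1
        funext l
        rw [h.duh s' ⟨hs, hs'.le⟩]
        exact flowCoeff_congr hs (fun τ hτ => by rw [if_pos (hτ.2.trans hs'.le)]) _ l
      · by_cases hτT : τ ≤ T
        · rw [if_pos hτT, hGG τ ⟨hτ.1, hτT⟩]
        · rw [if_neg hτT]

end

/-! ### Existence of solutions -/

section

variable {a V : ℝ} {b : ℝ → Fin 2 → L2 L₁ L₂}

lemma duhamel_zero (s t : ℝ) (k : ℤ × ℤ) : duhamel a b (fun _ => 0) s t k = 0 := by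
  simp [duhamel, force_zero]

lemma isAdmissible_zero {s T R : ℝ} (hR : 0 ≤ R) :
    IsAdmissible s T R (fun _ => (0 : Fin 2 → L2 L₁ L₂)) := by
  refine ⟨aestronglyMeasurable_const, fun t ht => ?_⟩
  have : 0 < t - s := sub_pos.2 ht.1
  rw [norm_zero]
  positivity

/-- The zero frequency does not contribute to the gradient, so only the mean-free part of the data
appears; elsewhere smoothing by the power 1/4 of the weight pays for the derivative. -/
lemma norm_gradOf_linear_le (ha : a ∈ Icc (0 : ℝ) 1) {s t R₀ : ℝ} (hst : s < t) (hR : 0 ≤ R₀)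
    {u₀ : L2 L₁ L₂} (hu : ‖meanFree u₀‖ ≤ R₀) :
    ‖gradOf L₁ L₂ (flowCoeff a b (fun _ => 0) s (fun k => coef L₁ L₂ k u₀) t)‖ ≤
      2 * Real.exp (t - s) * (t - s) ^ (-(1 / 4) : ℝ) * R₀ := by
  have hx : 0 < t - s := sub_pos.2 hst
  have hA := (area_pos L₁ L₂).le
  have hf : flowCoeff a b (fun _ => 0) s (fun k => coef L₁ L₂ k u₀) t = fun k =>
      (Real.exp (-(t - s) * symb L₁ L₂ a k) : ℂ) * coef L₁ L₂ k u₀ := by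
    funext k
    rw [flowCoeff, duhamel_zero, add_zero]
  have hsum := summable_grad_linear (L₁ := L₁) (L₂ := L₂) ha hx (summable_norm_coef_sq u₀)
  have hsym : ∀ k, (Real.exp (-(t - s) * symb L₁ L₂ a (-k)) : ℂ) * coef L₁ L₂ (-k) u₀ =
      (starRingEnd ℂ) ((Real.exp (-(t - s) * symb L₁ L₂ a k) : ℂ) * coef L₁ L₂ k u₀) := fun k => by
    rw [symb_neg, coef_neg, map_mul, Complex.conj_ofReal]
  rw [hf]
  refine (pi_norm_le_iff_of_nonneg (by positivity)).2 fun j => ?_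
  apply le_of_sq_le_sq _ (by positivity)
  rw [gradOf, norm_ofCoeff_sq (summable_grad_coeff hsum j) (grad_symm
    (x := fun k => (Real.exp (-(t - s) * symb L₁ L₂ a k) : ℂ) * coef L₁ L₂ k u₀) hsym j)]
  have hterm : ∀ k, ‖Complex.I * (freq L₁ L₂ k j : ℂ) *
      ((Real.exp (-(t - s) * symb L₁ L₂ a k) : ℂ) * coef L₁ L₂ k u₀)‖ ^ 2 ≤
      (2 * Real.exp (t - s) * (t - s) ^ (-(1 / 4) : ℝ)) ^ 2 *
        ‖coef L₁ L₂ k (meanFree u₀)‖ ^ 2 := by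
    intro k
    refine (norm_grad_coeff_sq_le (fun k => (Real.exp (-(t - s) * symb L₁ L₂ a k) : ℂ) *
      coef L₁ L₂ k u₀) j k).trans ?_
    rw [coef_meanFree]
    by_cases hk : k = 0
    · subst hk
      simp [freqSq_zero]
    · rw [if_neg hk, norm_mul, Complex.norm_real, Real.norm_of_nonneg (Real.exp_pos _).le, mul_pow,
        ← mul_assoc]
      gcongr
      exact freqSq_mul_exp_sq_le ha hx k
  have h1 := (summable_grad_coeff hsum j).tsum_le_tsum hterm
    ((summable_norm_coef_sq (meanFree u₀)).mul_left _)
  rw [tsum_mul_left] at h1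
  calc (L₁ * L₂) * ∑' k, ‖Complex.I * (freq L₁ L₂ k j : ℂ) *
      ((Real.exp (-(t - s) * symb L₁ L₂ a k) : ℂ) * coef L₁ L₂ k u₀)‖ ^ 2
      ≤ (L₁ * L₂) * ((2 * Real.exp (t - s) * (t - s) ^ (-(1 / 4) : ℝ)) ^ 2 *
        ∑' k, ‖coef L₁ L₂ k (meanFree u₀)‖ ^ 2) := mul_le_mul_of_nonneg_left h1 hA
    _ = (2 * Real.exp (t - s) * (t - s) ^ (-(1 / 4) : ℝ)) ^ 2 * ‖meanFree u₀‖ ^ 2 := by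
      rw [norm_meanFree_sq]; ring
    _ ≤ (2 * Real.exp (t - s) * (t - s) ^ (-(1 / 4) : ℝ) * R₀) ^ 2 := by
      rw [mul_pow _ R₀]; gcongr

lemma aestronglyMeasurable_gradOf_flowCoeff (ha : a ∈ Icc (0 : ℝ) 1) (hb : IsField b V)
    {s T M : ℝ} (hM : 0 ≤ M) (hsT : s ≤ T) {G : ℝ → Fin 2 → L2 L₁ L₂} (hG : IsAdmissible s T M G)
    {c : ℤ × ℤ → ℂ} (hc : Summable fun k => ‖c k‖ ^ 2)
    (hs : ∀ k, c (-k) = (starRingEnd ℂ) (c k)) :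
    AEStronglyMeasurable (fun t => gradOf L₁ L₂ (flowCoeff a b G s c t))
      (volume.restrict (Ioc s T)) := by
  have h : ∀ j, AEStronglyMeasurable (fun t => gradOf L₁ L₂ (flowCoeff a b G s c t) j)
      (volume.restrict (Ioc s T)) := by
    intro j
    refine aestronglyMeasurable_of_coef fun k => ?_
    have h1 : AEStronglyMeasurable
        (fun t => Complex.I * (freq L₁ L₂ k j : ℂ) * flowCoeff a b G s c t k)
        (volume.restrict (Ioc s T)) := by
      refine ContinuousOn.aestronglyMeasurable ?_ measurableSet_Ioc
      exact continuousOn_const.mul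
        ((continuousOn_flowCoeff ha hb hM hG hsT c k).mono Ioc_subset_Icc_self)
    refine h1.congr ?_
    filter_upwards [ae_restrict_mem measurableSet_Ioc] with t ht
    rw [coef_gradOf (summable_grad_flowCoeff ha hb hM hG hc ht) (flowCoeff_neg a b G hs)]
  have hc : Continuous fun p : L2 L₁ L₂ × L2 L₁ L₂ => (![p.1, p.2] : Fin 2 → L2 L₁ L₂) :=
    continuous_pi fun j => by fin_cases j <;> simp <;> fun_prop
  refine (hc.comp_aestronglyMeasurable ((h 0).prodMk (h 1))).congr
    (Filter.Eventually.of_forall fun t => ?_)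
  funext j
  fin_cases j <;> rfl

/-- The iteration for the gradient of the solution. -/
def picard (a : ℝ) (b : ℝ → Fin 2 → L2 L₁ L₂) (s : ℝ) (u₀ : L2 L₁ L₂) :
    ℕ → ℝ → Fin 2 → L2 L₁ L₂
  | 0 => fun _ => 0
  | n + 1 => fun t =>
      gradOf L₁ L₂ (flowCoeff a b (picard a b s u₀ n) s (fun k => coef L₁ L₂ k u₀) t)

/-- Local existence, for a time that depends only on the mean-free part of the data. -/
lemma exists_local_sol (ha : a ∈ Icc (0 : ℝ) 1) (hb : IsField b V) {R₀ : ℝ} (hR₀ : 0 ≤ R₀) :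
    ∃ δ : ℝ, 0 < δ ∧ ∀ (s : ℝ) (u₀ : L2 L₁ L₂), ‖meanFree u₀‖ ≤ R₀ →
      ∃ u G, Sol a b s (s + δ) u₀ u G := by
  -- Twice the bound for the linear part on intervals of length at most 1; the other half of R is
  -- left for the Duhamel integral.
  set R := 4 * Real.exp 1 * R₀ with hRdef
  have hR : 0 ≤ R := by positivity
  obtain ⟨δ, hδ0, hδ1, hδ⟩ := exists_small (contrConst L₁ L₂ * (V + R))
    (mul_nonneg contrConst_nonneg (add_nonneg hb.nonneg hR))
  refine ⟨δ, hδ0, fun s u₀ hu => ?_⟩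
  set T := s + δ with hT
  have hTs : T - s ≤ δ := by rw [hT]; linarith
  have hsT : s ≤ T := by rw [hT]; linarith
  set c : ℤ × ℤ → ℂ := fun k => coef L₁ L₂ k u₀ with hc
  have hcs : Summable fun k => ‖c k‖ ^ 2 := summable_norm_coef_sq u₀
  have hcn : ∀ k, c (-k) = (starRingEnd ℂ) (c k) := coef_neg u₀
  have hlin : ∀ t ∈ Ioc s T, ‖gradOf L₁ L₂ (flowCoeff a b (fun _ => 0) s c t)‖ ≤
      R / 2 * (t - s) ^ (-(1 / 4) : ℝ) := by
    intro t ht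
    refine (norm_gradOf_linear_le ha ht.1 hR₀ hu).trans ?_
    have hts : 0 < t - s := sub_pos.2 ht.1
    have : Real.exp (t - s) ≤ Real.exp 1 := Real.exp_le_exp.2 (by linarith [ht.2])
    calc 2 * Real.exp (t - s) * (t - s) ^ (-(1 / 4) : ℝ) * R₀
        ≤ 2 * Real.exp 1 * (t - s) ^ (-(1 / 4) : ℝ) * R₀ := by gcongr
      _ = R / 2 * (t - s) ^ (-(1 / 4) : ℝ) := by rw [hRdef]; ring
  have hmap : ∀ G, IsAdmissible s T R G →
      IsAdmissible s T R (fun t => gradOf L₁ L₂ (flowCoeff a b G s c t)) := by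
    intro G hG
    refine ⟨aestronglyMeasurable_gradOf_flowCoeff ha hb hR hsT hG hcs hcn, fun t ht => ?_⟩
    -- Comparison with the zero gradient, whose distance is R, bounds the Duhamel part by R/2.
    have h1 := contraction ha hb hR hδ1 hTs hδ hcs hcn hG (isAdmissible_zero hR) hR
      (fun t ht => by rw [sub_zero]; exact hG.bound t ht) t ht
    have h2 := hlin t ht
    have h3 := norm_le_norm_sub_add (gradOf L₁ L₂ (flowCoeff a b G s c t))
      (gradOf L₁ L₂ (flowCoeff a b (fun _ => 0) s c t))
    linarith
  have hadm : ∀ n, IsAdmissible s T R (picard a b s u₀ n) := by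
    intro n
    induction n with
    | zero => exact isAdmissible_zero hR
    | succ n ih => exact hmap _ ih
  have hdiff : ∀ n, ∀ t ∈ Ioc s T, ‖picard a b s u₀ n t - picard a b s u₀ (n + 1) t‖ ≤
      (R / 2 / 2 ^ n) * (t - s) ^ (-(1 / 4) : ℝ) := by
    intro n
    induction n with
    | zero =>
      intro t ht
      have := hlin t ht
      simpa [picard] using this
    | succ n ih =>
      intro t ht
      have := contraction ha hb hR hδ1 hTs hδ hcs hcn (hadm n) (hadm (n + 1)) (by positivity) ih t ht
      rw [pow_succ, ← div_div]
      exact this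
  have hdist : ∀ t ∈ Ioc s T, ∀ n, dist (picard a b s u₀ n t) (picard a b s u₀ (n + 1) t) ≤
      (R * (t - s) ^ (-(1 / 4) : ℝ)) / 2 / 2 ^ n := by
    intro t ht n
    rw [dist_eq_norm]
    refine (hdiff n t ht).trans (le_of_eq ?_)
    ring
  have hlim : ∀ t, ∃ g, t ∈ Ioc s T →
      Filter.Tendsto (fun n => picard a b s u₀ n t) Filter.atTop (nhds g) := by
    intro t
    by_cases ht : t ∈ Ioc s T
    · obtain ⟨g, hg⟩ := cauchySeq_tendsto_of_complete
        (cauchySeq_of_le_geometric_two (hdist t ht))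
      exact ⟨g, fun _ => hg⟩
    · exact ⟨0, fun h => absurd h ht⟩
  choose G hGlim using hlim
  have hG : IsAdmissible s T R G := by
    constructor
    · refine aestronglyMeasurable_of_tendsto_ae Filter.atTop (fun n => (hadm n).meas) ?_
      filter_upwards [ae_restrict_mem measurableSet_Ioc] with t ht
      exact hGlim t ht
    · intro t ht
      exact le_of_tendsto (hGlim t ht).norm
        (Filter.Eventually.of_forall fun n => (hadm n).bound t ht)
  -- Pointwise limits suffice: the geometric rate holds in the weighted norm, and `contraction`
  -- carries it to the images.
  have hfix : ∀ t ∈ Ioc s T, G t = gradOf L₁ L₂ (flowCoeff a b G s c t) := by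
    intro t ht
    have h1 : ∀ n, ‖picard a b s u₀ (n + 1) t - gradOf L₁ L₂ (flowCoeff a b G s c t)‖ ≤
        (R / 2 ^ n / 2) * (t - s) ^ (-(1 / 4) : ℝ) := fun n =>
      contraction ha hb hR hδ1 hTs hδ hcs hcn (hadm n) hG (by positivity) (fun r hr => by
        have := dist_le_of_le_geometric_two_of_tendsto (hdist r hr) (hGlim r hr) n
        rw [dist_eq_norm] at this
        refine this.trans (le_of_eq ?_)
        ring) t ht
    have h2 : Filter.Tendsto (fun n : ℕ => (R / 2 ^ n / 2) * (t - s) ^ (-(1 / 4) : ℝ))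
        Filter.atTop (nhds 0) := by
      have h1 := ((tendsto_pow_atTop_nhds_zero_of_lt_one (by norm_num : (0 : ℝ) ≤ 1 / 2)
        (by norm_num)).const_mul (R / 2)).mul_const ((t - s) ^ (-(1 / 4) : ℝ))
      simp only [mul_zero, zero_mul] at h1
      refine h1.congr fun n => ?_
      rw [div_pow, one_pow]
      ring
    have h3 : Filter.Tendsto (fun n => picard a b s u₀ (n + 1) t) Filter.atTop
        (nhds (gradOf L₁ L₂ (flowCoeff a b G s c t))) :=
      tendsto_iff_norm_sub_tendsto_zero.2 (squeeze_zero (fun _ => norm_nonneg _) h1 h2)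
    exact tendsto_nhds_unique ((Filter.tendsto_add_atTop_iff_nat 1).2 (hGlim t ht)) h3
  refine ⟨fun t => ofCoeff L₁ L₂ (flowCoeff a b G s c t), G, ⟨fun t ht j k => ?_, ⟨R, hR, hG⟩,
    fun t ht k => ?_⟩⟩
  · rw [coef_ofCoeff (summable_flowCoeff ha hb hR hG hcs (Ioc_subset_Icc_self ht))
      (flowCoeff_neg a b G hcn), hfix t ht,
      coef_gradOf (summable_grad_flowCoeff ha hb hR hG hcs ht) (flowCoeff_neg a b G hcn)]
  · exact coef_ofCoeff (summable_flowCoeff ha hb hR hG hcs ht) (flowCoeff_neg a b G hcn) k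

/-- An a priori bound implies global existence. -/
lemma exists_sol_of_bound (ha : a ∈ Icc (0 : ℝ) 1) (hb : IsField b V) {s R : ℝ} {u₀ : L2 L₁ L₂}
    (hR : ∀ T u G, s ≤ T → Sol a b s T u₀ u G → ∀ t ∈ Icc s T, ‖meanFree (u t)‖ ≤ R)
    (hu : ‖meanFree u₀‖ ≤ R) (T : ℝ) : ∃ u G, Sol a b s T u₀ u G := by
  obtain ⟨δ, hδ, hloc⟩ := exists_local_sol ha hb ((norm_nonneg _).trans hu)
  -- Each extension restarts δ/2 before the end of the previous interval, so that the solutions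
  -- overlap, and gains δ/2. The length δ is the same at every stage because the a priori bound R
  -- holds for every solution.
  have key : ∀ n : ℕ, ∃ u G, Sol a b s (s + δ + n * (δ / 2)) u₀ u G := by
    intro n
    induction n with
    | zero =>
      obtain ⟨u, G, h⟩ := hloc s u₀ hu
      exact ⟨u, G, by simpa using h⟩
    | succ n ih =>
      obtain ⟨u, G, h⟩ := ih
      have hn : 0 ≤ (n : ℝ) * (δ / 2) := by positivity
      set s' := s + δ / 2 + n * (δ / 2) with hs'
      obtain ⟨u', G', h'⟩ := hloc s' (u s')
        (hR _ u G (by linarith) h s' ⟨by linarith, by linarith⟩)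
      have e : s + δ + ((n + 1 : ℕ) : ℝ) * (δ / 2) = s' + δ := by
        rw [hs']; push_cast; ring
      rw [e]
      exact ⟨_, _, h.glue ha hb (by linarith) (by linarith) (by linarith) h'⟩
  obtain ⟨n, hn⟩ := exists_nat_ge ((T - s) / (δ / 2))
  rw [div_le_iff₀ (by positivity)] at hn
  obtain ⟨u, G, h⟩ := key n
  exact ⟨u, G, h.mono (by linarith)⟩

end

/-! ### Mild solutions in terms of Fourier coefficients -/

lemma coef_semigroup {σ : ℤ × ℤ → ℝ} (hσ : ∀ k, σ (-k) = σ k) {t : ℝ} {g : Torus L₁ L₂ → ℝ}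
    (h : Summable fun k => ‖(Real.exp (-t * σ k) : ℂ) * fourierCoeff2 g k‖ ^ 2) (k : ℤ × ℤ) :
    coef L₁ L₂ k (semigroup σ t g) = Real.exp (-t * σ k) * fourierCoeff2 g k := by
  rw [semigroup_eq_ofCoeff]
  refine coef_ofCoeff h (fun k => ?_) k
  rw [hσ, fourierCoeff2_neg, map_mul, Complex.conj_ofReal]

lemma coef_semigroup_L2 {a : ℝ} (ha : a ∈ Icc (0 : ℝ) 1) {t : ℝ} (ht : 0 ≤ t) (u : L2 L₁ L₂)
    (k : ℤ × ℤ) : coef L₁ L₂ k (semigroup (symb L₁ L₂ a) t u) =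
      Real.exp (-t * symb L₁ L₂ a k) * coef L₁ L₂ k u := by
  rw [coef_apply k u]
  refine coef_semigroup (symb_neg a) ?_ k
  refine Summable.of_nonneg_of_le (fun _ => sq_nonneg _) (fun k => ?_)
    ((summable_norm_coef_sq u).mul_left (Real.exp t ^ 2))
  rw [coef_apply, norm_mul, mul_pow, Complex.norm_real, Real.norm_of_nonneg (Real.exp_pos _).le]
  refine mul_le_mul_of_nonneg_right ?_ (sq_nonneg _)
  exact pow_le_pow_left₀ (Real.exp_pos _).le (exp_neg_mul_symb_le_exp ha ht k) 2

lemma semigroup_decay {a x Q : ℝ} (ha : a ∈ Icc (0 : ℝ) 1) (hx : 0 < x)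
    {g : Torus L₁ L₂ → ℝ} (hg : ∀ k, ‖fourierCoeff2 g k‖ ≤ Q) (k : ℤ × ℤ) :
    ‖(Real.exp (-x * symb L₁ L₂ a k) : ℂ) * fourierCoeff2 g k‖ ≤
      (2 * Real.exp x * x ^ (-(3 / 8) : ℝ) * Q) * weight L₁ L₂ k ^ (-(3 / 8) : ℝ) := by
  have hw := weight_pos (L₁ := L₁) (L₂ := L₂) k
  rw [norm_mul, Complex.norm_real, Real.norm_of_nonneg (Real.exp_pos _).le]
  calc Real.exp (-x * symb L₁ L₂ a k) * ‖fourierCoeff2 g k‖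
      ≤ (2 * Real.exp x * x ^ (-(3 / 8) : ℝ) * weight L₁ L₂ k ^ (-(3 / 8) : ℝ)) * Q := by
        gcongr
        · exact exp_neg_mul_symb_le ha hx (by norm_num) (by norm_num) k
        · exact hg k
    _ = _ := by ring

/-- The right-hand side `F` has the Fourier coefficients given by `force`. -/
def IsForce (a : ℝ) (b : ℝ → Fin 2 → L2 L₁ L₂)
    (F : ℝ → (Fin 2 → L2 L₁ L₂) → Torus L₁ L₂ → ℝ) : Prop :=
  ∀ᵐ τ ∂(volume.restrict (Ici (0 : ℝ))), ∀ G k, fourierCoeff2 (F τ G) k = force a (b τ) G k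

section

variable {a V s T M : ℝ} {b G : ℝ → Fin 2 → L2 L₁ L₂}
  {F : ℝ → (Fin 2 → L2 L₁ L₂) → Torus L₁ L₂ → ℝ} {u₀ : L2 L₁ L₂} {u : ℝ → L2 L₁ L₂}

/-- The force is only an integrable function, but its coefficients are bounded and the semigroup at
positive time maps it into L². The exponent 3/8 gives square summability and a kernel integrable in
time. -/
lemma IsForce.ae_semigroup (hF : IsForce a b F) (ha : a ∈ Icc (0 : ℝ) 1) (hb : IsField b V)
    (hM : 0 ≤ M) (hG : IsAdmissible s T M G) (hs : 0 ≤ s) {t : ℝ} (ht : t ∈ Icc s T) :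
    ∃ D, 0 ≤ D ∧ ∀ᵐ τ, τ ∈ Ioc s t →
      (∀ k, coef L₁ L₂ k (semigroup (symb L₁ L₂ a) (t - τ) (F τ (G τ))) =
        Real.exp (-(t - τ) * symb L₁ L₂ a k) * force a (b τ) (G τ) k) ∧
      ‖semigroup (symb L₁ L₂ a) (t - τ) (F τ (G τ))‖ ≤
        D * ((t - τ) ^ (-(3 / 8) : ℝ) * (τ - s) ^ (-(1 / 2) : ℝ)) ∧ τ < t := by
  have hA := area_pos L₁ L₂
  have hV := hb.nonneg
  have hT : 0 ≤ T - s := by linarith [ht.1, ht.2]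
  have hS := decayConst_nonneg (L₁ := L₁) (L₂ := L₂)
  set Q := 2 / (L₁ * L₂) * ((V * (1 + (T - s)) + 2 * M) * M) with hQ
  have hQ0 : 0 ≤ Q := by positivity
  refine ⟨decayConst L₁ L₂ * (2 * Real.exp (t - s) * Q), by positivity, ?_⟩
  have hne : ∀ᵐ τ : ℝ, τ ≠ t := by simp [ae_iff, measure_singleton]
  have hF' := (ae_restrict_iff' measurableSet_Ici).1 hF
  filter_upwards [hne, hF'] with τ hτt hFτ hτ
  have hlt : τ < t := lt_of_le_of_ne hτ.2 hτt
  have hx : 0 < t - τ := sub_pos.2 hlt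
  have hy : 0 < τ - s := sub_pos.2 hτ.1
  have hf := hFτ (hs.trans hτ.1.le) (G τ)
  have hbd : ∀ k, ‖fourierCoeff2 (F τ (G τ)) k‖ ≤ Q * (τ - s) ^ (-(1 / 2) : ℝ) := fun k => by
    rw [hf k]
    exact hG.norm_force_le ha hb hM ⟨hτ.1, hτ.2.trans ht.2⟩ k
  have hdec := semigroup_decay (L₁ := L₁) (L₂ := L₂) ha hx hbd
  refine ⟨fun k => ?_, ?_, hlt⟩
  · rw [coef_semigroup (symb_neg a) (summable_of_decay hdec), hf k]
  · rw [semigroup_eq_ofCoeff]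
    refine (norm_ofCoeff_le_of_decay (by positivity) hdec fun k => by
      rw [symb_neg, fourierCoeff2_neg, map_mul, Complex.conj_ofReal]).trans ?_
    have : Real.exp (t - τ) ≤ Real.exp (t - s) := Real.exp_le_exp.2 (by linarith)
    calc decayConst L₁ L₂ * (2 * Real.exp (t - τ) * (t - τ) ^ (-(3 / 8) : ℝ) *
          (Q * (τ - s) ^ (-(1 / 2) : ℝ)))
        ≤ decayConst L₁ L₂ * (2 * Real.exp (t - s) * (t - τ) ^ (-(3 / 8) : ℝ) *
          (Q * (τ - s) ^ (-(1 / 2) : ℝ))) := by gcongr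
      _ = _ := by ring

lemma IsForce.intervalIntegrable (hF : IsForce a b F) (ha : a ∈ Icc (0 : ℝ) 1) (hb : IsField b V)
    (hM : 0 ≤ M) (hG : IsAdmissible s T M G) (hs : 0 ≤ s) {t : ℝ} (ht : t ∈ Icc s T) :
    IntervalIntegrable (fun τ => semigroup (symb L₁ L₂ a) (t - τ) (F τ (G τ))) volume s t := by
  rcases ht.1.eq_or_lt with rfl | hst
  · exact IntervalIntegrable.refl
  obtain ⟨D, hD, hae⟩ := hF.ae_semigroup ha hb hM hG hs ht
  obtain ⟨g, hg, hgb, -⟩ := exists_beta_majorant hst (by norm_num : (0 : ℝ) ≤ 3 / 8) (by norm_num)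
  rw [intervalIntegrable_iff_integrableOn_Ioc_of_le ht.1] at hg ⊢
  refine Integrable.mono' (hg.const_mul D) ?_ ?_
  · refine aestronglyMeasurable_of_coef fun k => ?_
    have h1 := (hG.mono ht.2).intervalIntegrable_duhamel ha hb hM ht.1 t k
    rw [intervalIntegrable_iff_integrableOn_Ioc_of_le ht.1] at h1
    refine h1.aestronglyMeasurable.congr ?_
    rw [Filter.EventuallyEq, ae_restrict_iff' measurableSet_Ioc]
    filter_upwards [hae] with τ h hτ
    exact ((h hτ).1 k).symm
  · rw [ae_restrict_iff' measurableSet_Ioc]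
    filter_upwards [hae] with τ h hτ
    refine (h hτ).2.1.trans ?_
    gcongr
    exact hgb τ ⟨hτ.1, (h hτ).2.2⟩

lemma IsForce.coef_integral (hF : IsForce a b F) (ha : a ∈ Icc (0 : ℝ) 1) (hb : IsField b V)
    (hM : 0 ≤ M) (hG : IsAdmissible s T M G) (hs : 0 ≤ s) {t : ℝ} (ht : t ∈ Icc s T)
    (k : ℤ × ℤ) :
    coef L₁ L₂ k (semigroup (symb L₁ L₂ a) (t - s) u₀ +
      ∫ τ in s..t, semigroup (symb L₁ L₂ a) (t - τ) (F τ (G τ))) =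
      flowCoeff a b G s (fun k => coef L₁ L₂ k u₀) t k := by
  obtain ⟨D, hD, hae⟩ := hF.ae_semigroup ha hb hM hG hs ht
  rw [map_add, coef_semigroup_L2 ha (by linarith [ht.1]), flowCoeff, duhamel,
    ← ContinuousLinearMap.intervalIntegral_comp_comm _
      (hF.intervalIntegrable ha hb hM hG hs ht)]
  congr 1
  apply intervalIntegral.integral_congr_ae
  rw [uIoc_of_le ht.1]
  filter_upwards [hae] with τ h hτ
  exact (h hτ).1 k

lemma hasGradient_iff {w : L2 L₁ L₂} {g : Fin 2 → L2 L₁ L₂} : HasGradient w g ↔ IsGrad w g := by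
  simp only [HasGradient, IsGrad, coef_apply]

/-- Coefficients determine an L² function and commute with the Bochner integral, so Duhamel's
formula may be read coefficient by coefficient. Continuity, integrability and convergence of the
integrals need not be recorded in `Sol`: they follow from the weighted bound on the gradient. -/
lemma IsForce.isMildSolution_iff (hF : IsForce a b F) (ha : a ∈ Icc (0 : ℝ) 1) (hb : IsField b V)
    (hs : 0 ≤ s) (hsT : s ≤ T) :
    IsMildSolution (symb L₁ L₂ a) F s T u₀ u ↔ ∃ G, Sol a b s T u₀ u G := by
  constructor
  · rintro ⟨-, G, hgrad, hint, ⟨M, hM⟩, hduh⟩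
    -- The constant M of the hypothesis may be negative when the interval is empty.
    have hadm : IsAdmissible s T (max M 0) G := by
      refine ⟨hint.aestronglyMeasurable, fun t ht => ?_⟩
      have hts : 0 < t - s := sub_pos.2 ht.1
      refine (pi_norm_le_iff_of_nonneg (by positivity)).2 fun j => ?_
      have h1 := (hM t ht j).trans (le_max_left M 0)
      rw [Real.rpow_neg hts.le, ← div_eq_mul_inv, le_div_iff₀ (by positivity), mul_comm]
      exact h1
    refine ⟨G, fun t ht => hasGradient_iff.1 (hgrad t ht), ⟨_, le_max_right M 0, hadm⟩,
      fun t ht k => ?_⟩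
    rw [(hduh t ht).2, hF.coef_integral ha hb (le_max_right M 0) hadm hs ht]
  · rintro ⟨G, h⟩
    obtain ⟨M, hM, hG⟩ := h.adm
    refine ⟨h.continuousOn ha hb, G, fun t ht => hasGradient_iff.2 (h.grad t ht), ?_,
      ⟨M, fun t ht j => ?_⟩, fun t ht => ⟨hF.intervalIntegrable ha hb hM hG hs ht, ?_⟩⟩
    · have h1 : IntegrableOn (fun t => M * (t - s) ^ (-(1 / 4) : ℝ)) (Ioc s T) := by
        rw [← intervalIntegrable_iff_integrableOn_Ioc_of_le hsT]
        exact (intervalIntegrable_sub_rpow (by norm_num)).const_mul _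
      refine Integrable.mono' h1 hG.meas ?_
      rw [ae_restrict_iff' measurableSet_Ioc]
      exact Filter.Eventually.of_forall hG.bound
    · have hts : 0 < t - s := sub_pos.2 ht.1
      have h1 := (norm_le_pi_norm (G t) j).trans (hG.bound t ht)
      rw [Real.rpow_neg hts.le, ← div_eq_mul_inv, le_div_iff₀ (by positivity)] at h1
      rwa [mul_comm]
    · apply ext_coef
      intro k
      rw [hF.coef_integral ha hb hM hG hs ht, h.duh t ht]

end

/-! ### The vector field -/

section

variable {v : ℝ → Torus L₁ L₂ → EuclideanSpace ℝ (Fin 2)}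

/-- The times at which the field is bounded, Lipschitz continuous and divergence-free. -/
def IsGoodTime (v : ℝ → Torus L₁ L₂ → EuclideanSpace ℝ (Fin 2)) (K : ℝ≥0) (τ : ℝ) : Prop :=
  0 ≤ τ ∧ (∀ x, ‖v τ x‖ ≤ K) ∧ LipschitzWith K (v τ) ∧
    ∀ k, ∑ j, Complex.I * (freq L₁ L₂ k j : ℂ) * fourierCoeff2 (fun x => v τ x j) k = 0

lemma continuous_component {K : ℝ≥0} {τ : ℝ} (h : IsGoodTime v K τ) (j : Fin 2) :
    Continuous fun x => v τ x j :=
  (EuclideanSpace.proj (𝕜 := ℝ) j).continuous.comp h.2.2.1.continuous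

open scoped Classical in
/-- The components of the field as elements of `L²`, and zero at the exceptional times. -/
def fieldLp (v : ℝ → Torus L₁ L₂ → EuclideanSpace ℝ (Fin 2)) (K : ℝ≥0) (τ : ℝ) (j : Fin 2) :
    L2 L₁ L₂ :=
  if h : IsGoodTime v K τ then
    ContinuousMap.toLp 2 volume ℝ ⟨fun x => v τ x j, continuous_component h j⟩ else 0

lemma coeFn_fieldLp {K : ℝ≥0} {τ : ℝ} (h : IsGoodTime v K τ) (j : Fin 2) :
    fieldLp v K τ j =ᵐ[volume] fun x => v τ x j := by
  rw [fieldLp, dif_pos h]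
  exact ContinuousMap.coeFn_toLp (𝕜 := ℝ) (p := 2) volume _

lemma abs_fieldLp_le (v : ℝ → Torus L₁ L₂ → EuclideanSpace ℝ (Fin 2)) (K : ℝ≥0) (τ : ℝ)
    (j : Fin 2) : ∀ᵐ x, |fieldLp v K τ j x| ≤ K := by
  by_cases h : IsGoodTime v K τ
  · filter_upwards [coeFn_fieldLp h j] with x hx
    rw [hx, ← Real.norm_eq_abs]
    exact (PiLp.norm_apply_le (v τ x) j).trans (h.2.1 x)
  · rw [fieldLp, dif_neg h]
    filter_upwards [Lp.coeFn_zero ℝ 2 (volume : Measure (Torus L₁ L₂))] with x hx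
    rw [hx]
    simp

lemma isSolenoidal_fieldLp (v : ℝ → Torus L₁ L₂ → EuclideanSpace ℝ (Fin 2)) (K : ℝ≥0) (τ : ℝ) :
    IsSolenoidal (fieldLp v K τ) := by
  refine ⟨⟨K, abs_fieldLp_le v K τ⟩, fun k => ?_⟩
  by_cases h : IsGoodTime v K τ
  · rw [← h.2.2.2 k]
    refine Finset.sum_congr rfl fun j _ => ?_
    rw [coef_apply, fourierCoeff2_congr (coeFn_fieldLp h j)]
  · simp [fieldLp, h]

/-- Joint measurability gives measurable Fourier coefficients by Fubini, and these suffice for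
measurability into L². At negative times the field is zero by definition. -/
lemma aestronglyMeasurable_fieldLp {K : ℝ≥0}
    (hm : AEStronglyMeasurable (fun p : ℝ × Torus L₁ L₂ => v p.1 p.2)
      ((volume.restrict (Ici (0 : ℝ))).prod volume))
    (hgood : ∀ᵐ τ ∂(volume.restrict (Ici (0 : ℝ))), IsGoodTime v K τ) :
    AEStronglyMeasurable (fieldLp v K) volume := by
  have h : ∀ j, AEStronglyMeasurable (fun τ => fieldLp v K τ j) volume := by
    intro j
    have hu : (Ici (0 : ℝ)) ∪ Iio 0 = univ := Ici_union_Iio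
    rw [← Measure.restrict_univ (μ := (volume : Measure ℝ)), ← hu, aestronglyMeasurable_union_iff]
    constructor
    · refine aestronglyMeasurable_of_coef fun k => ?_
      have h1 : AEStronglyMeasurable (fun p : ℝ × Torus L₁ L₂ =>
          (starRingEnd ℂ) (character L₁ L₂ k p.2) * ((v p.1 p.2 j : ℝ) : ℂ))
          ((volume.restrict (Ici (0 : ℝ))).prod volume) := by
        refine AEStronglyMeasurable.mul ?_ ?_
        · exact (Complex.continuous_conj.comp ((continuous_character k).comp
            continuous_snd)).aestronglyMeasurable
        · exact (Complex.continuous_ofReal.comp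
            (EuclideanSpace.proj (𝕜 := ℝ) j).continuous).comp_aestronglyMeasurable hm
      have h2 := (h1.integral_prod_right').const_mul (((1 / (L₁ * L₂) : ℝ) : ℂ))
      refine h2.congr ?_
      filter_upwards [hgood] with τ hτ
      rw [coef_apply, fourierCoeff2_congr (coeFn_fieldLp hτ j), fourierCoeff2]
    · refine aestronglyMeasurable_zero.congr ?_
      filter_upwards [ae_restrict_mem measurableSet_Iio] with τ hτ
      have : ¬ IsGoodTime v K τ := fun h => absurd h.1 (not_le.2 hτ)
      simp [fieldLp, this]
  have hc : Continuous fun p : L2 L₁ L₂ × L2 L₁ L₂ => (![p.1, p.2] : Fin 2 → L2 L₁ L₂) :=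
    continuous_pi fun j => by fin_cases j <;> simp <;> fun_prop
  refine (hc.comp_aestronglyMeasurable ((h 0).prodMk (h 1))).congr
    (Filter.Eventually.of_forall fun t => ?_)
  funext j
  fin_cases j <;> rfl

lemma fourierCoeff2_force {K : ℝ≥0} {τ : ℝ} (h : IsGoodTime v K τ) (a : ℝ)
    (G : Fin 2 → L2 L₁ L₂) (k : ℤ × ℤ) :
    fourierCoeff2 (fun x => -(a / 2 * ∑ j, G j x ^ 2) - ∑ j, v τ x j * G j x) k =
      force a (fieldLp v K τ) G k := by
  set f := fieldLp v K τ with hf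
  have e : (fun x => -(a / 2 * ∑ j, G j x ^ 2) - ∑ j, v τ x j * G j x) =ᵐ[volume]
      fun x => (-(a / 2)) * (G 0 x * G 0 x + G 1 x * G 1 x) +
        (-1) * (f 0 x * G 0 x + f 1 x * G 1 x) := by
    filter_upwards [coeFn_fieldLp h 0, coeFn_fieldLp h 1] with x h0 h1
    rw [h0, h1, Fin.sum_univ_two, Fin.sum_univ_two]
    ring
  have i1 : Integrable (fun x => G 0 x * G 0 x + G 1 x * G 1 x) :=
    (integrable_mul_L2 (G 0) (G 0)).add (integrable_mul_L2 (G 1) (G 1))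
  have i2 : Integrable (fun x => f 0 x * G 0 x + f 1 x * G 1 x) :=
    (integrable_mul_L2 (f 0) (G 0)).add (integrable_mul_L2 (f 1) (G 1))
  rw [fourierCoeff2_congr e, fourierCoeff2_add (i1.const_mul _) (i2.const_mul _),
    fourierCoeff2_const_mul, fourierCoeff2_const_mul,
    fourierCoeff2_add (integrable_mul_L2 _ _) (integrable_mul_L2 _ _),
    fourierCoeff2_add (integrable_mul_L2 _ _) (integrable_mul_L2 _ _), force, Fin.sum_univ_two,
    Fin.sum_univ_two]
  simp only [prodCoeff_apply]
  push_cast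
  ring

/-- A Lipschitz divergence-free field, as a field of `L²` functions. -/
lemma exists_field (hv : IsLipschitzField v) (hdiv : IsDivergenceFree v) :
    ∃ (b : ℝ → Fin 2 → L2 L₁ L₂) (V : ℝ), IsField b V ∧ ∀ a : ℝ, IsForce a b
      (fun τ g x => -(a / 2 * ∑ j, g j x ^ 2) - ∑ j, v τ x j * g j x) := by
  obtain ⟨hm, K, hK⟩ := hv
  have hgood : ∀ᵐ τ ∂(volume.restrict (Ici (0 : ℝ))), IsGoodTime v K τ := by
    filter_upwards [hK, hdiv, ae_restrict_mem measurableSet_Ici] with τ h1 h2 h3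
    exact ⟨h3, h1.1, h1.2, h2⟩
  refine ⟨fieldLp v K, (volume : Measure (Torus L₁ L₂)).real univ ^ ((2 : ℝ≥0∞).toReal)⁻¹ * K,
    ⟨aestronglyMeasurable_fieldLp hm hgood, fun τ => ?_, isSolenoidal_fieldLp v K⟩, fun a => ?_⟩
  · refine (pi_norm_le_iff_of_nonneg (by positivity)).2 fun j => ?_
    exact Lp.norm_le_of_ae_bound K.2 (by
      filter_upwards [abs_fieldLp_le v K τ j] with x hx
      rwa [Real.norm_eq_abs])
  · filter_upwards [hgood] with τ hτ G k
    exact fourierCoeff2_force hτ a G k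

lemma symb_one : symb L₁ L₂ 1 = kseSymbol L₁ L₂ := by
  funext k; simp [symb, kseSymbol]

lemma symb_zero : symb L₁ L₂ 0 = bilaplaceSymbol L₁ L₂ := by
  funext k; simp [symb, bilaplaceSymbol]

lemma isKSEMildSolution_iff {b : ℝ → Fin 2 → L2 L₁ L₂} {V T : ℝ} {φ₀ : L2 L₁ L₂}
    {φ : ℝ → L2 L₁ L₂} (hb : IsField b V)
    (hF : ∀ a : ℝ, IsForce a b (fun τ g x => -(a / 2 * ∑ j, g j x ^ 2) - ∑ j, v τ x j * g j x))
    (hT : 0 ≤ T) : IsKSEMildSolution v T φ₀ φ ↔ ∃ G, Sol 1 b 0 T φ₀ φ G := by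
  rw [← (hF 1).isMildSolution_iff ⟨zero_le_one, le_rfl⟩ hb le_rfl hT, symb_one]
  rfl

lemma isAdvHyperSolution_iff {b : ℝ → Fin 2 → L2 L₁ L₂} {V s T : ℝ} {f₀ : L2 L₁ L₂}
    {f : ℝ → L2 L₁ L₂} (hb : IsField b V)
    (hF : ∀ a : ℝ, IsForce a b (fun τ g x => -(a / 2 * ∑ j, g j x ^ 2) - ∑ j, v τ x j * g j x))
    (hs : 0 ≤ s) (hT : s ≤ T) : IsAdvHyperSolution v s T f₀ f ↔ ∃ G, Sol 0 b s T f₀ f G := by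
  rw [← (hF 0).isMildSolution_iff ⟨le_rfl, zero_le_one⟩ hb hs hT, symb_zero]
  simp only [IsAdvHyperSolution, zero_div, zero_mul, neg_zero, zero_sub]

end

/-! ### The energy identity -/

lemma absolutelyContinuousOnInterval_congr {f g : ℝ → ℝ} {s T : ℝ}
    (hf : AbsolutelyContinuousOnInterval f s T) (h : ∀ t ∈ uIcc s T, f t = g t) :
    AbsolutelyContinuousOnInterval g s T := by
  rw [absolutelyContinuousOnInterval_iff] at hf ⊢
  intro ε hε
  obtain ⟨δ, hδ, H⟩ := hf ε hε
  refine ⟨δ, hδ, fun nI h1 h2 => ?_⟩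
  refine lt_of_eq_of_lt (Finset.sum_congr rfl fun i hi => ?_) (H nI h1 h2)
  rw [h _ (h1.1 i hi).1, h _ (h1.1 i hi).2]

/-- `x` is absolutely continuous on `[s, T]` with derivative `g`. -/
structure HasACDeriv (x g : ℝ → ℂ) (s T : ℝ) : Prop where
  re : AbsolutelyContinuousOnInterval (fun t => (x t).re) s T
  im : AbsolutelyContinuousOnInterval (fun t => (x t).im) s T
  deriv : ∀ᵐ t, t ∈ uIcc s T → HasDerivAt x (g t) t

lemma HasACDeriv.sub {x y g h : ℝ → ℂ} {s T : ℝ} (hx : HasACDeriv x g s T)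
    (hy : HasACDeriv y h s T) : HasACDeriv (fun t => x t - y t) (fun t => g t - h t) s T := by
  refine ⟨hx.re.sub hy.re, hx.im.sub hy.im, ?_⟩
  filter_upwards [hx.deriv, hy.deriv] with t h1 h2 ht
  exact (h1 ht).sub (h2 ht)

lemma hasACDeriv_zero (s T : ℝ) : HasACDeriv (fun _ => 0) (fun _ => 0) s T := by
  have h : AbsolutelyContinuousOnInterval (fun _ : ℝ => (0 : ℝ)) s T :=
    (LipschitzWith.const (0 : ℝ)).lipschitzOnWith.absolutelyContinuousOnInterval
  exact ⟨by simpa using h, by simpa using h,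
    Filter.Eventually.of_forall fun t _ => hasDerivAt_const t 0⟩

lemma HasACDeriv.congr {x y g : ℝ → ℂ} {s T : ℝ} (hx : HasACDeriv x g s T)
    (h : ∀ t ∈ uIcc s T, x t = y t) : HasACDeriv y g s T := by
  refine ⟨absolutelyContinuousOnInterval_congr hx.re fun t ht => by rw [h t ht],
    absolutelyContinuousOnInterval_congr hx.im fun t ht => by rw [h t ht], ?_⟩
  -- Equality on the closed interval transfers derivatives only at interior points; the endpoints
  -- form a null set.
  have h1 : ∀ᵐ t : ℝ, t ≠ s := by simp [ae_iff, measure_singleton]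
  have h2 : ∀ᵐ t : ℝ, t ≠ T := by simp [ae_iff, measure_singleton]
  filter_upwards [hx.deriv, h1, h2] with t ht hs hT hts
  refine (ht hts).congr_of_eventuallyEq ?_
  have h3 : uIcc s T ∈ nhds t := by
    rw [uIcc, Icc_mem_nhds_iff]
    rw [uIcc, mem_Icc] at hts
    constructor
    · refine hts.1.lt_of_ne fun h => ?_
      rcases min_choice s T with e | e <;> rw [e] at h
      · exact hs h.symm
      · exact hT h.symm
    · refine hts.2.lt_of_ne fun h => ?_
      rcases max_choice s T with e | e <;> rw [e] at h
      · exact hs h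
      · exact hT h
  filter_upwards [h3] with τ hτ
  exact (h τ hτ).symm

lemma HasACDeriv.norm_sq {x g : ℝ → ℂ} {s T : ℝ} (h : HasACDeriv x g s T) :
    AbsolutelyContinuousOnInterval (fun t => ‖x t‖ ^ 2) s T ∧
      ∀ᵐ t, t ∈ uIcc s T →
        HasDerivAt (fun t => ‖x t‖ ^ 2) (2 * ((starRingEnd ℂ) (x t) * g t).re) t := by
  have e : (fun t => ‖x t‖ ^ 2) = fun t => (x t).re * (x t).re + (x t).im * (x t).im := by
    funext t
    rw [← Complex.normSq_eq_norm_sq, Complex.normSq_apply]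
  rw [e]
  refine ⟨(h.re.mul h.re).add (h.im.mul h.im), ?_⟩
  filter_upwards [h.deriv] with t ht hts
  have h1 := (Complex.reCLM.hasFDerivAt (x := x t)).comp_hasDerivAt t (ht hts)
  have h2 := (Complex.imCLM.hasFDerivAt (x := x t)).comp_hasDerivAt t (ht hts)
  have h3 := (h1.mul h1).add (h2.mul h2)
  refine h3.congr_deriv ?_
  simp [Complex.mul_re]
  ring

lemma hasACDeriv_integral {f : ℝ → ℂ} {s T : ℝ} (hf : IntervalIntegrable f volume s T) :
    HasACDeriv (fun t => ∫ τ in s..t, f τ) f s T := by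
  have hre : IntervalIntegrable (fun τ => (f τ).re) volume s T :=
    ⟨hf.1.re, hf.2.re⟩
  have him : IntervalIntegrable (fun τ => (f τ).im) volume s T :=
    ⟨hf.1.im, hf.2.im⟩
  have hsub : ∀ t ∈ uIcc s T, IntervalIntegrable f volume s t := fun t ht =>
    hf.mono_set (uIcc_subset_uIcc left_mem_uIcc ht)
  refine ⟨?_, ?_, ?_⟩
  · refine absolutelyContinuousOnInterval_congr
      (hre.absolutelyContinuousOnInterval_intervalIntegral (c := s) left_mem_uIcc) ?_
    intro t ht
    exact (Complex.reCLM.intervalIntegral_comp_comm (hsub t ht))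
  · refine absolutelyContinuousOnInterval_congr
      (him.absolutelyContinuousOnInterval_intervalIntegral (c := s) left_mem_uIcc) ?_
    intro t ht
    exact (Complex.imCLM.intervalIntegral_comp_comm (hsub t ht))
  · filter_upwards [hf.ae_hasDerivAt_integral] with t h ht
    exact h ht s left_mem_uIcc

/-- The variation of constants formula, in differential form. -/
lemma hasACDeriv_exp_mul {f : ℝ → ℂ} {s T σ : ℝ} (c : ℂ)
    (hf : IntervalIntegrable (fun τ => (Real.exp (τ * σ) : ℂ) * f τ) volume s T) :
    HasACDeriv (fun t => (Real.exp (-t * σ) : ℂ) *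
        (c + ∫ τ in s..t, (Real.exp (τ * σ) : ℂ) * f τ))
      (fun t => -(σ : ℂ) * ((Real.exp (-t * σ) : ℂ) *
        (c + ∫ τ in s..t, (Real.exp (τ * σ) : ℂ) * f τ)) + f t) s T := by
  have hI := hasACDeriv_integral hf
  have hE : AbsolutelyContinuousOnInterval (fun t => Real.exp (-t * σ)) s T := by
    apply ContDiffOn.absolutelyContinuousOnInterval
    fun_prop
  have hc : ∀ r : ℝ, AbsolutelyContinuousOnInterval (fun _ : ℝ => r) s T := fun r =>
    (LipschitzWith.const r).lipschitzOnWith.absolutelyContinuousOnInterval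
  refine ⟨?_, ?_, ?_⟩
  · have h := hE.mul ((hc c.re).add hI.re)
    convert h using 1
    funext t
    simp only [Complex.re_ofReal_mul, Complex.add_re, Pi.mul_apply, Pi.add_apply]
  · have h := hE.mul ((hc c.im).add hI.im)
    convert h using 1
    funext t
    simp only [Complex.im_ofReal_mul, Complex.add_im, Pi.mul_apply, Pi.add_apply]
  · filter_upwards [hI.deriv] with t ht hts
    have h1 : HasDerivAt (fun t : ℝ => (Real.exp (-t * σ) : ℂ))
        ((Real.exp (-t * σ) * (-1 * σ) : ℝ) : ℂ) t :=
      ((((hasDerivAt_id t).neg).mul_const σ).exp).ofReal_comp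
    have h2 := h1.mul ((ht hts).const_add c)
    refine h2.congr_deriv ?_
    have e : ((Real.exp (-t * σ) : ℝ) : ℂ) * ((Real.exp (t * σ) : ℝ) : ℂ) = 1 := by
      rw [← Complex.ofReal_mul, ← Real.exp_add]
      simp
    push_cast at e ⊢
    linear_combination f t * e

/-- Integration of the derivatives of the squared coefficients, term by term. -/
lemma integral_energy {x g : ℝ → ℤ × ℤ → ℂ} {s T : ℝ} {Q : ℤ × ℤ → ℝ} {E : ℝ → ℝ} (hsT : s ≤ T)
    (hx : ∀ k, HasACDeriv (fun t => x t k) (fun t => g t k) s T)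
    (hQ : Summable Q) (hb : ∀ t ∈ Icc s T, ∀ k, ‖x t k‖ * ‖g t k‖ ≤ Q k)
    (hE : ∀ t ∈ Icc s T, HasSum (fun k => 2 * ((starRingEnd ℂ) (x t k) * g t k).re) (E t))
    (h0 : Summable fun k => ‖x s k‖ ^ 2) (h1 : Summable fun k => ‖x T k‖ ^ 2) :
    IntervalIntegrable E volume s T ∧ ∫ t in s..T, E t = sqSum (x T) - sqSum (x s) := by
  have hd : ∀ᵐ t, t ∈ uIcc s T → ∀ k, deriv (fun t => ‖x t k‖ ^ 2) t =
      2 * ((starRingEnd ℂ) (x t k) * g t k).re := by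
    have := ae_all_iff.2 fun k => (hx k).norm_sq.2
    filter_upwards [this] with t ht hts k
    exact (ht k hts).deriv
  rw [uIcc_of_le hsT] at hd
  have hsum : HasSum (fun k => ∫ t in s..T, deriv (fun t => ‖x t k‖ ^ 2) t)
      (∫ t in s..T, E t) := by
    refine intervalIntegral.hasSum_integral_of_dominated_convergence (fun k _ => 2 * Q k)
      (fun k => (measurable_deriv _).aestronglyMeasurable) (fun k => ?_)
      (Filter.Eventually.of_forall fun t _ => hQ.mul_left 2) intervalIntegrable_const ?_
    · filter_upwards [hd] with t ht hts
      rw [uIoc_of_le hsT] at hts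
      have hts' := Ioc_subset_Icc_self hts
      rw [ht hts' k, norm_mul, Real.norm_eq_abs, abs_two]
      have := Complex.abs_re_le_norm ((starRingEnd ℂ) (x t k) * g t k)
      rw [norm_mul, RCLike.norm_conj] at this
      rw [Real.norm_eq_abs]
      linarith [hb t hts' k]
    · filter_upwards [hd] with t ht hts
      rw [uIoc_of_le hsT] at hts
      have hts' := Ioc_subset_Icc_self hts
      exact (hE t hts').congr_fun fun k => ht hts' k
  constructor
  · rw [intervalIntegrable_iff_integrableOn_Ioc_of_le hsT]
    -- No measurability of g is assumed. It is recovered from `deriv`, which is measurable for every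
    -- function and agrees with the terms almost everywhere.
    have hm : AEStronglyMeasurable E (volume.restrict (Ioc s T)) := by
      have hm' : Measurable fun t => ∑' k, deriv (fun t => ‖x t k‖ ^ 2) t := by
        apply Measurable.tsum
        exact fun k => measurable_deriv _
      refine hm'.aestronglyMeasurable.congr ?_
      rw [Filter.EventuallyEq, ae_restrict_iff' measurableSet_Ioc]
      filter_upwards [hd] with t ht hts
      rw [← (hE t (Ioc_subset_Icc_self hts)).tsum_eq]
      exact tsum_congr fun k => ht (Ioc_subset_Icc_self hts) k
    refine IntegrableOn.of_bound (by simp) hm (2 * ∑' k, Q k) ?_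
    rw [ae_restrict_iff' measurableSet_Ioc]
    refine Filter.Eventually.of_forall fun t ht => ?_
    have hts' := Ioc_subset_Icc_self ht
    rw [← (hE t hts').tsum_eq]
    refine tsum_of_norm_bounded (hQ.hasSum.mul_left 2) fun k => ?_
    rw [norm_mul, Real.norm_eq_abs, abs_two]
    have := Complex.abs_re_le_norm ((starRingEnd ℂ) (x t k) * g t k)
    rw [norm_mul, RCLike.norm_conj] at this
    rw [Real.norm_eq_abs]
    linarith [hb t hts' k]
  · refine hsum.unique ((h1.hasSum.sub h0.hasSum).congr_fun fun k => ?_)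
    rw [(hx k).norm_sq.1.integral_deriv_eq_sub]

/-! ### The rate of change of the energy -/

/-- The Fourier coefficients of the mean-free part of a function. -/
def fluct (u : L2 L₁ L₂) (k : ℤ × ℤ) : ℂ := coef L₁ L₂ k (meanFree u)

lemma fluct_apply (u : L2 L₁ L₂) (k : ℤ × ℤ) :
    fluct u k = if k = 0 then 0 else coef L₁ L₂ k u := coef_meanFree u k

lemma fluct_zero (u : L2 L₁ L₂) : fluct u 0 = 0 := by rw [fluct_apply, if_pos rfl]

lemma fluct_sub (u w : L2 L₁ L₂) (k : ℤ × ℤ) : fluct (u - w) k = fluct u k - fluct w k := by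
  rw [fluct, meanFree_sub, map_sub]; rfl

lemma norm_meanFree_sq_eq (u : L2 L₁ L₂) : ‖meanFree u‖ ^ 2 = (L₁ * L₂) * sqSum (fluct u) :=
  norm_meanFree_sq u

lemma summable_fluct_sq (u : L2 L₁ L₂) : Summable fun k => ‖fluct u k‖ ^ 2 :=
  summable_norm_coef_sq (meanFree u)

lemma sum_norm_grad_sq {z : L2 L₁ L₂} {H : Fin 2 → L2 L₁ L₂} (hH : IsGrad z H) :
    ∑ j, ‖H j‖ ^ 2 = (L₁ * L₂) * gradSum L₁ L₂ (fluct z) := by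
  have h1 := hasSum_sum (s := Finset.univ) fun (j : Fin 2) _ => hasSum_norm_coef_sq (H j)
  have h2 : HasSum (fun k => freqSq L₁ L₂ k * ‖fluct z k‖ ^ 2)
      (∑ j, ‖H j‖ ^ 2 / (L₁ * L₂)) := by
    refine h1.congr_fun fun k => ?_
    simp only [hH _ k, norm_mul, Complex.norm_I, one_mul, Complex.norm_real, mul_pow,
      Real.norm_eq_abs, sq_abs]
    rw [← Finset.sum_mul, freqSq, fluct_apply]
    split_ifs with hk
    · subst hk
      simp [freq]
    · rfl
  rw [gradSum, h2.tsum_eq, ← Finset.sum_div, mul_div_cancel₀ _ (area_pos L₁ L₂).ne']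

lemma norm_sum_prodCoeff_le {z : L2 L₁ L₂} {H : Fin 2 → L2 L₁ L₂} (hH : IsGrad z H) (k : ℤ × ℤ) :
    ‖∑ j, prodCoeff L₁ L₂ k (H j) (H j)‖ ≤ gradSum L₁ L₂ (fluct z) := by
  have hA := area_pos L₁ L₂
  calc ‖∑ j, prodCoeff L₁ L₂ k (H j) (H j)‖ ≤ ∑ j, (L₁ * L₂)⁻¹ * (‖H j‖ * ‖H j‖) :=
        norm_sum_le_of_le _ fun j _ => norm_prodCoeff_le k _ _
    _ = (L₁ * L₂)⁻¹ * ∑ j, ‖H j‖ ^ 2 := by rw [Finset.mul_sum]; simp only [sq]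
    _ = gradSum L₁ L₂ (fluct z) := by
        rw [sum_norm_grad_sq hH, inv_mul_cancel_left₀ hA.ne']

/-- The Fourier coefficients of the time derivative of the mean-free part of `w`, if `w` is
transported with gradient `G` and forced by terms that depend on `z` and its gradient `H`. -/
def rate (a : ℝ) (b : Fin 2 → L2 L₁ L₂) (z : L2 L₁ L₂) (H : Fin 2 → L2 L₁ L₂) (w : L2 L₁ L₂)
    (G : Fin 2 → L2 L₁ L₂) (k : ℤ × ℤ) : ℂ :=
  if k = 0 then 0 else -(freqSq L₁ L₂ k ^ 2 : ℝ) * coef L₁ L₂ k w +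
    (a * freqSq L₁ L₂ k : ℝ) * coef L₁ L₂ k z -
    (a / 2 : ℝ) * (∑ j, prodCoeff L₁ L₂ k (H j) (H j)) - ∑ j, prodCoeff L₁ L₂ k (b j) (G j)

lemma summable_mixed {x y : ℤ × ℤ → ℂ} (hx : IsH2 L₁ L₂ x) (hy : IsH2 L₁ L₂ y) :
    Summable fun k => freqSq L₁ L₂ k * (‖x k‖ * ‖y k‖) := by
  refine Summable.of_nonneg_of_le (fun k => mul_nonneg (freqSq_nonneg k) (by positivity))
    (fun k => ?_) (hx.sq.add hy.lap)
  nlinarith [sq_nonneg (‖x k‖ - freqSq L₁ L₂ k * ‖y k‖), sq_nonneg (‖x k‖),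
    sq_nonneg (freqSq L₁ L₂ k * ‖y k‖)]

lemma mixed_sq_le {x y : ℤ × ℤ → ℂ} (hx : IsH2 L₁ L₂ x) (hy : IsH2 L₁ L₂ y) :
    (∑' k, freqSq L₁ L₂ k * (‖x k‖ * ‖y k‖)) ^ 2 ≤ sqSum x * lapSum L₁ L₂ y := by
  have h1 : Filter.Tendsto (fun S : Finset (ℤ × ℤ) =>
      (∑ k ∈ S, freqSq L₁ L₂ k * (‖x k‖ * ‖y k‖)) ^ 2)
      Filter.atTop (nhds ((∑' k, freqSq L₁ L₂ k * (‖x k‖ * ‖y k‖)) ^ 2)) :=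
    ((summable_mixed hx hy).hasSum : Filter.Tendsto _ _ _).pow 2
  refine le_of_tendsto h1 (Filter.Eventually.of_forall fun S => ?_)
  calc (∑ k ∈ S, freqSq L₁ L₂ k * (‖x k‖ * ‖y k‖)) ^ 2
      = (∑ k ∈ S, ‖x k‖ * (freqSq L₁ L₂ k * ‖y k‖)) ^ 2 := by
        congr 1; exact Finset.sum_congr rfl fun k _ => by ring
    _ ≤ (∑ k ∈ S, ‖x k‖ ^ 2) * ∑ k ∈ S, (freqSq L₁ L₂ k * ‖y k‖) ^ 2 :=
        Finset.sum_mul_sq_le_sq_mul_sq S _ _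
    _ ≤ sqSum x * lapSum L₁ L₂ y := by
        gcongr
        · exact sqSum_nonneg x
        · exact hx.sq.sum_le_tsum S fun _ _ => by positivity
        · simp_rw [mul_pow]
          exact hy.lap.sum_le_tsum S fun _ _ => by positivity

/-- Pairing the rate with w gives the dissipation, a destabilizing term bounded by absolute values,
and a quadratic term. The coefficients of |∇z|² are at most its mean, so the last is bounded by that
mean times the ℓ¹ norm of ŵ. Transport contributes nothing. -/
lemma hasSum_rate {a : ℝ} (ha : a ∈ Icc (0 : ℝ) 1) {b G H : Fin 2 → L2 L₁ L₂} {w z : L2 L₁ L₂}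
    (hb : IsSolenoidal b) (hG : IsGrad w G) (hH : IsGrad z H) (hw : IsH2 L₁ L₂ (fluct w))
    (hz : IsH2 L₁ L₂ (fluct z)) :
    ∃ E, HasSum (fun k => 2 * ((starRingEnd ℂ) (fluct w k) * rate a b z H w G k).re) E ∧
      E ≤ -2 * lapSum L₁ L₂ (fluct w) +
        2 * a * ∑' k, freqSq L₁ L₂ k * (‖fluct w k‖ * ‖fluct z k‖) +
        a * gradSum L₁ L₂ (fluct z) * ∑' k, ‖fluct w k‖ := by
  have hre : ∀ x y : ℂ, |((starRingEnd ℂ) x * y).re| ≤ ‖x‖ * ‖y‖ := fun x y => by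
    refine (Complex.abs_re_le_norm _).trans ?_
    rw [norm_mul, RCLike.norm_conj]
  have hsm := summable_mixed hw hz
  have h1 : HasSum (fun k => -2 * (freqSq L₁ L₂ k ^ 2 * ‖fluct w k‖ ^ 2))
      (-2 * lapSum L₁ L₂ (fluct w)) := hw.lap.hasSum.mul_left _
  have b2 : ∀ k, |freqSq L₁ L₂ k * ((starRingEnd ℂ) (fluct w k) * fluct z k).re| ≤
      freqSq L₁ L₂ k * (‖fluct w k‖ * ‖fluct z k‖) := fun k => by
    rw [abs_mul, abs_of_nonneg (freqSq_nonneg k)]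
    exact mul_le_mul_of_nonneg_left (hre _ _) (freqSq_nonneg k)
  have s2 : Summable fun k => freqSq L₁ L₂ k * ((starRingEnd ℂ) (fluct w k) * fluct z k).re :=
    hsm.of_norm_bounded b2
  have b3 : ∀ k, |((starRingEnd ℂ) (fluct w k) * ∑ j, prodCoeff L₁ L₂ k (H j) (H j)).re| ≤
      gradSum L₁ L₂ (fluct z) * ‖fluct w k‖ := fun k => by
    refine (hre _ _).trans ?_
    rw [mul_comm]
    exact mul_le_mul_of_nonneg_right (norm_sum_prodCoeff_le hH k) (norm_nonneg _)
  have s3 : Summable fun k =>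
      ((starRingEnd ℂ) (fluct w k) * ∑ j, prodCoeff L₁ L₂ k (H j) (H j)).re :=
    (hw.summable_norm.mul_left (gradSum L₁ L₂ (fluct z))).of_norm_bounded b3
  -- Dropping the zero mode of w is harmless since the transport term has zero mean.
  have h4 : HasSum (fun k => ((starRingEnd ℂ) (fluct w k) *
      ∑ j, prodCoeff L₁ L₂ k (b j) (G j)).re) 0 := by
    refine (Complex.hasSum_re (hb.hasSum_transport hG)).congr_fun fun k => ?_
    rw [fluct_apply]
    split_ifs with hk
    · rw [hk, hb.sum_prodCoeff_zero hG, mul_zero, mul_zero]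
    · rfl
  refine ⟨_, (((h1.add (s2.hasSum.mul_left (2 * a))).sub (s3.hasSum.mul_left a)).sub
    (h4.mul_left 2)).congr_fun fun k => ?_, ?_⟩
  · by_cases hk : k = 0
    · subst hk
      simp [fluct_zero]
    · rw [rate, if_neg hk, fluct_apply w, fluct_apply z, if_neg hk, if_neg hk,
        ← Complex.normSq_eq_norm_sq, Complex.normSq_apply]
      generalize (∑ j, prodCoeff L₁ L₂ k (H j) (H j)) = P
      generalize (∑ j, prodCoeff L₁ L₂ k (b j) (G j)) = Q
      simp only [Complex.mul_re, Complex.conj_re, Complex.conj_im, Complex.sub_re, Complex.add_re,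
        Complex.sub_im, Complex.add_im, Complex.mul_im, Complex.ofReal_re, Complex.ofReal_im,
        Complex.neg_re, Complex.neg_im]
      ring
  · have e2 : ∑' k, freqSq L₁ L₂ k * ((starRingEnd ℂ) (fluct w k) * fluct z k).re ≤
        ∑' k, freqSq L₁ L₂ k * (‖fluct w k‖ * ‖fluct z k‖) :=
      s2.tsum_le_tsum (fun k => (le_abs_self _).trans (b2 k)) hsm
    have e3 : -∑' k, ((starRingEnd ℂ) (fluct w k) * ∑ j, prodCoeff L₁ L₂ k (H j) (H j)).re ≤
        gradSum L₁ L₂ (fluct z) * ∑' k, ‖fluct w k‖ := by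
      rw [← tsum_neg, ← tsum_mul_left]
      exact s3.neg.tsum_le_tsum (fun k => (neg_le_abs _).trans (b3 k))
        (hw.summable_norm.mul_left _)
    have e2' := mul_le_mul_of_nonneg_left e2 (by linarith [ha.1] : 0 ≤ 2 * a)
    have e3' := mul_le_mul_of_nonneg_left e3 ha.1
    linarith

/-- Transport preserves the mean, so the mean is driven by the quadratic term alone. -/
lemma force_at_zero {a : ℝ} {b G : Fin 2 → L2 L₁ L₂} {w : L2 L₁ L₂} (ha : a ∈ Icc (0 : ℝ) 1)
    (hb : IsSolenoidal b) (hG : IsGrad w G) :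
    ‖force a b G 0‖ ≤ gradSum L₁ L₂ (fluct w) := by
  rw [force, hb.sum_prodCoeff_zero hG, sub_zero, norm_neg, norm_mul, Complex.norm_real,
    Real.norm_of_nonneg (by linarith [ha.1])]
  have h := norm_sum_prodCoeff_le hG 0
  have := gradSum_nonneg (L₁ := L₁) (L₂ := L₂) (fluct w)
  nlinarith [ha.1, ha.2, norm_nonneg (∑ j, prodCoeff L₁ L₂ 0 (G j) (G j))]

/-! ### Smoothing and the energy identity for solutions -/

lemma HasACDeriv.congr_deriv {x g g' : ℝ → ℂ} {s T : ℝ} (hx : HasACDeriv x g s T)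
    (h : ∀ t ∈ uIcc s T, g t = g' t) : HasACDeriv x g' s T := by
  refine ⟨hx.re, hx.im, ?_⟩
  filter_upwards [hx.deriv] with t ht hts
  rw [← h t hts]
  exact ht hts

lemma isH2_of_le {x : ℤ × ℤ → ℂ} {m : ℤ × ℤ → ℝ}
    (hm : Summable fun k => weight L₁ L₂ k * m k ^ 2) (h : ∀ k, ‖x k‖ ≤ m k) : IsH2 L₁ L₂ x := by
  refine Summable.of_nonneg_of_le (fun k => ?_) (fun k => ?_) hm
  · have := weight_pos (L₁ := L₁) (L₂ := L₂) k
    positivity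
  · have := weight_pos (L₁ := L₁) (L₂ := L₂) k
    have := h k
    gcongr

lemma norm_fluct_le (u : L2 L₁ L₂) (k : ℤ × ℤ) : ‖fluct u k‖ ≤ ‖coef L₁ L₂ k u‖ := by
  rw [fluct_apply]
  split_ifs <;> simp

lemma abs_symb_le {a : ℝ} (ha : a ∈ Icc (0 : ℝ) 1) (k : ℤ × ℤ) :
    |symb L₁ L₂ a k| ≤ 2 * weight L₁ L₂ k := by
  have h0 := freqSq_nonneg (L₁ := L₁) (L₂ := L₂) k
  have h1 := freqSq_le_weight (L₁ := L₁) (L₂ := L₂) k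
  have h2 := freqSq_sq_le_weight (L₁ := L₁) (L₂ := L₂) k
  have h3 : a * freqSq L₁ L₂ k ≤ 1 * freqSq L₁ L₂ k := mul_le_mul_of_nonneg_right ha.2 h0
  have h4 : 0 ≤ a * freqSq L₁ L₂ k := mul_nonneg ha.1 h0
  rw [symb, abs_le]
  constructor <;> nlinarith

/-- Subtracting the linear equation leaves the full hyperdiffusion and transport acting on z - f,
while the destabilizing and quadratic terms still involve only z. -/
lemma rate_sub (a : ℝ) (b : Fin 2 → L2 L₁ L₂) (z f : L2 L₁ L₂) (G H : Fin 2 → L2 L₁ L₂)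
    (k : ℤ × ℤ) : rate a b z G (z - f) (G - H) k = if k = 0 then 0 else
      (-(symb L₁ L₂ a k : ℂ) * coef L₁ L₂ k z + force a b G k) -
        (-(symb L₁ L₂ 0 k : ℂ) * coef L₁ L₂ k f + force 0 b H k) := by
  rw [rate]
  split_ifs with hk
  · rfl
  · simp only [force, symb, Pi.sub_apply, map_sub, Finset.sum_sub_distrib]
    push_cast
    ring

section

variable {a V s T : ℝ} {b G H : ℝ → Fin 2 → L2 L₁ L₂} {u₀ f₀ : L2 L₁ L₂} {u f : ℝ → L2 L₁ L₂}

/-- Parabolic smoothing, uniform for times at least s' > s. The linear part gains the power 1/2 of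
the weight and Duhamel's integral 7/8; after squaring and multiplying by the weight the latter
leaves the summable power -3/4. -/
lemma Sol.exists_h2_bound (ha : a ∈ Icc (0 : ℝ) 1) (hb : IsField b V) (h : Sol a b s T u₀ u G)
    {s' : ℝ} (hs : s < s') : ∃ m : ℤ × ℤ → ℝ, (Summable fun k => weight L₁ L₂ k * m k ^ 2) ∧
      ∀ t ∈ Icc s' T, ∀ k, ‖coef L₁ L₂ k (u t)‖ ≤ m k := by
  rcases lt_or_ge T s' with hT | hT
  · exact ⟨0, by simp, fun t ht => absurd (ht.1.trans ht.2) (not_le.2 hT)⟩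
  obtain ⟨M, hM, hG⟩ := h.adm
  have hA := area_pos L₁ L₂
  have hV := hb.nonneg
  have hy : 0 < s' - s := sub_pos.2 hs
  have hTs : 0 ≤ T - s := by linarith
  set P := 2 * Real.exp (T - s) * (s' - s) ^ (-(1 / 2) : ℝ) with hP
  set Q := (2 / (L₁ * L₂) * ((V * (1 + (T - s)) + 2 * M) * M)) * (12 / (1 - 7 / 8)) *
    Real.exp (T - s) * (s' - s) ^ (1 / 2 - 7 / 8 : ℝ) with hQ
  have hP0 : 0 ≤ P := by positivity
  have hQ0 : 0 ≤ Q := by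
    have : (0 : ℝ) ≤ 12 / (1 - 7 / 8) := by norm_num
    positivity
  refine ⟨fun k => P * weight L₁ L₂ k ^ (-(1 / 2) : ℝ) * ‖coef L₁ L₂ k u₀‖ +
    Q * weight L₁ L₂ k ^ (-(7 / 8) : ℝ), ?_, fun t ht k => ?_⟩
  · refine Summable.of_nonneg_of_le (fun k => ?_) (fun k => ?_)
      (((summable_norm_coef_sq u₀).mul_left (2 * P ^ 2)).add
        ((summable_weight_rpow L₁ L₂).mul_left (2 * Q ^ 2)))
    · have := weight_pos (L₁ := L₁) (L₂ := L₂) k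
      positivity
    · have hw := weight_pos (L₁ := L₁) (L₂ := L₂) k
      have e1 : weight L₁ L₂ k * (weight L₁ L₂ k ^ (-(1 / 2) : ℝ)) ^ 2 = 1 := by
        rw [← Real.rpow_natCast, ← Real.rpow_mul hw.le]
        nth_rewrite 1 [← Real.rpow_one (weight L₁ L₂ k)]
        rw [← Real.rpow_add hw]
        norm_num
      have e2 : weight L₁ L₂ k * (weight L₁ L₂ k ^ (-(7 / 8) : ℝ)) ^ 2 =
          weight L₁ L₂ k ^ (-(3 / 4) : ℝ) := by
        rw [← Real.rpow_natCast, ← Real.rpow_mul hw.le]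
        nth_rewrite 1 [← Real.rpow_one (weight L₁ L₂ k)]
        rw [← Real.rpow_add hw]
        norm_num
      set p := P * weight L₁ L₂ k ^ (-(1 / 2) : ℝ) * ‖coef L₁ L₂ k u₀‖ with hp
      set q := Q * weight L₁ L₂ k ^ (-(7 / 8) : ℝ) with hq
      calc weight L₁ L₂ k * (p + q) ^ 2 ≤ weight L₁ L₂ k * (2 * (p ^ 2 + q ^ 2)) :=
            mul_le_mul_of_nonneg_left add_sq_le hw.le
        _ = 2 * P ^ 2 * ‖coef L₁ L₂ k u₀‖ ^ 2 *
              (weight L₁ L₂ k * (weight L₁ L₂ k ^ (-(1 / 2) : ℝ)) ^ 2) +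
            2 * Q ^ 2 * (weight L₁ L₂ k * (weight L₁ L₂ k ^ (-(7 / 8) : ℝ)) ^ 2) := by
            rw [hp, hq]; ring
        _ = _ := by rw [e1, e2, mul_one]
  · have hw := weight_pos (L₁ := L₁) (L₂ := L₂) k
    have hts : 0 < t - s := by linarith [ht.1]
    rw [h.duh t ⟨by linarith [ht.1], ht.2⟩, flowCoeff]
    refine (norm_add_le _ _).trans (add_le_add ?_ ?_)
    · rw [norm_mul, Complex.norm_real, Real.norm_of_nonneg (Real.exp_pos _).le]
      refine mul_le_mul_of_nonneg_right ?_ (norm_nonneg _)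
      refine (exp_neg_mul_symb_le ha hts (by norm_num) (by norm_num : (1 / 2 : ℝ) ≤ 1) k).trans ?_
      refine mul_le_mul_of_nonneg_right ?_ (by positivity)
      refine mul_le_mul ?_ ?_ (by positivity) (by positivity)
      · exact mul_le_mul_of_nonneg_left (Real.exp_le_exp.2 (by linarith [ht.2])) (by norm_num)
      · exact Real.rpow_le_rpow_of_nonpos hy (by linarith [ht.1]) (by norm_num)
    · refine (norm_duhamel_le_weight ha hb hM hG (α := 7 / 8) ⟨by linarith [ht.1], ht.2⟩
        (by norm_num) (by norm_num) k).trans ?_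
      refine mul_le_mul_of_nonneg_right ?_ (by positivity)
      have : (0 : ℝ) ≤ 12 / (1 - 7 / 8) := by norm_num
      refine mul_le_mul ?_ ?_ (by positivity) (by positivity)
      · exact mul_le_mul_of_nonneg_left (Real.exp_le_exp.2 (by linarith [ht.2])) (by positivity)
      · exact Real.rpow_le_rpow_of_nonpos hy (by linarith [ht.1]) (by norm_num)

lemma Sol.exists_force_bound (ha : a ∈ Icc (0 : ℝ) 1) (hb : IsField b V)
    (h : Sol a b s T u₀ u G) {s' : ℝ} (hs : s < s') :
    ∃ D, 0 ≤ D ∧ ∀ t ∈ Icc s' T, ∀ k, ‖force a (b t) (G t) k‖ ≤ D := by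
  rcases lt_or_ge T s' with hT | hT
  · exact ⟨0, le_rfl, fun t ht => absurd (ht.1.trans ht.2) (not_le.2 hT)⟩
  obtain ⟨M, hM, hG⟩ := h.adm
  have hA := area_pos L₁ L₂
  have hV := hb.nonneg
  have hy : 0 < s' - s := sub_pos.2 hs
  have hTs : 0 ≤ T - s := by linarith
  refine ⟨2 / (L₁ * L₂) * ((V * (1 + (T - s)) + 2 * M) * M) * (s' - s) ^ (-(1 / 2) : ℝ),
    by positivity, fun t ht k => ?_⟩
  refine (hG.norm_force_le ha hb hM ⟨by linarith [ht.1], ht.2⟩ k).trans ?_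
  refine mul_le_mul_of_nonneg_left ?_ (by positivity)
  exact Real.rpow_le_rpow_of_nonpos hy (by linarith [ht.1]) (by norm_num)

/-- The field is only measurable in time, so each coefficient solves its equation almost everywhere
and absolute continuity replaces differentiability. -/
lemma Sol.hasACDeriv (ha : a ∈ Icc (0 : ℝ) 1) (hb : IsField b V) (h : Sol a b s T u₀ u G)
    (hsT : s ≤ T) (k : ℤ × ℤ) : HasACDeriv (fun t => coef L₁ L₂ k (u t))
      (fun t => -(symb L₁ L₂ a k : ℂ) * coef L₁ L₂ k (u t) + force a (b t) (G t) k) s T := by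
  obtain ⟨M, hM, hG⟩ := h.adm
  have h1 := hasACDeriv_exp_mul ((Real.exp (s * symb L₁ L₂ a k) : ℂ) * coef L₁ L₂ k u₀)
    (hG.intervalIntegrable_exp_mul ha hb hM hsT k)
  have e : ∀ t ∈ uIcc s T, (Real.exp (-t * symb L₁ L₂ a k) : ℂ) *
      ((Real.exp (s * symb L₁ L₂ a k) : ℂ) * coef L₁ L₂ k u₀ +
        ∫ τ in s..t, (Real.exp (τ * symb L₁ L₂ a k) : ℂ) * force a (b τ) (G τ) k) =
      coef L₁ L₂ k (u t) := fun t ht => by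
    rw [uIcc_of_le hsT] at ht
    rw [h.duh t ht, flowCoeff, duhamel_eq_exp_mul, mul_add, ← mul_assoc, ← Complex.ofReal_mul,
      ← Real.exp_add]
    congr 4
    ring
  refine (h1.congr e).congr_deriv fun t ht => ?_
  rw [e t ht]

lemma Sol.hasACDeriv_fluct (ha : a ∈ Icc (0 : ℝ) 1) (hb : IsField b V) (h : Sol a b s T u₀ u G)
    (h' : Sol 0 b s T f₀ f H) (hsT : s ≤ T) (k : ℤ × ℤ) :
    HasACDeriv (fun t => fluct (u t - f t) k)
      (fun t => rate a (b t) (u t) (G t) (u t - f t) (G t - H t) k) s T := by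
  by_cases hk : k = 0
  · subst hk
    refine ((hasACDeriv_zero s T).congr fun t _ => ?_).congr_deriv fun t _ => ?_
    · rw [fluct_zero]
    · rw [rate, if_pos rfl]
  · refine (((h.hasACDeriv ha hb hsT k).sub (h'.hasACDeriv ⟨le_rfl, zero_le_one⟩ hb hsT k)).congr
      fun t _ => ?_).congr_deriv fun t _ => ?_
    · rw [fluct_apply, if_neg hk, map_sub]
    · rw [rate_sub, if_neg hk]

lemma Sol.isH2 (ha : a ∈ Icc (0 : ℝ) 1) (hb : IsField b V) (h : Sol a b s T u₀ u G) {t : ℝ}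
    (ht : t ∈ Ioc s T) : IsH2 L₁ L₂ (fluct (u t)) := by
  obtain ⟨m, hm, hle⟩ := h.exists_h2_bound ha hb ht.1
  exact isH2_of_le hm fun k => (norm_fluct_le _ k).trans (hle t ⟨le_rfl, ht.2⟩ k)

lemma isH2_sub {x y z : ℤ × ℤ → ℂ} (hx : IsH2 L₁ L₂ x) (hy : IsH2 L₁ L₂ y)
    (h : ∀ k, z k = x k - y k) : IsH2 L₁ L₂ z := by
  refine Summable.of_nonneg_of_le (fun k => ?_) (fun k => ?_) ((hx.mul_left 2).add (hy.mul_left 2))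
  · have := weight_pos (L₁ := L₁) (L₂ := L₂) k
    positivity
  · have hw := weight_pos (L₁ := L₁) (L₂ := L₂) k
    have h1 : ‖z k‖ ^ 2 ≤ 2 * (‖x k‖ ^ 2 + ‖y k‖ ^ 2) := by
      rw [h k]
      exact (pow_le_pow_left₀ (norm_nonneg _) (norm_sub_le _ _) 2).trans add_sq_le
    have h2 := mul_le_mul_of_nonneg_left h1 hw.le
    linarith

/-- The energy identity for the difference of a solution and a solution of the
advection-hyperdiffusion equation. -/
lemma Sol.energy (ha : a ∈ Icc (0 : ℝ) 1) (hb : IsField b V) (h : Sol a b s T u₀ u G)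
    (h' : Sol 0 b s T f₀ f H) : ∃ E : ℝ → ℝ,
      (∀ s' t, s < s' → s' ≤ t → t ≤ T → IntervalIntegrable E volume s' t ∧
        ∫ τ in s'..t, E τ = sqSum (fluct (u t - f t)) - sqSum (fluct (u s' - f s'))) ∧
      ∀ τ ∈ Ioc s T, IsH2 L₁ L₂ (fluct (u τ)) ∧ IsH2 L₁ L₂ (fluct (u τ - f τ)) ∧
        E τ ≤ -2 * lapSum L₁ L₂ (fluct (u τ - f τ)) +
        2 * a * ∑' k, freqSq L₁ L₂ k * (‖fluct (u τ - f τ) k‖ * ‖fluct (u τ) k‖) +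
        a * gradSum L₁ L₂ (fluct (u τ)) * ∑' k, ‖fluct (u τ - f τ) k‖ := by
  have h0 : (0 : ℝ) ∈ Icc (0 : ℝ) 1 := ⟨le_rfl, zero_le_one⟩
  have hgrad : ∀ τ ∈ Ioc s T, IsGrad (u τ - f τ) (G τ - H τ) := fun τ hτ j k => by
    rw [Pi.sub_apply, map_sub, map_sub, h.grad τ hτ, h'.grad τ hτ]
    ring
  have key : ∀ τ, ∃ E, τ ∈ Ioc s T → HasSum (fun k => 2 * ((starRingEnd ℂ) (fluct (u τ - f τ) k) *
      rate a (b τ) (u τ) (G τ) (u τ - f τ) (G τ - H τ) k).re) E ∧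
      (IsH2 L₁ L₂ (fluct (u τ)) ∧ IsH2 L₁ L₂ (fluct (u τ - f τ)) ∧
      E ≤ -2 * lapSum L₁ L₂ (fluct (u τ - f τ)) +
        2 * a * ∑' k, freqSq L₁ L₂ k * (‖fluct (u τ - f τ) k‖ * ‖fluct (u τ) k‖) +
        a * gradSum L₁ L₂ (fluct (u τ)) * ∑' k, ‖fluct (u τ - f τ) k‖) := fun τ => by
    by_cases hτ : τ ∈ Ioc s T
    · have i1 := h.isH2 ha hb hτ
      have i2 := isH2_sub i1 (h'.isH2 h0 hb hτ) (fluct_sub (u τ) (f τ))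
      obtain ⟨E, hE, hle⟩ := hasSum_rate ha (hb.sol τ) (hgrad τ hτ) (h.grad τ hτ) i2 i1
      exact ⟨E, fun _ => ⟨hE, i1, i2, hle⟩⟩
    · exact ⟨0, fun hc => absurd hc hτ⟩
  choose E hE using key
  refine ⟨E, fun s' t hs hst ht => ?_, fun τ hτ => (hE τ hτ).2⟩
  obtain ⟨m₁, hm₁, hle₁⟩ := h.exists_h2_bound ha hb hs
  obtain ⟨m₂, hm₂, hle₂⟩ := h'.exists_h2_bound h0 hb hs
  obtain ⟨D₁, hD₁, hf₁⟩ := h.exists_force_bound ha hb hs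
  obtain ⟨D₂, hD₂, hf₂⟩ := h'.exists_force_bound h0 hb hs
  have hr := (h.restart ha hb hs.le).mono ht
  have hr' := (h'.restart h0 hb hs.le).mono ht
  have hm : Summable fun k => weight L₁ L₂ k * (m₁ k + m₂ k) ^ 2 := by
    refine Summable.of_nonneg_of_le (fun k => ?_) (fun k => ?_)
      ((hm₁.mul_left 2).add (hm₂.mul_left 2))
    · have := weight_pos (L₁ := L₁) (L₂ := L₂) k
      positivity
    · have hw := weight_pos (L₁ := L₁) (L₂ := L₂) k
      have := mul_le_mul_of_nonneg_left (add_sq_le : (m₁ k + m₂ k) ^ 2 ≤ _) hw.le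
      linarith
  have hm0 : ∀ k, 0 ≤ m₁ k + m₂ k := fun k =>
    add_nonneg ((norm_nonneg _).trans (hle₁ t ⟨hst, ht⟩ k))
      ((norm_nonneg _).trans (hle₂ t ⟨hst, ht⟩ k))
  -- An H² majorant is absolutely summable, by the same weighted inequality as for H² coefficients.
  have hms : Summable fun k => m₁ k + m₂ k := by
    have hH : IsH2 L₁ L₂ fun k => ((m₁ k + m₂ k : ℝ) : ℂ) := isH2_of_le hm fun k => by
      rw [Complex.norm_real, Real.norm_of_nonneg (hm0 k)]
    refine hH.summable_norm.congr fun k => ?_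
    rw [Complex.norm_real, Real.norm_of_nonneg (hm0 k)]
  -- The dominating sequence is the product of the H² majorant m = m₁ + m₂ with the bound 2wm + D₁ +
  -- D₂ for the rate.
  refine integral_energy hst (fun k => hr.hasACDeriv_fluct ha hb hr' hst k)
    (Q := fun k => 2 * (weight L₁ L₂ k * (m₁ k + m₂ k) ^ 2) + (D₁ + D₂) * (m₁ k + m₂ k))
    ((hm.mul_left 2).add (hms.mul_left _)) (fun τ hτ k => ?_)
    (fun τ hτ => (hE τ ⟨hs.trans_le hτ.1, hτ.2.trans ht⟩).1) (summable_fluct_sq _)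
    (summable_fluct_sq _)
  have hτ' : τ ∈ Icc s' T := ⟨hτ.1, hτ.2.trans ht⟩
  have hw := weight_pos (L₁ := L₁) (L₂ := L₂) k
  have b1 := hle₁ τ hτ' k
  have b2 := hle₂ τ hτ' k
  have c1 : ‖fluct (u τ - f τ) k‖ ≤ m₁ k + m₂ k := by
    rw [fluct_sub]
    exact (norm_sub_le _ _).trans (add_le_add ((norm_fluct_le _ k).trans b1)
      ((norm_fluct_le _ k).trans b2))
  have c2 : ‖rate a (b τ) (u τ) (G τ) (u τ - f τ) (G τ - H τ) k‖ ≤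
      2 * weight L₁ L₂ k * (m₁ k + m₂ k) + (D₁ + D₂) := by
    rw [rate_sub]
    split_ifs with hk
    · rw [norm_zero]
      have := hm0 k
      positivity
    · have d : ∀ {a' : ℝ} (x : ℂ) {m' : ℝ}, a' ∈ Icc (0 : ℝ) 1 → ‖x‖ ≤ m' →
          ‖-(symb L₁ L₂ a' k : ℂ) * x‖ ≤ 2 * weight L₁ L₂ k * m' := fun x m' ha' hx => by
        rw [norm_mul, norm_neg, Complex.norm_real, Real.norm_eq_abs]
        exact mul_le_mul (abs_symb_le ha' k) hx (norm_nonneg _) (by positivity)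
      have e1 := norm_add_le (-(symb L₁ L₂ a k : ℂ) * coef L₁ L₂ k (u τ)) (force a (b τ) (G τ) k)
      have e2 := norm_add_le (-(symb L₁ L₂ 0 k : ℂ) * coef L₁ L₂ k (f τ)) (force 0 (b τ) (H τ) k)
      refine (norm_sub_le _ _).trans ?_
      have := d _ ha b1
      have := d _ h0 b2
      have := hf₁ τ hτ' k
      have := hf₂ τ hτ' k
      linarith
  calc _ ≤ (m₁ k + m₂ k) * (2 * weight L₁ L₂ k * (m₁ k + m₂ k) + (D₁ + D₂)) :=
        mul_le_mul c1 c2 (norm_nonneg _) (hm0 k)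
    _ = _ := by ring

/-- Written this way, the energy is visibly continuous on L². -/
lemma sqSum_fluct_eq (w : L2 L₁ L₂) :
    sqSum (fluct w) = ‖w‖ ^ 2 / (L₁ * L₂) - ‖coef L₁ L₂ 0 w‖ ^ 2 := by
  have h := norm_sq_le_meanFree w
  have hA := area_pos L₁ L₂
  rw [norm_meanFree_sq_eq] at h
  rw [h, ← mul_add, mul_div_cancel_left₀ _ hA.ne']
  ring

lemma continuous_sqSum_fluct : Continuous fun w : L2 L₁ L₂ => sqSum (fluct w) := by
  simp only [sqSum_fluct_eq]
  fun_prop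

/-- Away from the initial time the H² majorant gives uniform convergence of the series. -/
lemma Sol.continuousOn_lapSum (ha : a ∈ Icc (0 : ℝ) 1) (hb : IsField b V)
    (h : Sol a b s T u₀ u G) {s' : ℝ} (hs : s < s') :
    ContinuousOn (fun t => lapSum L₁ L₂ (fluct (u t))) (Icc s' T) := by
  obtain ⟨m, hm, hle⟩ := h.exists_h2_bound ha hb hs
  have hu := (h.continuousOn ha hb).mono (Icc_subset_Icc_left hs.le)
  refine continuousOn_tsum (fun k => ?_) hm fun k t ht => ?_
  · simp only [fluct_apply]
    split_ifs
    · simp only [norm_zero]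
      exact continuousOn_const
    · exact continuousOn_const.mul
        (((coef L₁ L₂ k).continuous.comp_continuousOn hu).norm.pow 2)
  · have hw := weight_pos (L₁ := L₁) (L₂ := L₂) k
    rw [Real.norm_of_nonneg (by positivity)]
    have h1 := (norm_fluct_le (u t) k).trans (hle t ht k)
    have h2 := freqSq_sq_le_weight (L₁ := L₁) (L₂ := L₂) k
    gcongr

end

/-! ### Energy inequalities -/

/-- The energy inequality on `[t₀, T]`, for the energy `N` and the dissipation `D`. -/
structure EnergyIneq (c t₀ T : ℝ) (N D : ℝ → ℝ) : Prop where
  contN : ContinuousOn N (Icc t₀ T)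
  nonneg : ∀ t, 0 ≤ N t
  nonnegD : ∀ t, 0 ≤ D t
  contD : ∀ s, t₀ < s → ContinuousOn D (Icc s T)
  ineq : ∀ s t, t₀ < s → s ≤ t → t ≤ T →
    N t + ∫ τ in s..t, D τ ≤ N s + c * ∫ τ in s..t, (N τ + N τ ^ 3)

/-- Carries inequalities known only for s > t₀, where solutions are smooth enough, to the initial
time. -/
lemma le_of_tendsto_right {f : ℝ → ℝ} {t₀ t m A : ℝ} (ht : t₀ < t) (hf : ContinuousOn f (Icc t₀ t))
    (h : ∀ s ∈ Ioc t₀ t, m ≤ f s + A) : m ≤ f t₀ + A := by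
  have h1 : Filter.Tendsto f (nhdsWithin t₀ (Ioc t₀ t)) (nhds (f t₀)) :=
    ((hf t₀ ⟨le_rfl, ht.le⟩).mono Ioc_subset_Icc_self)
  have : (nhdsWithin t₀ (Ioc t₀ t)).NeBot := by
    rw [nhdsWithin_Ioc_eq_nhdsGT ht]
    infer_instance
  exact ge_of_tendsto (h1.add_const A) (by filter_upwards [self_mem_nhdsWithin] with s hs using h s hs)

section

variable {c t₀ T : ℝ} {N D : ℝ → ℝ}

lemma EnergyIneq.intervalIntegrable (h : EnergyIneq c t₀ T N D) {s t : ℝ} (hs : t₀ < s)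
    (hst : s ≤ t) (ht : t ≤ T) : IntervalIntegrable D volume s t := by
  refine ContinuousOn.intervalIntegrable ?_
  rw [uIcc_of_le hst]
  exact (h.contD s hs).mono (Icc_subset_Icc_right ht)

lemma EnergyIneq.integral_mono (h : EnergyIneq c t₀ T N D) {s' s t : ℝ} (hs' : t₀ < s')
    (hs : s' ≤ s) (hst : s ≤ t) (ht : t ≤ T) : ∫ τ in s..t, D τ ≤ ∫ τ in s'..t, D τ := by
  rw [← intervalIntegral.integral_add_adjacent_intervals
    (h.intervalIntegrable hs' hs (hst.trans ht))
    (h.intervalIntegrable (hs'.trans_le hs) hst ht)]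
  linarith [intervalIntegral.integral_nonneg (μ := volume) hs fun τ _ => h.nonnegD τ]

/-- The energy inequality is used from s' near t₀, and s' → t₀ by continuity of N. The dissipation
is integrated from s > t₀ only, as its integrability near t₀ is not assumed. -/
lemma EnergyIneq.bound_of_le (hc : 0 ≤ c) (h : EnergyIneq c t₀ T N D) {m s t : ℝ} (hs : t₀ < s)
    (hst : s ≤ t) (ht : t ≤ T) (hle : ∀ τ ∈ Ioo t₀ t, N τ ≤ m) :
    N t + ∫ τ in s..t, D τ ≤ N t₀ + c * ((t - t₀) * (m + m ^ 3)) := by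
  refine le_of_tendsto_right hs (h.contN.mono (Icc_subset_Icc_right (hst.trans ht)))
    fun s' hs' => ?_
  have h1 := h.ineq s' t hs'.1 (hs'.2.trans hst) ht
  have h2 := h.integral_mono hs'.1 hs'.2 hst ht
  rcases (hs'.2.trans hst).eq_or_lt with heq | hlt
  · have e1 : s' = s := le_antisymm hs'.2 (hst.trans heq.symm.le)
    subst e1
    subst heq
    simp only [intervalIntegral.integral_same, mul_zero, add_zero] at h1 ⊢
    have hm : 0 ≤ m :=
      (h.nonneg _).trans (hle ((t₀ + s') / 2) ⟨by linarith, by linarith⟩)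
    have : 0 ≤ c * ((s' - t₀) * (m + m ^ 3)) := by
      have : 0 ≤ s' - t₀ := by linarith
      positivity
    linarith
  have hm : 0 ≤ m :=
    (h.nonneg _).trans (hle ((s' + t) / 2) ⟨by linarith [hs'.1], by linarith⟩)
  have h3 : ∫ τ in s'..t, (N τ + N τ ^ 3) ≤ ∫ τ in s'..t, (m + m ^ 3) := by
    have hN : ContinuousOn N (Icc s' t) := h.contN.mono (Icc_subset_Icc hs'.1.le ht)
    refine intervalIntegral.integral_mono_on_of_le_Ioo (hs'.2.trans hst) ?_
      intervalIntegrable_const fun τ hτ => ?_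
    · refine ContinuousOn.intervalIntegrable ?_
      rw [uIcc_of_le (hs'.2.trans hst)]
      exact hN.add (hN.pow 3)
    · have h4 := hle τ ⟨hs'.1.trans hτ.1, hτ.2⟩
      have h5 := h.nonneg τ
      gcongr
  rw [intervalIntegral.integral_const, smul_eq_mul] at h3
  have h4 : (t - s') * (m + m ^ 3) ≤ (t - t₀) * (m + m ^ 3) :=
    mul_le_mul_of_nonneg_right (by linarith [hs'.1]) (by positivity)
  have h5 := mul_le_mul_of_nonneg_left (h3.trans h4) hc
  linarith

/-- At the first time when N reaches 4β² the energy inequality gives N ≤ β² + cτ(4β² + 64β⁶), which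
is below β² + 3β². -/
lemma EnergyIneq.bootstrap (hc : 0 ≤ c) (h : EnergyIneq c t₀ T N D) {β τ : ℝ} (hβ : 0 < β)
    (hT : T ≤ t₀ + τ) (h0 : N t₀ ≤ β ^ 2) (hτ : c * (τ * (4 + 64 * β ^ 4)) < 3) :
    ∀ t ∈ Icc t₀ T, N t ≤ 4 * β ^ 2 := by
  by_contra! hcon
  obtain ⟨t', ht', hN'⟩ := hcon
  have hβ2 : 0 < β ^ 2 := by positivity
  set Z := {t | t ∈ Icc t₀ T ∧ 4 * β ^ 2 ≤ N t} with hZ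
  have hclosed : IsCompact Z := by
    have : Z = Icc t₀ T ∩ N ⁻¹' Ici (4 * β ^ 2) := rfl
    rw [this]
    exact isCompact_Icc.of_isClosed_subset
      (h.contN.preimage_isClosed_of_isClosed isClosed_Icc isClosed_Ici) inter_subset_left
  obtain ⟨t, ⟨ht, hNt⟩, hmin⟩ := hclosed.exists_isLeast ⟨t', ht', hN'.le⟩
  have ht0 : t₀ < t := by
    refine ht.1.lt_of_ne fun e => ?_
    rw [← e] at hNt
    linarith
  have hle : ∀ σ ∈ Ioo t₀ t, N σ ≤ 4 * β ^ 2 := fun σ hσ => by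
    by_contra! hc'
    exact absurd (hmin ⟨⟨hσ.1.le, hσ.2.le.trans ht.2⟩, hc'.le⟩) (not_le.2 hσ.2)
  have h1 := h.bound_of_le hc ht0 le_rfl ht.2 hle
  rw [intervalIntegral.integral_same, add_zero] at h1
  have h2 : c * ((t - t₀) * (4 * β ^ 2 + (4 * β ^ 2) ^ 3)) ≤
      c * (τ * (4 + 64 * β ^ 4)) * β ^ 2 := by
    have : (4 * β ^ 2 + (4 * β ^ 2) ^ 3) = (4 + 64 * β ^ 4) * β ^ 2 := by ring
    rw [this, ← mul_assoc (t - t₀), ← mul_assoc c]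
    have : t - t₀ ≤ τ := by linarith [ht.2]
    gcongr
  have h3 := mul_lt_mul_of_pos_right hτ hβ2
  linarith

lemma EnergyIneq.dissipation_le (hc : 0 ≤ c) (h : EnergyIneq c t₀ T N D) {β τ : ℝ} (hβ : 0 < β)
    (hT : T ≤ t₀ + τ) (h0 : N t₀ ≤ β ^ 2) (hτ : c * (τ * (4 + 64 * β ^ 4)) < 3) {s t : ℝ}
    (hs : t₀ < s) (hst : s ≤ t) (ht : t ≤ T) :
    N t + ∫ τ in s..t, D τ ≤ β ^ 2 + c * (τ * (4 + 64 * β ^ 4)) * β ^ 2 := by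
  have hb := h.bootstrap hc hβ hT h0 hτ
  have h1 := h.bound_of_le hc hs hst ht fun σ hσ => hb σ ⟨hσ.1.le, hσ.2.le.trans ht⟩
  have h2 : c * ((t - t₀) * (4 * β ^ 2 + (4 * β ^ 2) ^ 3)) ≤
      c * (τ * (4 + 64 * β ^ 4)) * β ^ 2 := by
    have : (4 * β ^ 2 + (4 * β ^ 2) ^ 3) = (4 + 64 * β ^ 4) * β ^ 2 := by ring
    rw [this, ← mul_assoc (t - t₀), ← mul_assoc c]
    have : t - t₀ ≤ τ := by linarith
    gcongr
  linarith

end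

/-! ### Energy and difference inequalities for solutions. -/

/-- Young's inequality in root-free form: products X³Y or XY³ are compared with terms of the
binomial expansion of (X + Y)⁴. -/
lemma le_add_of_pow_four_le {p X Y : ℝ} (hX : 0 ≤ X) (hY : 0 ≤ Y)
    (h : p ^ 4 ≤ (X + Y) ^ 4) : p ≤ X + Y :=
  le_of_pow_le_pow_left₀ (by norm_num) (by positivity) h

/-- Taking f = 0 turns the identity for the difference into the energy identity of one solution. -/
lemma sol_zero (b : ℝ → Fin 2 → L2 L₁ L₂) (a s T : ℝ) :
    Sol a b s T 0 (fun _ => 0) (fun _ => 0) := by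
  refine ⟨fun t _ j k => by simp, ⟨0, le_rfl, isAdmissible_zero le_rfl⟩, fun t _ k => ?_⟩
  simp [flowCoeff, duhamel_zero]

section

variable {V s T : ℝ} {b G H : ℝ → Fin 2 → L2 L₁ L₂} {u₀ f₀ : L2 L₁ L₂} {u f : ℝ → L2 L₁ L₂}

variable (L₁ L₂) in
-- Of the dissipation 2D, half of one D absorbs the destabilizing term and another half the
-- quadratic term, which interpolation and Agmon's inequality bound by a constant times (ND)^{3/4}.
-- One D remains.
lemma exists_energyIneq : ∃ c : ℝ, 0 < c ∧ ∀ (b : ℝ → Fin 2 → L2 L₁ L₂) (V : ℝ) (_ : IsField b V)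
    (s T : ℝ) (u₀ : L2 L₁ L₂) (u : ℝ → L2 L₁ L₂) (G : ℝ → Fin 2 → L2 L₁ L₂),
    Sol 1 b s T u₀ u G →
    EnergyIneq c s T (fun t => sqSum (fluct (u t))) (fun t => lapSum L₁ L₂ (fluct (u t))) := by
  obtain ⟨κ, hκ, hag⟩ := exists_agmon L₁ L₂
  refine ⟨2 + 8 * κ, by positivity, fun b V hb s T u₀ u G h => ?_⟩
  have h1 : (1 : ℝ) ∈ Icc (0 : ℝ) 1 := ⟨zero_le_one, le_rfl⟩
  have hcN := continuous_sqSum_fluct.comp_continuousOn (h.continuousOn h1 hb)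
  refine ⟨hcN, fun t => sqSum_nonneg _, fun t => lapSum_nonneg _,
    fun s' hs' => h.continuousOn_lapSum h1 hb hs', fun s' t hs hst ht => ?_⟩
  obtain ⟨E, hE, hle⟩ := h.energy h1 hb (sol_zero b 0 s T)
  obtain ⟨hEi, hEe⟩ := hE s' t hs hst ht
  simp only [sub_zero] at hEe hle
  have hD : IntervalIntegrable (fun τ => lapSum L₁ L₂ (fluct (u τ))) volume s' t := by
    refine ContinuousOn.intervalIntegrable ?_
    rw [uIcc_of_le hst]
    exact (h.continuousOn_lapSum h1 hb hs).mono (Icc_subset_Icc_right ht)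
  have hN : IntervalIntegrable (fun τ => sqSum (fluct (u τ)) + sqSum (fluct (u τ)) ^ 3)
      volume s' t := by
    refine ContinuousOn.intervalIntegrable ?_
    rw [uIcc_of_le hst]
    have := hcN.mono (Icc_subset_Icc hs.le ht)
    exact this.add (this.pow 3)
  have hmono := intervalIntegral.integral_mono_on hst hEi
    ((hN.const_mul (2 + 8 * κ)).sub hD) fun τ hτ => by
      obtain ⟨i1, -, hEle⟩ := hle τ ⟨hs.trans_le hτ.1, hτ.2.trans ht⟩
      set N := sqSum (fluct (u τ)) with hNdef
      set D := lapSum L₁ L₂ (fluct (u τ)) with hDdef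
      set R := ∑' k, freqSq L₁ L₂ k * (‖fluct (u τ) k‖ * ‖fluct (u τ) k‖)
      set g := gradSum L₁ L₂ (fluct (u τ))
      set S := ∑' k, ‖fluct (u τ) k‖
      have hN0 : 0 ≤ N := sqSum_nonneg _
      have hD0 : 0 ≤ D := lapSum_nonneg _
      have hR : R ^ 2 ≤ N * D := mixed_sq_le i1 i1
      have hg : g ^ 2 ≤ N * D := gradSum_sq_le i1
      have hS : S ^ 4 ≤ κ * (N * D) := hag _ i1 (fluct_zero _)
      have e1 : R ≤ D / 4 + N := by
        refine le_of_pow_le_pow_left₀ two_ne_zero (by positivity) ?_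
        nlinarith [sq_nonneg (D / 4 - N)]
      -- Young with exponents 4/3 and 4; the factor 8 compensates (1/2)³.
      have e2 : g * S ≤ D / 2 + 8 * κ * N ^ 3 := by
        refine le_add_of_pow_four_le (by positivity) (by positivity) ?_
        calc (g * S) ^ 4 = (g ^ 2) ^ 2 * S ^ 4 := by ring
          _ ≤ (N * D) ^ 2 * (κ * (N * D)) := by gcongr
          _ = (D / 2) ^ 3 * (8 * κ * N ^ 3) := by ring
          _ ≤ (D / 2) ^ 4 + 4 * (D / 2) ^ 3 * (8 * κ * N ^ 3) +
              6 * (D / 2) ^ 2 * (8 * κ * N ^ 3) ^ 2 + 4 * (D / 2) * (8 * κ * N ^ 3) ^ 3 +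
              (8 * κ * N ^ 3) ^ 4 := by
              have p1 : 0 ≤ (D / 2) ^ 4 := by positivity
              have p2 : 0 ≤ (D / 2) ^ 3 * (8 * κ * N ^ 3) := by positivity
              have p3 : 0 ≤ (D / 2) ^ 2 * (8 * κ * N ^ 3) ^ 2 := by positivity
              have p4 : 0 ≤ (D / 2) * (8 * κ * N ^ 3) ^ 3 := by positivity
              have p5 : 0 ≤ (8 * κ * N ^ 3) ^ 4 := by positivity
              linarith
          _ = _ := by ring
      have e3 : 0 ≤ κ * N := by positivity
      have e4 : 0 ≤ N ^ 3 := by positivity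
      show E τ ≤ (2 + 8 * κ) * (N + N ^ 3) - D
      linarith
  rw [intervalIntegral.integral_sub (hN.const_mul _) hD, intervalIntegral.integral_const_mul,
    hEe] at hmono
  linarith

/-- The energy of a solution of the advection-hyperdiffusion equation does not increase. -/
lemma Sol.energy_antitone (hb : IsField b V) (h : Sol 0 b s T u₀ u G) {t : ℝ} (ht : t ∈ Icc s T) :
    sqSum (fluct (u t)) ≤ sqSum (fluct u₀) := by
  have h0 : (0 : ℝ) ∈ Icc (0 : ℝ) 1 := ⟨le_rfl, zero_le_one⟩
  rw [← h.apply_left (ht.1.trans ht.2)]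
  rcases ht.1.eq_or_lt with rfl | hst
  · exact le_rfl
  have hcN := continuous_sqSum_fluct.comp_continuousOn (h.continuousOn h0 hb)
  obtain ⟨E, hE, hle⟩ := h.energy h0 hb (sol_zero b 0 s T)
  simp only [sub_zero] at hE hle
  rw [← add_zero (sqSum (fluct (u s)))]
  refine le_of_tendsto_right (f := fun τ => sqSum (fluct (u τ))) hst
    (hcN.mono (Icc_subset_Icc_right ht.2)) fun s' hs' => ?_
  obtain ⟨hEi, hEe⟩ := hE s' t hs'.1 hs'.2 ht.2
  have := intervalIntegral.integral_mono_on hs'.2 hEi (intervalIntegrable_const (c := (0 : ℝ)))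
    fun τ hτ => by
      obtain ⟨-, -, h3⟩ := hle τ ⟨hs'.1.trans_le hτ.1, hτ.2.trans ht.2⟩
      have := lapSum_nonneg (L₁ := L₁) (L₂ := L₂) (fluct (u τ))
      simp only [mul_zero, zero_mul, add_zero] at h3
      linarith
  simp only [intervalIntegral.integral_zero] at this
  linarith

variable (L₁ L₂) in
-- The dissipation X of the difference u - f absorbs its share X of the quadratic term. What remains
-- is controlled by the dissipation of u and the a priori size β; r balances the two parts of the
-- destabilizing term.
lemma exists_differenceIneq : ∃ c : ℝ, 0 < c ∧ ∀ (b : ℝ → Fin 2 → L2 L₁ L₂) (V : ℝ)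
    (_ : IsField b V) (s T : ℝ) (u₀ f₀ : L2 L₁ L₂) (u f : ℝ → L2 L₁ L₂)
    (G H : ℝ → Fin 2 → L2 L₁ L₂), Sol 1 b s T u₀ u G → Sol 0 b s T f₀ f H →
    ∀ β r : ℝ, 0 < β → 0 < r →
    (∀ τ ∈ Ioc s T, sqSum (fluct (u τ)) ≤ 4 * β ^ 2 ∧ sqSum (fluct (u τ - f τ)) ≤ 9 * β ^ 2) →
    ∀ s' t, s < s' → s' ≤ t → t ≤ T → sqSum (fluct (u t - f t)) ≤
      sqSum (fluct (u s' - f s')) +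
        ((r + c * β) * (∫ τ in s'..t, lapSum L₁ L₂ (fluct (u τ))) +
          (9 * β ^ 2 / r + c * β ^ 4) * (t - s')) := by
  obtain ⟨κ, hκ, hag⟩ := exists_agmon L₁ L₂
  refine ⟨144 * κ + 1, by positivity, fun b V hb s T u₀ f₀ u f G H h h' β r hβ hr hbd
    s' t hs hst ht => ?_⟩
  have h1 : (1 : ℝ) ∈ Icc (0 : ℝ) 1 := ⟨zero_le_one, le_rfl⟩
  obtain ⟨E, hE, hle⟩ := h.energy h1 hb h'
  obtain ⟨hEi, hEe⟩ := hE s' t hs hst ht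
  have hD : IntervalIntegrable (fun τ => lapSum L₁ L₂ (fluct (u τ))) volume s' t := by
    refine ContinuousOn.intervalIntegrable ?_
    rw [uIcc_of_le hst]
    exact (h.continuousOn_lapSum h1 hb hs).mono (Icc_subset_Icc_right ht)
  have hmono := intervalIntegral.integral_mono_on hst hEi
    ((hD.const_mul (r + (144 * κ + 1) * β)).add (intervalIntegrable_const
      (c := 9 * β ^ 2 / r + (144 * κ + 1) * β ^ 4))) fun τ hτ => by
      have hτ' : τ ∈ Ioc s T := ⟨hs.trans_le hτ.1, hτ.2.trans ht⟩
      obtain ⟨i1, i2, hEle⟩ := hle τ hτ'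
      obtain ⟨b1, b2⟩ := hbd τ hτ'
      set D := lapSum L₁ L₂ (fluct (u τ)) with hDdef
      set X := lapSum L₁ L₂ (fluct (u τ - f τ)) with hXdef
      set N := sqSum (fluct (u τ))
      set W := sqSum (fluct (u τ - f τ))
      set R := ∑' k, freqSq L₁ L₂ k * (‖fluct (u τ - f τ) k‖ * ‖fluct (u τ) k‖)
      set g := gradSum L₁ L₂ (fluct (u τ))
      set S := ∑' k, ‖fluct (u τ - f τ) k‖
      have hN0 : 0 ≤ N := sqSum_nonneg _
      have hW0 : 0 ≤ W := sqSum_nonneg _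
      have hD0 : 0 ≤ D := lapSum_nonneg _
      have hX0 : 0 ≤ X := lapSum_nonneg _
      have hR : R ^ 2 ≤ 9 * β ^ 2 * D := (mixed_sq_le i2 i1).trans (by gcongr)
      have hg : g ^ 2 ≤ 4 * β ^ 2 * D := (gradSum_sq_le i1).trans (by gcongr)
      have hS : S ^ 4 ≤ κ * (9 * β ^ 2 * X) := (hag _ i2 (fluct_zero _)).trans (by gcongr)
      have e1 : 2 * R ≤ r * D + 9 * β ^ 2 / r := by
        refine le_of_pow_le_pow_left₀ two_ne_zero (by positivity) ?_
        have : r * D * (9 * β ^ 2 / r) = 9 * β ^ 2 * D := by field_simp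
        nlinarith [sq_nonneg (r * D - 9 * β ^ 2 / r)]
      -- After Young the quadratic term leaves the cube root of a multiple of (βD)²β⁴, and this
      -- product is at most Y³.
      set Y := β * D + β ^ 4 with hY
      have hY0 : 0 ≤ Y := by positivity
      have e2 : g * S ≤ X + (144 * κ + 1) * Y := by
        refine le_add_of_pow_four_le (by positivity) (by positivity) ?_
        have hY3 : (β * D) ^ 2 * β ^ 4 ≤ Y ^ 3 := by
          have p1 : 0 ≤ β * D := by positivity
          have p2 : 0 ≤ β ^ 4 := by positivity
          rw [hY]
          nlinarith [mul_nonneg p1 (sq_nonneg (β ^ 4)), mul_nonneg (sq_nonneg (β * D)) p2,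
            pow_nonneg p1 3, pow_nonneg p2 3]
        -- The shift by 1 avoids a cube root in the constant.
        have hk : 144 * κ ≤ (144 * κ + 1) ^ 3 := by
          have : 0 ≤ 144 * κ := by positivity
          nlinarith [pow_nonneg this 3, sq_nonneg (144 * κ)]
        have hYk : 144 * κ * ((β * D) ^ 2 * β ^ 4) ≤ ((144 * κ + 1) * Y) ^ 3 := by
          rw [mul_pow (144 * κ + 1)]
          exact mul_le_mul hk hY3 (by positivity) (by positivity)
        set Z := (144 * κ + 1) * Y with hZ
        have hZ0 : 0 ≤ Z := by positivity
        calc (g * S) ^ 4 = (g ^ 2) ^ 2 * S ^ 4 := by ring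
          _ ≤ (4 * β ^ 2 * D) ^ 2 * (κ * (9 * β ^ 2 * X)) := by gcongr
          _ = X * (144 * κ * ((β * D) ^ 2 * β ^ 4)) := by ring
          _ ≤ X * Z ^ 3 := by gcongr
          _ ≤ X ^ 4 + 4 * X ^ 3 * Z + 6 * X ^ 2 * Z ^ 2 + 4 * (X * Z ^ 3) + Z ^ 4 := by
              have p1 : 0 ≤ X ^ 4 := by positivity
              have p2 : 0 ≤ X ^ 3 * Z := by positivity
              have p3 : 0 ≤ X ^ 2 * Z ^ 2 := by positivity
              have p4 : 0 ≤ X * Z ^ 3 := by positivity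
              have p5 : 0 ≤ Z ^ 4 := by positivity
              linarith
          _ = _ := by ring
      show E τ ≤ (r + (144 * κ + 1) * β) * D + (9 * β ^ 2 / r + (144 * κ + 1) * β ^ 4)
      rw [hY] at e2
      linarith
  rw [intervalIntegral.integral_add (hD.const_mul _) intervalIntegrable_const,
    intervalIntegral.integral_const_mul, intervalIntegral.integral_const, smul_eq_mul, hEe]
    at hmono
  linarith

/-- The change of the mean of a solution is controlled by the dissipation. -/
lemma Sol.norm_mean_sub_le (hb : IsField b V) (h : Sol 1 b s T u₀ u G) {s' t : ℝ} (hs : s < s')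
    (hst : s' ≤ t) (ht : t ≤ T) : ‖coef L₁ L₂ 0 (u t) - coef L₁ L₂ 0 (u s')‖ ≤
      ∫ τ in s'..t, (sqSum (fluct (u τ)) + lapSum L₁ L₂ (fluct (u τ))) := by
  have h1 : (1 : ℝ) ∈ Icc (0 : ℝ) 1 := ⟨zero_le_one, le_rfl⟩
  have e := (h.restart h1 hb hs.le).duh t ⟨hst, ht⟩ 0
  have hz : symb L₁ L₂ 1 0 = 0 := by simp [symb, freqSq_zero]
  rw [e]
  simp only [flowCoeff, duhamel, hz, mul_zero, Real.exp_zero, Complex.ofReal_one, one_mul,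
    add_sub_cancel_left]
  refine intervalIntegral.norm_integral_le_of_norm_le hst
    (Filter.Eventually.of_forall fun τ hτ => ?_) ?_
  · have hτ' : τ ∈ Ioc s T := ⟨hs.trans hτ.1, hτ.2.trans ht⟩
    refine (force_at_zero h1 (hb.sol τ) (h.grad τ hτ')).trans ?_
    have := gradSum_sq_le (h.isH2 h1 hb hτ')
    have hN := sqSum_nonneg (fluct (u τ))
    have hD := lapSum_nonneg (L₁ := L₁) (L₂ := L₂) (fluct (u τ))
    refine le_of_pow_le_pow_left₀ two_ne_zero (by positivity) ?_
    nlinarith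
  · refine ContinuousOn.intervalIntegrable ?_
    rw [uIcc_of_le hst]
    exact ((continuous_sqSum_fluct.comp_continuousOn (h.continuousOn h1 hb)).mono
      (Icc_subset_Icc hs.le ht)).add
      ((h.continuousOn_lapSum h1 hb hs).mono (Icc_subset_Icc_right ht))

/-- The advection-hyperdiffusion equation can be solved for all times. -/
lemma exists_sol_linear (hb : IsField b V) (s T : ℝ) (f₀ : L2 L₁ L₂) :
    ∃ f H, Sol 0 b s T f₀ f H := by
  have hA := area_pos L₁ L₂
  refine exists_sol_of_bound (R := ‖meanFree f₀‖) ⟨le_rfl, zero_le_one⟩ hb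
    (fun T' u G hsT h t ht => ?_) le_rfl T
  have := h.energy_antitone hb ht
  refine le_of_pow_le_pow_left₀ two_ne_zero (norm_nonneg _) ?_
  rw [norm_meanFree_sq_eq, norm_meanFree_sq_eq]
  gcongr

end

/-! ### Decay over one dissipation time -/

/-- Translates energies into norms, for which the triangle inequality is available. -/
lemma sqSum_fluct_le_iff {w : L2 L₁ L₂} {p : ℝ} (hp : 0 ≤ p) :
    sqSum (fluct w) ≤ p ^ 2 ↔ ‖meanFree w‖ ≤ Real.sqrt (L₁ * L₂) * p := by
  have hA := area_pos L₁ L₂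
  rw [← pow_le_pow_iff_left₀ (norm_nonneg _) (by positivity) two_ne_zero, mul_pow,
    Real.sq_sqrt hA.le, norm_meanFree_sq_eq, mul_le_mul_iff_right₀ hA]

lemma sqSum_fluct_sub_le {u f : L2 L₁ L₂} {p q : ℝ} (hp : 0 ≤ p) (hq : 0 ≤ q)
    (hu : sqSum (fluct u) ≤ p ^ 2) (hf : sqSum (fluct f) ≤ q ^ 2) :
    sqSum (fluct (u - f)) ≤ (p + q) ^ 2 := by
  rw [sqSum_fluct_le_iff hp] at hu
  rw [sqSum_fluct_le_iff hq] at hf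
  rw [sqSum_fluct_le_iff (by positivity), meanFree_sub, mul_add]
  exact (norm_sub_le _ _).trans (add_le_add hu hf)

lemma sqSum_fluct_le_of_sub {u f : L2 L₁ L₂} {p q : ℝ} (hp : 0 ≤ p) (hq : 0 ≤ q)
    (hu : sqSum (fluct (u - f)) ≤ p ^ 2) (hf : sqSum (fluct f) ≤ q ^ 2) :
    sqSum (fluct u) ≤ (p + q) ^ 2 := by
  rw [sqSum_fluct_le_iff hp, meanFree_sub] at hu
  rw [sqSum_fluct_le_iff hq] at hf
  rw [sqSum_fluct_le_iff (by positivity), mul_add]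
  have := norm_le_norm_sub_add (meanFree u) (meanFree f)
  linarith

lemma fluct_meanFree (u : L2 L₁ L₂) : fluct (meanFree u) = fluct u := by
  funext k
  rw [fluct, meanFree_meanFree, fluct]

/-- The smallness conditions, for a time `τ`, under which the energy decays over a time `τ`. -/
structure IsSmall (c c₂ μ K τ β : ℝ) : Prop where
  bootstrap : c * (τ * (4 + 64 * β ^ 4)) < 3
  gap : 2 * μ + c * (4 + 64 * β ^ 4) ≤ K
  small : 10 * (τ * Real.sqrt K) + c₂ * (τ * K * β + τ * β ^ 2) ≤ 1 / 16

/-- Makes the same τ and K usable at all later steps of the iteration, where β has decreased. -/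
lemma IsSmall.mono {c c₂ μ K τ β β' : ℝ} (h : IsSmall c c₂ μ K τ β) (hc : 0 ≤ c) (hc₂ : 0 ≤ c₂)
    (hK : 0 ≤ K) (hτ : 0 ≤ τ) (h0 : 0 ≤ β') (hβ : β' ≤ β) : IsSmall c c₂ μ K τ β' := by
  have hβ0 := h0.trans hβ
  constructor
  · refine lt_of_le_of_lt ?_ h.bootstrap
    gcongr
  · refine le_trans ?_ h.gap
    gcongr
  · refine le_trans ?_ h.small
    gcongr

/-- The solution operator of the advection-hyperdiffusion equation halves the norm over a time
`τ`. -/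
def Halves (b : ℝ → Fin 2 → L2 L₁ L₂) (τ : ℝ) : Prop :=
  ∀ s, 0 ≤ s → ∀ (f₀ : L2 L₁ L₂) (f : ℝ → L2 L₁ L₂) (H : ℝ → Fin 2 → L2 L₁ L₂),
    ∫ x, f₀ x = 0 → Sol 0 b s (s + τ) f₀ f H → ‖f (s + τ)‖ ≤ 1 / 2 * ‖f₀‖

/-- The conclusions about a solution on an interval that starts at `t₀` and is not longer than
`τ`. -/
def StepBound (b : ℝ → Fin 2 → L2 L₁ L₂) (μ τ β : ℝ) : Prop :=
  ∀ (t₀ T : ℝ) (u₀ : L2 L₁ L₂) (u : ℝ → L2 L₁ L₂) (G : ℝ → Fin 2 → L2 L₁ L₂), 0 ≤ t₀ →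
    t₀ ≤ T → T ≤ t₀ + τ → Sol 1 b t₀ T u₀ u G → sqSum (fluct u₀) ≤ β ^ 2 →
    (∀ t ∈ Icc t₀ T, sqSum (fluct (u t)) ≤ 4 * β ^ 2 ∧
      ‖coef L₁ L₂ 0 (u t) - coef L₁ L₂ 0 u₀‖ ≤ (4 * τ + 4) * β ^ 2) ∧
    (T = t₀ + τ → sqSum (fluct (u T)) ≤ max (9 / 16) (1 - 2 * μ * τ) * β ^ 2)

variable (L₁ L₂) in
-- Alternative on the dissipation over one step: if large, it outweighs the growth allowed by the
-- energy inequality; if small, the solution stays close to the linear flow, which halves the norm.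
lemma exists_stepBound : ∃ c c₂ : ℝ, 0 < c ∧ 0 < c₂ ∧ ∀ (b : ℝ → Fin 2 → L2 L₁ L₂) (V : ℝ)
    (_ : IsField b V) (μ K τ β : ℝ), 0 < K → 0 < τ → 0 < β → IsSmall c c₂ μ K τ β → Halves b τ →
    StepBound b μ τ β := by
  obtain ⟨c, hc, henergy⟩ := exists_energyIneq L₁ L₂
  obtain ⟨c₂, hc₂, hdiff⟩ := exists_differenceIneq L₁ L₂
  refine ⟨c, c₂, hc, hc₂, fun b V hb μ K τ β hK hτ hβ hsm hhalf t₀ T u₀ u G ht₀ htT hT h hu₀ => ?_⟩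
  have h1 : (1 : ℝ) ∈ Icc (0 : ℝ) 1 := ⟨zero_le_one, le_rfl⟩
  have h0 : (0 : ℝ) ∈ Icc (0 : ℝ) 1 := ⟨le_rfl, zero_le_one⟩
  have hE := henergy b V hb t₀ T u₀ u G h
  have hu := h.apply_left htT
  have hN0 : sqSum (fluct (u t₀)) ≤ β ^ 2 := by rwa [hu]
  have hboot := hE.bootstrap hc.le hβ hT hN0 hsm.bootstrap
  have hdiss := fun {s t : ℝ} (hs : t₀ < s) (hst : s ≤ t) (ht : t ≤ T) =>
    hE.dissipation_le hc.le hβ hT hN0 hsm.bootstrap hs hst ht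
  have hβ2 : 0 < β ^ 2 := by positivity
  have hcont := h.continuousOn h1 hb
  refine ⟨fun t ht => ⟨hboot t ht, ?_⟩, fun hTe => ?_⟩
  · rcases ht.1.eq_or_lt with rfl | hlt
    · rw [hu, sub_self, norm_zero]
      positivity
    have hc0 : ContinuousOn (fun s => ‖coef L₁ L₂ 0 (u s) - coef L₁ L₂ 0 u₀‖) (Icc t₀ t) :=
      (((coef L₁ L₂ 0).continuous.comp_continuousOn
        (hcont.mono (Icc_subset_Icc_right ht.2))).sub continuousOn_const).norm
    have hlim := le_of_tendsto_right (m := ‖coef L₁ L₂ 0 (u t) - coef L₁ L₂ 0 u₀‖)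
      (A := (4 * τ + 4) * β ^ 2) hlt hc0 fun s hs => by
        have e1 := h.norm_mean_sub_le hb hs.1 hs.2 ht.2
        have hNi : IntervalIntegrable (fun σ => sqSum (fluct (u σ))) volume s t := by
          refine ContinuousOn.intervalIntegrable ?_
          rw [uIcc_of_le hs.2]
          exact hE.contN.mono (Icc_subset_Icc hs.1.le ht.2)
        rw [intervalIntegral.integral_add hNi (hE.intervalIntegrable hs.1 hs.2 ht.2)] at e1
        have e2 : ∫ σ in s..t, sqSum (fluct (u σ)) ≤ (t - s) * (4 * β ^ 2) := by
          refine (intervalIntegral.integral_mono_on hs.2 hNi intervalIntegrable_const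
            fun σ hσ => hboot σ ⟨hs.1.le.trans hσ.1, hσ.2.trans ht.2⟩).trans ?_
          rw [intervalIntegral.integral_const, smul_eq_mul]
        -- The dissipation is at most β² + 3β² and the integral of N at most 4τβ², whence (4τ +
        -- 4)β².
        have e3 := hdiss hs.1 hs.2 ht.2
        have e4 := mul_lt_mul_of_pos_right hsm.bootstrap hβ2
        have e5 : (t - s) * (4 * β ^ 2) ≤ τ * (4 * β ^ 2) :=
          mul_le_mul_of_nonneg_right (by linarith [hs.1, ht.2]) (by positivity)
        have e6 := sqSum_nonneg (fluct (u t))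
        have e7 := norm_sub_le_norm_sub_add_norm_sub (coef L₁ L₂ 0 (u t)) (coef L₁ L₂ 0 (u s))
          (coef L₁ L₂ 0 u₀)
        linarith
    rwa [hu, sub_self, norm_zero, zero_add] at hlim
  · subst hTe
    -- The alternative is stated for every s > t₀ because the dissipation has not been integrated up
    -- to t₀.
    by_cases hcase : ∃ s ∈ Ioc t₀ (t₀ + τ),
        τ * K * β ^ 2 ≤ ∫ σ in s..(t₀ + τ), lapSum L₁ L₂ (fluct (u σ))
    · obtain ⟨s, hs, hle⟩ := hcase
      have e1 := hdiss hs.1 hs.2 le_rfl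
      have e2 := mul_le_mul_of_nonneg_right (mul_le_mul_of_nonneg_left hsm.gap hτ.le) hβ2.le
      have e3 := mul_le_mul_of_nonneg_right (le_max_right (9 / 16) (1 - 2 * μ * τ)) hβ2.le
      linarith
    · push Not at hcase
      -- The linear flow starts from the mean-free part of the data, so the difference has zero
      -- energy at t₀.
      obtain ⟨f, H, hf⟩ := exists_sol_linear hb t₀ (t₀ + τ) (meanFree u₀)
      have hfN : ∀ t ∈ Icc t₀ (t₀ + τ), sqSum (fluct (f t)) ≤ β ^ 2 := fun t ht => by
        have := hf.energy_antitone hb ht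
        rw [fluct_meanFree] at this
        exact this.trans hu₀
      have hfT : sqSum (fluct (f (t₀ + τ))) ≤ (β / 2) ^ 2 := by
        rw [sqSum_fluct_le_iff hβ.le] at hu₀
        rw [sqSum_fluct_le_iff (by positivity)]
        have e1 := hhalf t₀ ht₀ _ f H (integral_meanFree u₀) hf
        have e2 := norm_meanFree_le (f (t₀ + τ))
        linarith
      have hw : ∀ t ∈ Ioc t₀ (t₀ + τ), sqSum (fluct (u t)) ≤ 4 * β ^ 2 ∧
          sqSum (fluct (u t - f t)) ≤ 9 * β ^ 2 := fun t ht => by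
        have ht' := Ioc_subset_Icc_self ht
        refine ⟨hboot t ht', ?_⟩
        have := sqSum_fluct_sub_le (p := 2 * β) (by positivity) hβ.le
          ((hboot t ht').trans_eq (by ring)) (hfN t ht')
        linarith
      have hsq : 0 < Real.sqrt K := Real.sqrt_pos.2 hK
      -- The choice r = K^{-1/2} balances r · τKβ² against τ · 9β²/r; together they give the 10τ√K
      -- of `IsSmall.small`.
      have hd := hdiff b V hb t₀ (t₀ + τ) u₀ (meanFree u₀) u f G H h hf β (Real.sqrt K)⁻¹ hβ
        (by positivity) hw
      have hcw : ContinuousOn (fun t => sqSum (fluct (u t - f t))) (Icc t₀ (t₀ + τ)) :=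
        continuous_sqSum_fluct.comp_continuousOn (hcont.sub (hf.continuousOn h0 hb))
      have hlim := le_of_tendsto_right (m := sqSum (fluct (u (t₀ + τ) - f (t₀ + τ))))
        (A := (β / 4) ^ 2) (by linarith) hcw fun s hs => by
          have e1 := hd s (t₀ + τ) hs.1 hs.2 le_rfl
          have e2 := mul_le_mul_of_nonneg_left (hcase s hs).le
            (by positivity : 0 ≤ (Real.sqrt K)⁻¹ + c₂ * β)
          have e3 : (9 * β ^ 2 / (Real.sqrt K)⁻¹ + c₂ * β ^ 4) * (t₀ + τ - s) ≤
              (9 * β ^ 2 / (Real.sqrt K)⁻¹ + c₂ * β ^ 4) * τ :=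
            mul_le_mul_of_nonneg_left (by linarith [hs.1]) (by positivity)
          have e4 : ((Real.sqrt K)⁻¹ + c₂ * β) * (τ * K * β ^ 2) =
              (τ * Real.sqrt K + c₂ * (τ * K * β)) * β ^ 2 := by
            have : (Real.sqrt K)⁻¹ * K = Real.sqrt K := by
              nth_rewrite 2 [← Real.mul_self_sqrt hK.le]
              rw [inv_mul_cancel_left₀ hsq.ne']
            linear_combination τ * β ^ 2 * this
          have e5 : (9 * β ^ 2 / (Real.sqrt K)⁻¹ + c₂ * β ^ 4) * τ =
              (9 * (τ * Real.sqrt K) + c₂ * (τ * β ^ 2)) * β ^ 2 := by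
            rw [div_inv_eq_mul]
            ring
          have e6 := mul_le_mul_of_nonneg_right hsm.small hβ2.le
          linarith
      have hw0 : sqSum (fluct (u t₀ - f t₀)) = 0 := by
        rw [hu, hf.apply_left (by linarith)]
        have : fluct (u₀ - meanFree u₀) = fun _ => 0 := by
          funext k
          rw [fluct_sub, fluct_meanFree, sub_self]
        rw [this]
        simp [sqSum]
      rw [hw0, zero_add] at hlim
      -- The sum β/4 + β/2 is 3β/4, hence the factor 9/16.
      have e1 := sqSum_fluct_le_of_sub (by positivity) (by positivity) hlim hfT
      have e2 := mul_le_mul_of_nonneg_right (le_max_left (9 / 16) (1 - 2 * μ * τ)) hβ2.le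
      linarith

/-! ### Global bounds -/

/-- Each step multiplies the energy by at most Q < 1 and moves the mean by at most a multiple of the
current energy; the moves sum to a geometric series. -/
lemma sol_bound {b : ℝ → Fin 2 → L2 L₁ L₂} {V μ τ β₀ : ℝ} (hb : IsField b V) (hμ : 0 < μ)
    (hτ : 0 < τ) (hβ₀ : 0 < β₀) (hstep : ∀ β, 0 < β → β ≤ β₀ → StepBound b μ τ β) {t₀ T : ℝ}
    {u₀ : L2 L₁ L₂} {u : ℝ → L2 L₁ L₂} {G : ℝ → Fin 2 → L2 L₁ L₂} (ht₀ : 0 ≤ t₀)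
    (h : Sol 1 b t₀ T u₀ u G) (h0 : sqSum (fluct u₀) ≤ β₀ ^ 2) {t : ℝ} (ht : t ∈ Icc t₀ T) :
    sqSum (fluct (u t)) ≤ 4 * β₀ ^ 2 ∧ ‖coef L₁ L₂ 0 (u t) - coef L₁ L₂ 0 u₀‖ ≤
      (4 * τ + 4) * β₀ ^ 2 / (1 - max (9 / 16) (1 - 2 * μ * τ)) := by
  have h1 : (1 : ℝ) ∈ Icc (0 : ℝ) 1 := ⟨zero_le_one, le_rfl⟩
  set Q := max (9 / 16) (1 - 2 * μ * τ) with hQ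
  have hQ0 : 0 < Q := lt_of_lt_of_le (by norm_num) (le_max_left _ _)
  have hQ1 : Q < 1 := max_lt (by norm_num) (by linarith [mul_pos hμ hτ])
  -- The one-step bound is applied with β = Q^{n/2}β₀, also to the last, incomplete step.
  have step : ∀ (n : ℕ) (r : ℝ), t₀ + n * τ ≤ r → r ≤ t₀ + n * τ + τ → r ≤ T →
      sqSum (fluct (u (t₀ + n * τ))) ≤ Q ^ n * β₀ ^ 2 →
      sqSum (fluct (u r)) ≤ 4 * (Q ^ n * β₀ ^ 2) ∧
      ‖coef L₁ L₂ 0 (u r) - coef L₁ L₂ 0 (u (t₀ + n * τ))‖ ≤ (4 * τ + 4) * (Q ^ n * β₀ ^ 2) ∧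
      (r = t₀ + n * τ + τ → sqSum (fluct (u r)) ≤ Q * (Q ^ n * β₀ ^ 2)) := by
    intro n r hr1 hr2 hr3 hN
    have hn : 0 ≤ (n : ℝ) * τ := by positivity
    have hQn : 0 < Q ^ n := by positivity
    have e : (Real.sqrt (Q ^ n) * β₀) ^ 2 = Q ^ n * β₀ ^ 2 := by
      rw [mul_pow, Real.sq_sqrt hQn.le]
    have hle : Real.sqrt (Q ^ n) * β₀ ≤ β₀ :=
      mul_le_of_le_one_left hβ₀.le (Real.sqrt_le_one.2 (pow_le_one₀ hQ0.le hQ1.le))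
    have := hstep (Real.sqrt (Q ^ n) * β₀) (by positivity) hle (t₀ + n * τ) r _ u G (by linarith)
      hr1 hr2 ((h.restart h1 hb (by linarith)).mono hr3) (by rwa [e])
    rw [e] at this
    exact ⟨(this.1 r ⟨hr1, le_rfl⟩).1, (this.1 r ⟨hr1, le_rfl⟩).2, this.2⟩
  have iter : ∀ n : ℕ, t₀ + n * τ ≤ T → sqSum (fluct (u (t₀ + n * τ))) ≤ Q ^ n * β₀ ^ 2 ∧
      ‖coef L₁ L₂ 0 (u (t₀ + n * τ)) - coef L₁ L₂ 0 u₀‖ ≤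
        (4 * τ + 4) * β₀ ^ 2 * ∑ i ∈ Finset.range n, Q ^ i := by
    intro n
    induction n with
    | zero =>
      intro _
      simp only [Nat.cast_zero, zero_mul, add_zero, pow_zero, one_mul]
      rw [h.apply_left (ht.1.trans ht.2), sub_self, norm_zero]
      exact ⟨h0, by simp⟩
    | succ n ih =>
      intro hn
      have e : t₀ + ((n + 1 : ℕ) : ℝ) * τ = t₀ + n * τ + τ := by push_cast; ring
      rw [e] at hn ⊢
      obtain ⟨i1, i2⟩ := ih (by linarith)
      obtain ⟨-, s2, s3⟩ := step n _ (by linarith) le_rfl hn i1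
      refine ⟨(s3 rfl).trans_eq (by ring), ?_⟩
      rw [Finset.sum_range_succ, mul_add]
      have := norm_sub_le_norm_sub_add_norm_sub (coef L₁ L₂ 0 (u (t₀ + n * τ + τ)))
        (coef L₁ L₂ 0 (u (t₀ + n * τ))) (coef L₁ L₂ 0 u₀)
      linarith
  set n := ⌊(t - t₀) / τ⌋₊ with hn
  have n1 : (n : ℝ) * τ ≤ t - t₀ :=
    (le_div_iff₀ hτ).1 (Nat.floor_le (div_nonneg (by linarith [ht.1]) hτ.le))
  have n2 : t - t₀ < ((n : ℝ) + 1) * τ := (div_lt_iff₀ hτ).1 (Nat.lt_floor_add_one _)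
  obtain ⟨i1, i2⟩ := iter n (by linarith [ht.2])
  obtain ⟨s1, s2, -⟩ := step n t (by linarith) (by linarith) ht.2 i1
  have hQn : Q ^ n ≤ 1 := pow_le_one₀ hQ0.le hQ1.le
  constructor
  · have : Q ^ n * β₀ ^ 2 ≤ 1 * β₀ ^ 2 := by gcongr
    linarith
  · have e1 := norm_sub_le_norm_sub_add_norm_sub (coef L₁ L₂ 0 (u t))
        (coef L₁ L₂ 0 (u (t₀ + n * τ))) (coef L₁ L₂ 0 u₀)
    have e2 : ‖coef L₁ L₂ 0 (u t) - coef L₁ L₂ 0 u₀‖ ≤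
        (4 * τ + 4) * β₀ ^ 2 * ∑ i ∈ Finset.range (n + 1), Q ^ i := by
      rw [Finset.sum_range_succ, mul_add]
      linarith
    rw [le_div_iff₀ (by linarith)]
    calc _ ≤ (4 * τ + 4) * β₀ ^ 2 * (∑ i ∈ Finset.range (n + 1), Q ^ i) * (1 - Q) :=
          mul_le_mul_of_nonneg_right e2 (by linarith)
      _ = (4 * τ + 4) * β₀ ^ 2 * (1 - Q ^ (n + 1)) := by
          rw [mul_assoc, geom_sum_mul_neg]
      _ ≤ (4 * τ + 4) * β₀ ^ 2 * 1 := by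
          have : 0 < Q ^ (n + 1) := by positivity
          gcongr
          linarith
      _ = _ := mul_one _

/-- The smallness conditions hold for times below `2 T₁(B)`, if the constant is large. -/
lemma exists_isSmall {c c₂ A : ℝ} (hc : 0 < c) (hc₂ : 0 < c₂) (hA : 0 < A) :
    ∃ C : ℝ, 0 < C ∧ ∀ μ B τ : ℝ, 0 < μ → 0 < B → 0 < τ → τ < 2 * timeT1 C μ B →
      IsSmall c c₂ μ (2 * μ + 4 * C + 64 * C * B ^ 4) τ (B / Real.sqrt A) := by
  have hs : 0 < Real.sqrt A := Real.sqrt_pos.2 hA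
  -- The second summand serves the bootstrap and gap conditions, the third the smallness condition:
  -- 8 times a number below C, divided by 2C, is at most 1/2, so the number itself contributes at
  -- most 1/16. Division by powers of A accounts for β = B/√A.
  refine ⟨1 + c * (4 + 64 / A ^ 2) + 8 * (10 + c₂ * (1 / Real.sqrt A + 1 / A)), by positivity,
    fun μ B τ hμ hB hτ hlt => ?_⟩
  set C := 1 + c * (4 + 64 / A ^ 2) + 8 * (10 + c₂ * (1 / Real.sqrt A + 1 / A)) with hC
  have q1 : 0 < c * (4 + 64 / A ^ 2) := by positivity
  have q2 : 0 < 10 + c₂ * (1 / Real.sqrt A + 1 / A) := by positivity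
  have hC1 : 1 ≤ C := by linarith
  set K := 2 * μ + 4 * C + 64 * C * B ^ 4 with hK
  have hK1 : 1 ≤ K := by
    have : 0 ≤ 64 * C * B ^ 4 := by positivity
    linarith
  have hsK : 1 ≤ Real.sqrt K := Real.one_le_sqrt.2 hK1
  have hKB : B ^ 4 ≤ K := by
    have : 1 * B ^ 4 ≤ 64 * C * B ^ 4 := by gcongr; linarith
    linarith
  -- T₁ is exactly 1/(4C(KB + √K)), and this product controls every power of B needed below.
  have hprod : τ * (K * B + Real.sqrt K) ≤ 1 / (2 * C) := by
    have e : timeT1 C μ B = 1 / (4 * C * (K * B + Real.sqrt K)) := by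
      rw [timeT1, ← hK]
      congr 1
      ring
    rw [e] at hlt
    have hpos : 0 < K * B + Real.sqrt K := by positivity
    calc τ * (K * B + Real.sqrt K) ≤
          (2 * (1 / (4 * C * (K * B + Real.sqrt K)))) * (K * B + Real.sqrt K) := by gcongr
      _ = 1 / (2 * C) := by field_simp; ring
  have hβ2 : (B / Real.sqrt A) ^ 2 = B ^ 2 / A := by rw [div_pow, Real.sq_sqrt hA.le]
  have hβ4 : (B / Real.sqrt A) ^ 4 = B ^ 4 / A ^ 2 := by
    rw [show (B / Real.sqrt A) ^ 4 = ((B / Real.sqrt A) ^ 2) ^ 2 by ring, hβ2, div_pow]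
    ring
  have a1 : 0 ≤ τ * (K * B) := by positivity
  have a2 : 0 ≤ τ * Real.sqrt K := by positivity
  have hKB' : τ * (K * B) ≤ 1 / (2 * C) := by linarith
  have hsqK : τ * Real.sqrt K ≤ 1 / (2 * C) := by linarith
  have hτC : τ ≤ 1 / (2 * C) := (le_mul_of_one_le_right hτ.le hsK).trans hsqK
  -- For B ≤ 1 use √K ≥ 1, for B ≥ 1 use B⁴ ≤ K ≤ KB.
  have hB4 : τ * B ^ 4 ≤ 1 / (2 * C) := by
    refine le_trans ?_ hprod
    refine mul_le_mul_of_nonneg_left ?_ hτ.le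
    rcases le_total B 1 with h | h
    · have : B ^ 4 ≤ 1 := pow_le_one₀ hB.le h
      have : 0 ≤ K * B := by positivity
      linarith
    · have : B ^ 4 * 1 ≤ K * B := by gcongr
      linarith
  have hB2 : τ * B ^ 2 ≤ 1 / (2 * C) := by
    refine le_trans ?_ hsqK
    refine mul_le_mul_of_nonneg_left (Real.le_sqrt_of_sq_le ?_) hτ.le
    calc (B ^ 2) ^ 2 = B ^ 4 := by ring
      _ ≤ K := hKB
  have hhalf : ∀ x : ℝ, 0 ≤ x → x ≤ C → x * (1 / (2 * C)) ≤ 1 / 2 := fun x hx hxC => by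
    rw [mul_one_div, div_le_div_iff₀ (by positivity) two_pos]
    linarith
  constructor
  · rw [hβ4]
    have e : c * (τ * (4 + 64 * (B ^ 4 / A ^ 2))) = c * 4 * τ + c * (64 / A ^ 2) * (τ * B ^ 4) := by
      ring
    have e1 := mul_le_mul_of_nonneg_left hτC (by positivity : 0 ≤ c * 4)
    have e2 := mul_le_mul_of_nonneg_left hB4 (by positivity : 0 ≤ c * (64 / A ^ 2))
    have e3 := hhalf (c * (4 + 64 / A ^ 2)) q1.le (by linarith)
    linarith
  · rw [hβ4]
    have p1 : 0 < c * (64 / A ^ 2) := by positivity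
    have p2 : c * 4 ≤ 4 * C := by linarith [mul_comm c 4]
    have p3 : c * (64 / A ^ 2) * B ^ 4 ≤ 64 * C * B ^ 4 :=
      mul_le_mul_of_nonneg_right (by linarith) (by positivity)
    have e : c * (4 + 64 * (B ^ 4 / A ^ 2)) = c * 4 + c * (64 / A ^ 2) * B ^ 4 := by ring
    linarith
  · rw [hβ2]
    have e : 10 * (τ * Real.sqrt K) + c₂ * (τ * K * (B / Real.sqrt A) + τ * (B ^ 2 / A)) =
        10 * (τ * Real.sqrt K) + c₂ * (1 / Real.sqrt A) * (τ * (K * B)) +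
          c₂ * (1 / A) * (τ * B ^ 2) := by ring
    have e1 := mul_le_mul_of_nonneg_left hsqK (by norm_num : (0 : ℝ) ≤ 10)
    have e2 := mul_le_mul_of_nonneg_left hKB' (by positivity : 0 ≤ c₂ * (1 / Real.sqrt A))
    have e3 := mul_le_mul_of_nonneg_left hB2 (by positivity : 0 ≤ c₂ * (1 / A))
    have e4 := hhalf (8 * (10 + c₂ * (1 / Real.sqrt A + 1 / A))) (by positivity) (by linarith)
    linarith

/-! ### Halving times and global solutions. -/

lemma sol_const (a : ℝ) (b : ℝ → Fin 2 → L2 L₁ L₂) (s : ℝ) (u₀ : L2 L₁ L₂) :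
    Sol a b s s u₀ (fun _ => u₀) (fun _ => 0) := by
  refine ⟨fun t ht => absurd ht (by simp), ⟨0, le_rfl, isAdmissible_zero le_rfl⟩,
    fun t ht k => ?_⟩
  rw [Icc_self, mem_singleton_iff] at ht
  subst ht
  simp [flowCoeff, duhamel]

lemma exists_meanFree_ne_zero : ∃ f₀ : L2 L₁ L₂, ∫ x, f₀ x = 0 ∧ f₀ ≠ 0 := by
  refine ⟨meanFree (mode L₁ L₂ 1 (1, 0)), integral_meanFree _, fun h => ?_⟩
  have h1 := coef_meanFree (mode L₁ L₂ 1 (1, 0)) (1, 0)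
  rw [h, map_zero, if_neg (by simp), coef_mode] at h1
  norm_num at h1

/-- The infimum need not be attained, so a halving time is taken strictly below 2m. -/
lemma exists_halving_time {v : ℝ → Torus L₁ L₂ → EuclideanSpace ℝ (Fin 2)}
    {b : ℝ → Fin 2 → L2 L₁ L₂} {V m : ℝ} (hb : IsField b V)
    (hF : ∀ a : ℝ, IsForce a b (fun τ g x => -(a / 2 * ∑ j, g j x ^ 2) - ∑ j, v τ x j * g j x))
    (hm : 0 < m) (h : dissipationTime v ≤ ENNReal.ofReal m) :
    ∃ τ, 0 < τ ∧ τ < 2 * m ∧ Halves b τ := by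
  have h1 : dissipationTime v < ENNReal.ofReal (2 * m) :=
    h.trans_lt ((ENNReal.ofReal_lt_ofReal_iff (by positivity)).2 (by linarith))
  obtain ⟨_, ⟨τ, ⟨hτ0, hτ⟩, rfl⟩, hlt⟩ := sInf_lt_iff.1 h1
  have hH : Halves b τ := fun s hs f₀ f H hmean hsol =>
    hτ s hs f₀ f hmean ((isAdvHyperSolution_iff hb hF hs (by linarith)).2 ⟨H, hsol⟩)
  -- At τ = 0 the solution operator is the identity, which does not halve a nonzero mean-free
  -- function.
  refine ⟨τ, hτ0.lt_of_ne fun h0 => ?_, (ENNReal.ofReal_lt_ofReal_iff (by positivity)).1 hlt, hH⟩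
  subst h0
  obtain ⟨f₀, hf₀, hne⟩ := exists_meanFree_ne_zero (L₁ := L₁) (L₂ := L₂)
  have := hH 0 le_rfl f₀ (fun _ => f₀) (fun _ => 0) hf₀ (by
    rw [add_zero]
    exact sol_const 0 b 0 f₀)
  have := norm_pos_iff.2 hne
  linarith

/-- A solution that is small in energy at some time is global and bounded. -/
lemma exists_global_sol {b : ℝ → Fin 2 → L2 L₁ L₂} {V μ τ β₀ : ℝ} (hb : IsField b V) (hμ : 0 < μ)
    (hτ : 0 < τ) (hβ₀ : 0 < β₀) (hstep : ∀ β, 0 < β → β ≤ β₀ → StepBound b μ τ β) {t₁ : ℝ}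
    {φ₀ : L2 L₁ L₂} {ψ : ℝ → L2 L₁ L₂} {Ψ : ℝ → Fin 2 → L2 L₁ L₂} (ht₁ : 0 ≤ t₁)
    (h : Sol 1 b 0 t₁ φ₀ ψ Ψ) (h0 : sqSum (fluct (ψ t₁)) ≤ β₀ ^ 2) :
    ∃ Φ : ℝ → L2 L₁ L₂, (∀ T, 0 ≤ T → ∃ G, Sol 1 b 0 T φ₀ Φ G) ∧
      ∃ M : ℝ, ∀ t, 0 ≤ t → ‖Φ t‖ ≤ M := by
  have h1 : (1 : ℝ) ∈ Icc (0 : ℝ) 1 := ⟨zero_le_one, le_rfl⟩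
  have hA := area_pos L₁ L₂
  obtain ⟨M₀, hM₀⟩ := isCompact_Icc.exists_bound_of_continuousOn (h.continuousOn h1 hb)
  set P := ‖coef L₁ L₂ 0 (ψ t₁)‖ +
    (4 * τ + 4) * β₀ ^ 2 / (1 - max (9 / 16) (1 - 2 * μ * τ)) with hP
  -- On [0, t₁] every solution agrees with ψ, bounded by M₀ on a compact interval; after t₁ the
  -- square root bounds the norm through the energy and the mean.
  set R := M₀ + Real.sqrt ((L₁ * L₂) * (4 * β₀ ^ 2 + P ^ 2)) with hR
  have hM₀0 : 0 ≤ M₀ := (norm_nonneg _).trans (hM₀ 0 ⟨le_rfl, ht₁⟩)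
  have hbound : ∀ T u G, 0 ≤ T → Sol 1 b 0 T φ₀ u G → ∀ t ∈ Icc 0 T, ‖u t‖ ≤ R := by
    intro T u G hT hu t ht
    rcases le_total t t₁ with hle | hle
    · rw [(hu.mono ht.2).unique h1 hb (h.mono hle) t ⟨ht.1, le_rfl⟩]
      have := hM₀ t ⟨ht.1, hle⟩
      have := Real.sqrt_nonneg ((L₁ * L₂) * (4 * β₀ ^ 2 + P ^ 2))
      linarith
    · have e : u t₁ = ψ t₁ :=
        (hu.mono (hle.trans ht.2)).unique h1 hb h t₁ ⟨ht₁, le_rfl⟩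
      have hr := hu.restart h1 hb ht₁
      rw [e] at hr
      obtain ⟨b1, b2⟩ := sol_bound hb hμ hτ hβ₀ hstep ht₁ hr h0 ⟨hle, ht.2⟩
      have b3 : ‖coef L₁ L₂ 0 (u t)‖ ≤ P := by
        have := norm_le_norm_sub_add (coef L₁ L₂ 0 (u t)) (coef L₁ L₂ 0 (ψ t₁))
        linarith
      have b4 : ‖u t‖ ^ 2 ≤ (L₁ * L₂) * (4 * β₀ ^ 2 + P ^ 2) := by
        rw [norm_sq_le_meanFree, norm_meanFree_sq_eq, ← mul_add]
        gcongr
      have := Real.le_sqrt_of_sq_le b4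
      linarith
  have hex : ∀ T, ∃ u G, Sol 1 b 0 T φ₀ u G := by
    refine exists_sol_of_bound (R := R) h1 hb (fun T u G hT hu t ht =>
      (norm_meanFree_le _).trans (hbound T u G hT hu t ht)) ((norm_meanFree_le _).trans ?_)
    have := hbound 0 _ _ le_rfl (sol_const 1 b 0 φ₀) 0 ⟨le_rfl, le_rfl⟩
    exact this
  choose U G hU using hex
  have hagree : ∀ T t, t ∈ Icc 0 T → U t t = U T t := fun T t ht =>
    (hU t).unique h1 hb ((hU T).mono ht.2) t ⟨ht.1, le_rfl⟩
  -- The diagonal of the family of solutions on [0, T] agrees with each member by uniqueness.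
  refine ⟨fun t => U t t, fun T hT => ⟨G T, fun t ht => ?_, (hU T).adm, fun t ht k => ?_⟩, R,
    fun t ht => hbound t _ _ ht (hU t) t ⟨ht, le_rfl⟩⟩
  · rw [hagree T t (Ioc_subset_Icc_self ht)]
    exact (hU T).grad t ht
  · rw [hagree T t ht]
    exact (hU T).duh t ht k

end AdvectiveKSE

end

theorem corollary2p12 (L₁ L₂ : ℝ) [Fact (0 < L₁)] [Fact (0 < L₂)] :
    ∃ C : ℝ, 0 < C ∧
      ∀ (μ : ℝ) (v : ℝ → AdvectiveKSE.Torus L₁ L₂ → EuclideanSpace ℝ (Fin 2)) (B : ℝ)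
        (φ₀ : AdvectiveKSE.L2 L₁ L₂),
        0 < μ → AdvectiveKSE.IsLipschitzField v → AdvectiveKSE.IsDivergenceFree v → 0 < B →
        AdvectiveKSE.dissipationTime v ≤
          ENNReal.ofReal (min (min (AdvectiveKSE.timeT0 C B) (AdvectiveKSE.timeT1 C μ B))
            (1 / (4 * μ))) →
        (‖AdvectiveKSE.meanFree φ₀‖ ≤ B ∨
          ∃ (T : ℝ) (φ : ℝ → AdvectiveKSE.L2 L₁ L₂), 0 < T ∧
            AdvectiveKSE.IsKSEMildSolution v T φ₀ φ ∧
            ∃ t₀ ∈ Set.Icc 0 T, ‖AdvectiveKSE.meanFree (φ t₀)‖ ≤ B) →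
        ∃ Φ : ℝ → AdvectiveKSE.L2 L₁ L₂,
          (∀ T, 0 < T → AdvectiveKSE.IsKSEMildSolution v T φ₀ Φ) ∧
          (∃ M : ℝ, ∀ t, 0 ≤ t → ‖Φ t‖ ≤ M) ∧
          ∀ (T : ℝ) (φ : ℝ → AdvectiveKSE.L2 L₁ L₂), 0 < T →
            AdvectiveKSE.IsKSEMildSolution v T φ₀ φ → Set.EqOn φ Φ (Set.Icc 0 T) := by
  have hA := AdvectiveKSE.area_pos L₁ L₂
  have hs : 0 < Real.sqrt (L₁ * L₂) := Real.sqrt_pos.2 hA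
  obtain ⟨c, c₂, hc, hc₂, hstep⟩ := AdvectiveKSE.exists_stepBound L₁ L₂
  obtain ⟨C, hC, hsmall⟩ := AdvectiveKSE.exists_isSmall hc hc₂ hA
  refine ⟨C, hC, fun μ v B φ₀ hμ hv hdiv hB hdis hdata => ?_⟩
  have h1 : (1 : ℝ) ∈ Set.Icc (0 : ℝ) 1 := ⟨zero_le_one, le_rfl⟩
  obtain ⟨b, V, hb, hF⟩ := AdvectiveKSE.exists_field hv hdiv
  have hT1 : 0 < AdvectiveKSE.timeT1 C μ B := by
    have : 0 < Real.sqrt (2 * μ + 4 * C + 64 * C * B ^ 4) := Real.sqrt_pos.2 (by positivity)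
    unfold AdvectiveKSE.timeT1
    positivity
  obtain ⟨τ, hτ, hlt, hhalf⟩ := AdvectiveKSE.exists_halving_time hb hF hT1
    (hdis.trans (ENNReal.ofReal_le_ofReal ((min_le_left _ _).trans (min_le_right _ _))))
  have hsm := hsmall μ B τ hμ hB hτ hlt
  have hK : 0 < 2 * μ + 4 * C + 64 * C * B ^ 4 := by positivity
  -- By Parseval the energy is the squared norm divided by the area, so the norm bound B corresponds
  -- to β₀ = B/√(L₁L₂).
  have hβ₀ : 0 < B / Real.sqrt (L₁ * L₂) := by positivity
  have hN : ∀ w : AdvectiveKSE.L2 L₁ L₂, ‖AdvectiveKSE.meanFree w‖ ≤ B →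
      AdvectiveKSE.sqSum (AdvectiveKSE.fluct w) ≤ (B / Real.sqrt (L₁ * L₂)) ^ 2 := fun w hw => by
    rw [AdvectiveKSE.sqSum_fluct_le_iff hβ₀.le]
    rwa [mul_div_cancel₀ _ hs.ne']
  -- Both forms of the hypothesis supply a solution on some [0, t₁] that is small at t₁; in the
  -- first form t₁ = 0 and the solution is the data.
  have hstart : ∃ t₁, 0 ≤ t₁ ∧ ∃ ψ Ψ, AdvectiveKSE.Sol 1 b 0 t₁ φ₀ ψ Ψ ∧
      AdvectiveKSE.sqSum (AdvectiveKSE.fluct (ψ t₁)) ≤ (B / Real.sqrt (L₁ * L₂)) ^ 2 := by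
    rcases hdata with h | ⟨T, φ, hT, hφ, t₀, ht₀, h⟩
    · exact ⟨0, le_rfl, _, _, AdvectiveKSE.sol_const 1 b 0 φ₀, hN _ h⟩
    · obtain ⟨G, hG⟩ := (AdvectiveKSE.isKSEMildSolution_iff hb hF hT.le).1 hφ
      exact ⟨t₀, ht₀.1, φ, G, hG.mono ht₀.2, hN _ h⟩
  obtain ⟨t₁, ht₁, ψ, Ψ, hψ, hψN⟩ := hstart
  obtain ⟨Φ, hΦ, hM⟩ := AdvectiveKSE.exists_global_sol hb hμ hτ hβ₀
    (fun β hβ hle => hstep b V hb μ _ τ β hK hτ hβ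
      (hsm.mono hc.le hc₂.le hK.le hτ.le hβ.le hle) hhalf) ht₁ hψ hψN
  refine ⟨Φ, fun T hT => (AdvectiveKSE.isKSEMildSolution_iff hb hF hT.le).2 (hΦ T hT.le), hM,
    fun T φ hT hφ t ht => ?_⟩
  obtain ⟨G, hG⟩ := (AdvectiveKSE.isKSEMildSolution_iff hb hF hT.le).1 hφ
  obtain ⟨G', hG'⟩ := hΦ T hT.le
  exact hG.unique h1 hb hG' t ht
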